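/- Fix $T,K\in\mathbb N$. For units $i=1,2,\dots$ and periods $t=1,\dots,T$ let $x_{it}$ be random vectors in $\mathbb R^K$ and $\epsilon_{it}$ random errors; write $x_i=(x_{i1},\dots,x_{iT})'$. For each $N$ let $\{1,\dots,N\}=G_1\cup G_2$ be a partition, where $M=\#G_2\to\infty$ and $M/N\to m_0\in[0,1)$ as $N\to\infty$, let $\gamma=\gamma_N\to\infty$, and let $\lambda_2\in\mathbb R^K$, $\lambda_2\neq0$. The data follow the local alternatives $H_{1,n}$: $y_{it}=x_{it}'\beta_i+\epsilon_{it}$ with $\beta_i=\beta$ for $i\in G_1$ and $\beta_i=\beta+\lambda_2/\gamma$ for $i\in G_2$. *Errors.* Conditionally on all regressors, the $\epsilon_{it}$ are independent over $i$ and $t$, identically distributed over $t$, with mean $0$ and variance $\sigma_i^2>0$, $\sup_i\sigma_i^2<\infty$, and their conditional sixth moments are bounded by a constant. *Regressors.* $\mathbb E|x_{it,k}|^{4+d}\le C<\infty$ for some $d>0$ and all $i,t,k$. The probability limits $$\Sigma=\operatorname*{plim}_{N\to\infty} N^{-1}\sum_{i=1}^N x_i'x_i,\qquad \Sigma^{(G_2)}=\operatorname*{plim}_{N\to\infty}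 M^{-1}\sum_{i\in G_2}x_i'x_i$$ exist and are nonstochastic positive definite matrices. With $u_{i,k}=\sum_{s<t}x_{it,k}x_{it}x_{is,k}x_{is}'$, the nonstochastic limits $U_k=\operatorname{plim}N^{-1}\sum_{i=1}^N u_{i,k}$, $U_k^{(G_2)}=\operatorname{plim}M^{-1}\sum_{i\in G_2}u_{i,k}$ and $\mathcal V=(\mathcal V_{kl})$, $\mathcal V_{kl}=\operatorname{plim}N^{-1}\sum_{i=1}^N\sum_{s<t}\sigma_i^4x_{it,k}x_{it,l}x_{is,k}x_{is,l}$, exist, and $\mathcal V$ is positive definite. Let $LM=\hat s'\hat V^{-1}\hat s$ be the Breitung–Roling–Salish (BRS) statistic, where $\hat\epsilon_{it}=y_{it}-x_{it}'\hat\beta_{LS}$ with $\hat\beta_{LS}=(\sum_{i=1}^N x_i'x_i)^{-1}\sum_{i=1}^N x_i'y_i$, $\hat s_k=\sum_{i=1}^N\sum_{s<t}\hat\epsilon_{it}\hat\epsilon_{is}x_{it,k}x_{is,k}$ and $\hat V_{kl}=\sum_{i=1}^N\sum_{t=2}^T\sum_{s,p=1}^{t-1}\hat\epsilon_{it}^2x_{it,k}x_{it,l}\hat\epsilon_{is}\hat\epsilon_{ip}x_{is,k}x_{ip,l}$.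 Define $d\in\mathbb R^K$ by $$d_k=\lambda_2'U_k^{(G_2)}\lambda_2+m_0\,\lambda_2'\Big(\Sigma^{(G_2)}\Sigma^{-1}U_k\Sigma^{-1}\Sigma^{(G_2)}-\Sigma^{(G_2)}\Sigma^{-1}\big(U_k^{(G_2)}+U_k^{(G_2)\prime}\big)\Big)\lambda_2 .$$ Then, as $N\to\infty$ with $T$ fixed: 1. if $\sqrt M/(\gamma N^{1/4})\to0$, then $LM\overset{d}{\to}\chi^2_K$; 2. if $\sqrt M/(\gamma N^{1/4})\to c>0$, then $LM\overset{d}{\to}\chi^2_K(\delta'\mathcal V^{-1}\delta)$, the noncentral chi-squared law with this noncentrality parameter, where $\delta=c^2d$; 3. if $\sqrt M/(\gamma N^{1/4})\to\infty$ and $d\neq0$, then $LM\to\infty$ in probability, i.e. $P(LM>B)\to1$ for every $B$. Consequently, if $M/\sqrt N\to0$, then $LM\overset{d}{\to}\chi^2_K$, so that the alternatives are undetectable; and if the alternatives are detectable, in the sense that $\liminf_{N\to\infty}P(LM>q)>P(\chi^2_K>q)$ for some critical value $q$, then $M$ grows at least like $\sqrt N$, i.e. $\sqrt N=O(M)$.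 -/

import Mathlib

open MeasureTheory ProbabilityTheory Filter Topology Matrix Finset

noncomputable section

namespace PanelLM

/-! ### Chi-squared laws -/

/-- The central chi-squared law with `K` degrees of freedom: the law of `∑ k, Z k ^ 2`
for `Z` with independent standard normal coordinates. -/
def chiSq (K : ℕ) : Measure ℝ :=
  (Measure.pi fun _ : Fin K => gaussianReal 0 1).map
    fun z : Fin K → ℝ => ∑ k, z k ^ 2

/-- The noncentral chi-squared law with `K ≥ 1` degrees of freedom and noncentrality parameter
`θ ≥ 0`: the law of `(Z 0 + √θ) ^ 2 + ∑ k ≠ 0, Z k ^ 2`. -/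
def noncentralChiSq (K : ℕ) (θ : ℝ) : Measure ℝ :=
  (Measure.pi fun _ : Fin K => gaussianReal 0 1).map
    fun z : Fin K → ℝ => ∑ k, (z k + if (k : ℕ) = 0 then √θ else 0) ^ 2

instance (K : ℕ) : IsProbabilityMeasure (chiSq K) :=
  Measure.isProbabilityMeasure_map (Measurable.aemeasurable (by fun_prop))

instance (K : ℕ) (θ : ℝ) : IsProbabilityMeasure (noncentralChiSq K θ) :=
  Measure.isProbabilityMeasure_map (Measurable.aemeasurable (by fun_prop))

/-! ### The LM statistic, as a function of the data `(y, x)` of the units `0, …, N - 1` -/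

section Statistic

variable {T K : ℕ}

/-- `x_i' x_i = ∑ t, x_it x_it'`. -/
def gram (xi : Fin T → Fin K → ℝ) : Matrix (Fin K) (Fin K) ℝ :=
  ∑ t, vecMulVec (xi t) (xi t)

/-- The pooled least squares estimator `(∑ i, x_i' x_i)⁻¹ ∑ i, x_i' y_i`. -/
def pooledLS (N : ℕ) (y : ℕ → Fin T → ℝ) (x : ℕ → Fin T → Fin K → ℝ) : Fin K → ℝ :=
  (∑ i ∈ range N, gram (x i))⁻¹ *ᵥ ∑ i ∈ range N, ∑ t, y i t • x i t

/-- The pooled least squares residual `y_it - x_it' β̂`. -/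
def residual (N : ℕ) (y : ℕ → Fin T → ℝ) (x : ℕ → Fin T → Fin K → ℝ) (i : ℕ) (t : Fin T) : ℝ :=
  y i t - x i t ⬝ᵥ pooledLS N y x

/-- The score vector. -/
def score (N : ℕ) (y : ℕ → Fin T → ℝ) (x : ℕ → Fin T → Fin K → ℝ) : Fin K → ℝ := fun k =>
  ∑ i ∈ range N, ∑ t, ∑ s ∈ univ.filter (· < t),
    residual N y x i t * residual N y x i s * x i t k * x i s k

/-- The variance estimator of the score. -/
def scoreVar (N : ℕ) (y : ℕ → Fin T → ℝ) (x : ℕ → Fin T → Fin K → ℝ) :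
    Matrix (Fin K) (Fin K) ℝ := Matrix.of fun k l =>
  ∑ i ∈ range N, ∑ t, ∑ s ∈ univ.filter (· < t), ∑ p ∈ univ.filter (· < t),
    residual N y x i t ^ 2 * x i t k * x i t l *
      (residual N y x i s * residual N y x i p) * x i s k * x i p l

/-- The LM statistic `ŝ' V̂⁻¹ ŝ`. -/
def lmStat (N : ℕ) (y : ℕ → Fin T → ℝ) (x : ℕ → Fin T → Fin K → ℝ) : ℝ :=
  score N y x ⬝ᵥ ((scoreVar N y x)⁻¹ *ᵥ score N y x)

/-! ### Unit-level moment matrices and the noncentrality vector -/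

/-- `∑_{s < t} x_it,k x_it x_is,k x_is'`. -/
def unitU (xi : Fin T → Fin K → ℝ) (k : Fin K) : Matrix (Fin K) (Fin K) ℝ :=
  ∑ t, ∑ s ∈ univ.filter (· < t), (xi t k * xi s k) • vecMulVec (xi t) (xi s)

/-- The matrix with entries `∑_{s < t} x_it,k x_it,l x_is,k x_is,l`. -/
def unitV (xi : Fin T → Fin K → ℝ) : Matrix (Fin K) (Fin K) ℝ := Matrix.of fun k l =>
  ∑ t, ∑ s ∈ univ.filter (· < t), xi t k * xi t l * xi s k * xi s l

/-- The vector with `k`-th entry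
`λ' U_k^G λ + m₀ (λ' S^G S⁻¹ U_k S⁻¹ S^G λ - λ' S^G S⁻¹ (U_k^G + (U_k^G)') λ)`. -/
def drift (m₀ : ℝ) (lam : Fin K → ℝ) (S SG : Matrix (Fin K) (Fin K) ℝ)
    (U UG : Fin K → Matrix (Fin K) (Fin K) ℝ) : Fin K → ℝ := fun k =>
  lam ⬝ᵥ (UG k *ᵥ lam) +
    m₀ * (lam ⬝ᵥ ((SG * S⁻¹ * U k * S⁻¹ * SG) *ᵥ lam) -
      lam ⬝ᵥ ((SG * S⁻¹ * (UG k + (UG k)ᵀ)) *ᵥ lam))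

end Statistic

/-! ### The model and its assumptions -/

variable {Ω : Type*} [MeasurableSpace Ω]

/-- The random matrices `A N` converge in probability, entrywise, to the constant matrix `A₀`. -/
def PLim {K : ℕ} (μ : Measure Ω) (A : ℕ → Ω → Matrix (Fin K) (Fin K) ℝ)
    (A₀ : Matrix (Fin K) (Fin K) ℝ) : Prop :=
  ∀ k l, TendstoInMeasure μ (fun N ω => A N ω k l) atTop (fun _ => A₀ k l)

/-- The average of `f i` over a finite set `G` of units. -/
def groupAvg {K : ℕ} (G : Finset ℕ) (f : ℕ → Matrix (Fin K) (Fin K) ℝ) :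
    Matrix (Fin K) (Fin K) ℝ :=
  (#G : ℝ)⁻¹ • ∑ i ∈ G, f i

/-- Errors. Under the conditional law of all errors given all regressors, the errors are
independent over units and periods, identically distributed over the periods of each unit, with
mean zero, variance `σ² i` and uniformly bounded sixth moments; the variances are positive and
bounded. -/
structure Errors {T K : ℕ} (μ : Measure Ω) [IsProbabilityMeasure μ]
    (x : ℕ → Ω → Fin T → Fin K → ℝ) (ε : ℕ → Ω → Fin T → ℝ) (σ2 : ℕ → ℝ) : Prop where
  measurable : ∀ i, Measurable (ε i)
  var_pos : ∀ i, 0 < σ2 i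
  var_bdd : ∃ C, ∀ i, σ2 i ≤ C
  cond : ∃ C : ℝ, ∀ᵐ ω ∂μ,
    let ν : Measure (ℕ × Fin T → ℝ) :=
      condDistrib (fun ω (p : ℕ × Fin T) => ε p.1 ω p.2) (fun ω i => x i ω) μ (fun i => x i ω)
    iIndepFun (fun (p : ℕ × Fin T) (e : ℕ × Fin T → ℝ) => e p) ν ∧
    (∀ i t s, IdentDistrib (fun e : ℕ × Fin T → ℝ => e (i, t)) (fun e => e (i, s)) ν ν) ∧
    ∀ p, ∫ e, e p ∂ν = 0 ∧ ∫ e, e p ^ 2 ∂ν = σ2 p.1 ∧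
      Integrable (fun e => e p ^ 6) ν ∧ ∫ e, e p ^ 6 ∂ν ≤ C

/-- Regressors. Absolute moments of some order `4 + d > 4` are uniformly bounded, and the averages
of `x_i' x_i` over all units and over the groups `G N` have positive definite
nonstochastic probability limits `S` and `SG`. -/
structure Regressors {T K : ℕ} (μ : Measure Ω) (x : ℕ → Ω → Fin T → Fin K → ℝ)
    (G : ℕ → Finset ℕ) (S SG : Matrix (Fin K) (Fin K) ℝ) : Prop where
  measurable : ∀ i, Measurable (x i)
  moments : ∃ d > (0 : ℝ), ∃ C : ℝ, ∀ i t k,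
    Integrable (fun ω => |x i ω t k| ^ (4 + d)) μ ∧ ∫ ω, |x i ω t k| ^ (4 + d) ∂μ ≤ C
  plim : PLim μ (fun N ω => groupAvg (range N) fun i => gram (x i ω)) S
  posDef : S.PosDef
  plim_group : PLim μ (fun N ω => groupAvg (G N) fun i => gram (x i ω)) SG
  posDef_group : SG.PosDef

/-- The sequence of alternatives: the second group `G N` of the units `0, …, N - 1` has a size that
diverges, with `#(G N) / N → m₀ ∈ [0, 1)`, and its slopes differ from the others by
`lam / γ N`, where `lam ≠ 0` and `γ` diverges. -/
structure LocalAlternative {K : ℕ} (G : ℕ → Finset ℕ) (γ : ℕ → ℝ) (lam : Fin K → ℝ)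
    (m₀ : ℝ) : Prop where
  subset : ∀ N, G N ⊆ range N
  size : Tendsto (fun N => #(G N)) atTop atTop
  share : Tendsto (fun N => (#(G N) : ℝ) / N) atTop (𝓝 m₀)
  share_nonneg : 0 ≤ m₀
  share_lt : m₀ < 1
  ne_zero : lam ≠ 0
  scale : Tendsto γ atTop atTop

/-- The slope of unit `i` in the panel with `N` units. -/
def slope {K : ℕ} (β lam : Fin K → ℝ) (G : ℕ → Finset ℕ) (γ : ℕ → ℝ) (N i : ℕ) : Fin K → ℝ :=
  if i ∈ G N then β + (γ N)⁻¹ • lam else β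

/-- The LM statistic of the panel with `N` units, whose data follow the model
`y_it = x_it' (slope of unit i) + ε_it`. -/
def panelLM {T K : ℕ} (x : ℕ → Ω → Fin T → Fin K → ℝ) (ε : ℕ → Ω → Fin T → ℝ)
    (β lam : Fin K → ℝ) (G : ℕ → Finset ℕ) (γ : ℕ → ℝ) (N : ℕ) (ω : Ω) : ℝ :=
  lmStat N (fun i t => x i ω t ⬝ᵥ slope β lam G γ N i + ε i ω t) (fun i => x i ω)

/-- The alternatives are detected: for some critical value `q`, the rejection probability
`P(LM > q)` asymptotically exceeds its limit `P(χ²_K > q)` under slope homogeneity. -/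
def Detects (μ : Measure Ω) (K : ℕ) (LM : ℕ → Ω → ℝ) : Prop :=
  ∃ q : ℝ, chiSq K (Set.Ioi q) < liminf (fun N => μ {ω | q < LM N ω}) atTop

end PanelLM

end

/-! Let the rate be `√M / (γ N^(1/4))`. A residual is the error plus `x_it'` times the gap between
the unit's own slope and the pooled estimator. The score is quadratic in the residuals, so it splits
exactly (`unitScore_add`, `sum_unitScore_add`) into the score of the true errors, a part linear in
the errors with coefficients cubic in the regressors, and a quadratic form in the gaps with the
matrices `unitU`. After division by `√N` the first part is asymptotically `N(0, V)` and the second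
vanishes. The third converges to `c² d` if the rate tends to `c`: the gaps consist of `1/γ` on the
second group and of the shift of the pooled estimator on all units, and the two squares and the
mixed product give the terms of `drift`.

The central limit theorem is proved given the regressors. The score of the errors is then a sum of
independent centred forms, and `norm_charFun_sum_lowerForm_sub_le` compares its characteristic
function with a Gaussian one, at the cost of `∑ ‖x_i‖^6 / N^(3/2)` and `∑ ‖x_i‖^8 / N²`. Slightly
more than four moments suffice for these to vanish, because the largest regressor is `o(N^(1/4))`
(`sum_pow_le_powSum`). As `V` is nonrandom, the expectation over the regressors has the same limit.

Everything else is done for one realisation. Convergence in probability is almost sure convergence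
along further subsequences, which `ASAlong` packages; `PathLimits` lists the limits that are used,
and `PathLimits.tendsto_score_sub` and `PathLimits.tendsto_scoreVar` are deterministic consequences.
Slutsky's theorem then yields the limit law for a finite limit of the rate, and
`exists_root_dotProduct_inv` picks the root of `V` for which this law is literally
`noncentralChiSq`.

If the rate diverges, let `w` be its inverse. Then `w² ŝ/√N` tends to `d ≠ 0` and `w⁴ V̂/N` tends to
`0`, so the bound `ŝ'V̂⁻¹ŝ ≥ (ŝ'ŝ)² / (ŝ'V̂ŝ)` forces divergence. It requires `V̂` to be positive
definite. The limit of `w⁴ V̂/N` is no help there; instead `sq_dotProduct_unitDiff_le` bounds the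
variance estimator from below by a truncation that costs only `4 + q` moments of the regressors.

If `M = o(√N)`, the rate tends to zero. If `√N` is not `O(M)`, a subsequence of groups with `M =
o(√N)` is filled up to a full sequence satisfying all hypotheses with `m₀ = 0`, and its central
limit contradicts detection. -/

noncomputable section

namespace PanelLM

/-! ### Almost sure convergence along subsequences -/

section Along

variable {Ω : Type*} [MeasurableSpace Ω] {μ : Measure Ω}

/-- Every subsequence has a further subsequence along which `P` holds almost surely; `P` may be
used for every filter below the one generated by the subsequence. -/
def ASAlong (μ : Measure Ω) (P : Filter ℕ → Ω → Prop) : Prop :=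
  ∀ ns : ℕ → ℕ, StrictMono ns → ∃ ms : ℕ → ℕ, StrictMono ms ∧
    ∀ᵐ ω ∂μ, ∀ l : Filter ℕ, l.NeBot → l ≤ map (ns ∘ ms) atTop → P l ω

lemma ASAlong.of_tendstoInMeasure {E : Type*} [PseudoEMetricSpace E] {f : ℕ → Ω → E} {g : Ω → E}
    (h : TendstoInMeasure μ f atTop g) :
    ASAlong μ fun l ω => Tendsto (fun n => f n ω) l (𝓝 (g ω)) := by
  intro ns hns
  obtain ⟨ms, hms, hae⟩ := (h.comp hns.tendsto_atTop).exists_seq_tendsto_ae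
  refine ⟨ms, hms, ?_⟩
  filter_upwards [hae] with ω hω l _ hl
  exact Tendsto.mono_left (tendsto_map'_iff.2 hω) hl

/-- A subsequence that serves `P` is thinned to one that serves `Q`. `P` survives the thinning
because it was required for all filters below the first one. -/
lemma ASAlong.and {P Q : Filter ℕ → Ω → Prop} (hP : ASAlong μ P) (hQ : ASAlong μ Q) :
    ASAlong μ fun l ω => P l ω ∧ Q l ω := by
  intro ns hns
  obtain ⟨ms, hms, h1⟩ := hP ns hns
  obtain ⟨ks, hks, h2⟩ := hQ (ns ∘ ms) (hns.comp hms)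
  refine ⟨ms ∘ ks, hms.comp hks, ?_⟩
  filter_upwards [h1, h2] with ω h1 h2 l hn hl
  refine ⟨h1 l hn (hl.trans ?_), h2 l hn hl⟩
  rw [← Function.comp_assoc, ← Filter.map_map]
  exact map_mono hks.tendsto_atTop

lemma ASAlong.mono {P Q : Filter ℕ → Ω → Prop} (hP : ASAlong μ P)
    (h : ∀ l ω, l.NeBot → l ≤ atTop → P l ω → Q l ω) : ASAlong μ Q := by
  intro ns hns
  obtain ⟨ms, hms, h1⟩ := hP ns hns
  refine ⟨ms, hms, ?_⟩
  filter_upwards [h1] with ω h1 l hn hl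
  exact h l ω hn (hl.trans (hns.comp hms).tendsto_atTop) (h1 l hn hl)

lemma ASAlong.forall {ι : Type*} [Finite ι] {P : ι → Filter ℕ → Ω → Prop}
    (h : ∀ i, ASAlong μ (P i)) : ASAlong μ fun l ω => ∀ i, P i l ω := by
  classical
  have := Fintype.ofFinite ι
  have key : ∀ s : Finset ι, ASAlong μ fun l ω => ∀ i ∈ s, P i l ω := by
    intro s
    induction s using Finset.induction_on with
    | empty => exact fun ns _ => ⟨id, strictMono_id, by simp⟩
    | insert a s _ ih =>
      refine ((h a).and ih).mono fun l ω _ _ h i hi => ?_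
      rcases Finset.mem_insert.1 hi with rfl | hi
      exacts [h.1, h.2 i hi]
  exact (key univ).mono fun l ω _ _ h i => h i (mem_univ i)

lemma ASAlong.tendstoInMeasure [IsFiniteMeasure μ] {E : Type*} [PseudoEMetricSpace E]
    {f : ℕ → Ω → E} {g : Ω → E} (hf : ∀ n, AEStronglyMeasurable (f n) μ)
    (h : ASAlong μ fun l ω => Tendsto (fun n => f n ω) l (𝓝 (g ω))) :
    TendstoInMeasure μ f atTop g := by
  rw [exists_seq_tendstoInMeasure_atTop_iff hf]
  intro ns hns
  obtain ⟨ms, hms, h1⟩ := h ns hns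
  refine ⟨ms, hms, ?_⟩
  filter_upwards [h1] with ω h1
  exact tendsto_map'_iff.1 (h1 _ inferInstance le_rfl)

/-- Divergence is not convergence in measure to a real function, so it is passed through the
indicators of `{f n ≤ B}`, which are eventually zero along every good filter. -/
lemma tendsto_measure_lt_of_asAlong [IsProbabilityMeasure μ] {f : ℕ → Ω → ℝ}
    (hf : ∀ n, Measurable (f n)) (h : ASAlong μ fun l ω => Tendsto (fun n => f n ω) l atTop)
    (B : ℝ) : Tendsto (fun n => μ {ω | B < f n ω}) atTop (𝓝 1) := by
  have hm : ∀ n, MeasurableSet {ω | f n ω ≤ B} := fun n => measurableSet_le (hf n) measurable_const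
  have h1 : TendstoInMeasure μ (fun n => Set.indicator {ω | f n ω ≤ B} (1 : Ω → ℝ)) atTop 0 := by
    refine ASAlong.tendstoInMeasure
      (fun n => (measurable_one.indicator (hm n)).aestronglyMeasurable) ?_
    refine h.mono fun l ω _ _ h => tendsto_const_nhds.congr' ?_
    filter_upwards [h.eventually_gt_atTop B] with n hn
    simp [hn]
  have h2 : Tendsto (fun n => μ {ω | f n ω ≤ B}) atTop (𝓝 0) := by
    have := h1 1 one_pos
    refine this.congr fun n => ?_
    congr 1
    ext ω
    by_cases hω : f n ω ≤ B <;> simp [Set.indicator, hω]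
  have h3 := ENNReal.Tendsto.sub (tendsto_const_nhds (x := (1 : ENNReal)) (f := atTop)) h2
    (Or.inl ENNReal.one_ne_top)
  rw [tsub_zero] at h3
  refine h3.congr fun n => ?_
  rw [← prob_compl_eq_one_sub (hm n)]
  congr 1
  ext ω
  simp

end Along

/-! ### Convergence in probability from bounds on moments -/

section Moments

variable {Ω : Type*} [MeasurableSpace Ω] {μ : Measure Ω}

lemma tendstoInMeasure_zero_of_lintegral_le {f : ℕ → Ω → ℝ} (hf : ∀ n, Measurable (f n))
    {b : ℕ → ℝ} (hb : ∀ n, ∫⁻ ω, ‖f n ω‖ₑ ∂μ ≤ ENNReal.ofReal (b n))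
    (h : Tendsto b atTop (𝓝 0)) : TendstoInMeasure μ f atTop 0 := by
  refine tendstoInMeasure_of_tendsto_eLpNorm one_ne_zero
    (fun n => (hf n).aestronglyMeasurable) measurable_zero.aestronglyMeasurable ?_
  refine tendsto_of_tendsto_of_tendsto_of_le_of_le tendsto_const_nhds
    (by simpa using ENNReal.tendsto_ofReal h) (fun _ => zero_le) fun n => ?_
  rw [sub_zero, eLpNorm_one_eq_lintegral_enorm]
  exact hb n

lemma tendstoInMeasure_zero_of_sq {f : ℕ → Ω → ℝ}
    (h : TendstoInMeasure μ (fun n ω => f n ω ^ 2) atTop 0) : TendstoInMeasure μ f atTop 0 := by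
  rw [tendstoInMeasure_iff_norm] at h ⊢
  intro δ hδ
  refine (h (δ ^ 2) (by positivity)).congr fun n => ?_
  congr 1
  ext ω
  simp only [Pi.zero_apply, sub_zero, norm_pow, Set.mem_ofPred_eq]
  exact pow_le_pow_iff_left₀ hδ.le (norm_nonneg _) two_ne_zero

variable [IsProbabilityMeasure μ] {𝓧 𝓔 : Type*} [MeasurableSpace 𝓧] [MeasurableSpace 𝓔] [StandardBorelSpace 𝓔] [Nonempty 𝓔]
  {X : Ω → 𝓧} {E : Ω → 𝓔}

lemma lintegral_eq_lintegral_condDistrib (hX : Measurable X) (hE : Measurable E)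
    {f : 𝓧 × 𝓔 → ENNReal} (hf : Measurable f) :
    ∫⁻ ω, f (X ω, E ω) ∂μ = ∫⁻ ω, ∫⁻ e, f (X ω, e) ∂condDistrib E X μ (X ω) ∂μ := by
  rw [← lintegral_map hf (hX.prodMk hE), ← compProd_map_condDistrib hE.aemeasurable,
    Measure.lintegral_compProd hf, lintegral_map hf.lintegral_kernel_prod_right' hX]

/-- Markov's inequality under the conditional law. Where the conditional bound is below `ρ`, a
deviation `δ` has conditional probability at most `ρ / δ`; elsewhere probability is bounded by one.
Hence the bound need only vanish in probability, not in mean. -/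
lemma tendstoInMeasure_zero_of_condDistrib (hX : Measurable X) (hE : Measurable E)
    {f : ℕ → 𝓧 → 𝓔 → ℝ} (hf : ∀ n, Measurable (Function.uncurry (f n)))
    {b : ℕ → 𝓧 → ℝ}
    (hb : ∀ n, ∀ᵐ ω ∂μ, ∫⁻ e, ‖f n (X ω) e‖ₑ ∂condDistrib E X μ (X ω) ≤ ENNReal.ofReal (b n (X ω)))
    (h : TendstoInMeasure μ (fun n ω => b n (X ω)) atTop 0) :
    TendstoInMeasure μ (fun n ω => f n (X ω) (E ω)) atTop 0 := by
  rw [tendstoInMeasure_iff_norm] at h ⊢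
  intro δ hδ
  simp only [Pi.zero_apply, sub_zero] at h ⊢
  have key : ∀ ρ > 0, ∀ n, μ {ω | δ ≤ ‖f n (X ω) (E ω)‖} ≤
      μ {ω | ρ ≤ ‖b n (X ω)‖} + ENNReal.ofReal (ρ / δ) := by
    intro ρ hρ n
    have hS : MeasurableSet {p : 𝓧 × 𝓔 | δ ≤ ‖f n p.1 p.2‖} :=
      measurableSet_le measurable_const (hf n).norm
    calc μ {ω | δ ≤ ‖f n (X ω) (E ω)‖}
        = ∫⁻ ω, Set.indicator {p : 𝓧 × 𝓔 | δ ≤ ‖f n p.1 p.2‖} 1 (X ω, E ω) ∂μ := by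
          exact (lintegral_indicator_one (hS.preimage (hX.prodMk hE))).symm
      _ = ∫⁻ ω, condDistrib E X μ (X ω) {e | δ ≤ ‖f n (X ω) e‖} ∂μ := by
          rw [lintegral_eq_lintegral_condDistrib hX hE (measurable_one.indicator hS)]
          refine lintegral_congr fun ω => ?_
          exact lintegral_indicator_one (hS.preimage measurable_prodMk_left)
      _ ≤ ∫⁻ ω, (Set.indicator {ω | ρ ≤ ‖b n (X ω)‖} 1 ω + ENNReal.ofReal (ρ / δ)) ∂μ := by
          refine lintegral_mono_ae ?_
          filter_upwards [hb n] with ω hω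
          by_cases hr : ρ ≤ ‖b n (X ω)‖
          · simp only [Set.indicator, Set.mem_ofPred_eq, hr, if_true, Pi.one_apply]
            exact prob_le_one.trans le_self_add
          · simp only [Set.indicator, Set.mem_ofPred_eq, hr, if_false, zero_add]
            have hfm : Measurable (f n (X ω)) := (hf n).comp measurable_prodMk_left
            have hc := mul_meas_ge_le_lintegral (μ := condDistrib E X μ (X ω))
              hfm.enorm (ENNReal.ofReal δ)
            have hset : {e | δ ≤ ‖f n (X ω) e‖} = {e | ENNReal.ofReal δ ≤ ‖f n (X ω) e‖ₑ} := by
              ext e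
              simp only [Set.mem_ofPred_eq]
              rw [← ofReal_norm, ENNReal.ofReal_le_ofReal_iff (norm_nonneg _)]
            rw [hset, ENNReal.ofReal_div_of_pos hδ,
              ENNReal.le_div_iff_mul_le (by simp [hδ]) (by simp), mul_comm]
            refine hc.trans (hω.trans (ENNReal.ofReal_le_ofReal ?_))
            exact (le_abs_self _).trans (not_le.1 hr).le
      _ ≤ _ := by
          rw [lintegral_add_right _ measurable_const, lintegral_const, measure_univ, mul_one]
          gcongr
          exact lintegral_indicator_one_le _
  rw [ENNReal.tendsto_nhds_zero]
  intro η hη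
  by_cases hη' : η = ⊤
  · simp [hη']
  have hηr : 0 < η.toReal := ENNReal.toReal_pos hη.ne' hη'
  -- The choice `ρ = δ η / 2` makes `ρ / δ` half of the allowed `η`.
  have h2 := (ENNReal.tendsto_nhds_zero.1 (h (δ * (η.toReal / 2)) (by positivity))) (η / 2)
    (by simpa using hη.ne')
  filter_upwards [h2] with n hn
  refine (key (δ * (η.toReal / 2)) (by positivity) n).trans ?_
  rw [mul_div_cancel_left₀ _ hδ.ne', ENNReal.ofReal_div_of_pos two_pos, ENNReal.ofReal_toReal hη']
  exact (add_le_add hn (by simp)).trans (ENNReal.add_halves η).le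

lemma tendstoInMeasure_zero_of_condDistrib_sq (hX : Measurable X) (hE : Measurable E)
    {f : ℕ → 𝓧 → 𝓔 → ℝ} (hf : ∀ n, Measurable (Function.uncurry (f n)))
    {b : ℕ → 𝓧 → ℝ}
    (hb : ∀ n, ∀ᵐ ω ∂μ,
      ∫⁻ e, ‖f n (X ω) e ^ 2‖ₑ ∂condDistrib E X μ (X ω) ≤ ENNReal.ofReal (b n (X ω)))
    (h : TendstoInMeasure μ (fun n ω => b n (X ω)) atTop 0) :
    TendstoInMeasure μ (fun n ω => f n (X ω) (E ω)) atTop 0 :=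
  tendstoInMeasure_zero_of_sq (tendstoInMeasure_zero_of_condDistrib hX hE
    (f := fun n x e => f n x e ^ 2) (fun n => (hf n).pow_const 2) hb h)

end Moments

/-! ### Moments under a law with independent coordinates -/

section ErrorLaw

lemma lintegral_enorm_le_ofReal {α : Type*} [MeasurableSpace α] {ν : Measure α} {f : α → ℝ} {b : ℝ}
    (hf : Integrable f ν) (h0 : ∀ a, 0 ≤ f a) (h : ∫ a, f a ∂ν ≤ b) :
    ∫⁻ a, ‖f a‖ₑ ∂ν ≤ ENNReal.ofReal b := by
  rw [← ofReal_integral_norm_eq_lintegral_enorm hf]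
  refine ENNReal.ofReal_le_ofReal (le_trans (le_of_eq ?_) h)
  exact integral_congr_ae (.of_forall fun a => Real.norm_of_nonneg (h0 a))

/-- The errors of all units and periods are independent, with mean zero, variances `σ2` and sixth
moments bounded by `C`. -/
structure ErrorLaw {T : ℕ} (ν : Measure (ℕ × Fin T → ℝ)) (σ2 : ℕ → ℝ) (C : ℝ) : Prop where
  indep : iIndepFun (fun (p : ℕ × Fin T) (e : ℕ × Fin T → ℝ) => e p) ν
  mean : ∀ p, ∫ e, e p ∂ν = 0
  var : ∀ p, ∫ e, e p ^ 2 ∂ν = σ2 p.1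
  integrable_six : ∀ p, Integrable (fun e => e p ^ 6) ν
  six : ∀ p, ∫ e, e p ^ 6 ∂ν ≤ C

namespace ErrorLaw

variable {T : ℕ} {ν : Measure (ℕ × Fin T → ℝ)} {σ2 : ℕ → ℝ} {C : ℝ}

lemma isProbabilityMeasure (h : ErrorLaw ν σ2 C) : IsProbabilityMeasure ν :=
  h.indep.isProbabilityMeasure

lemma pow_le_one_add_six (u : ℝ) {k : ℕ} (hk : k ≤ 6) : |u| ^ k ≤ 1 + u ^ 6 := by
  have h6 : u ^ 6 = |u| ^ 6 := by rw [pow_abs, abs_of_nonneg (by positivity)]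
  rw [h6]
  rcases le_total |u| 1 with h | h
  · have := pow_le_one₀ (n := k) (abs_nonneg u) h
    have := pow_nonneg (abs_nonneg u) 6
    linarith
  · have := pow_le_pow_right₀ h hk
    linarith

lemma integrable_abs_pow (h : ErrorLaw ν σ2 C) (p : ℕ × Fin T) {k : ℕ} (hk : k ≤ 6) :
    Integrable (fun e => |e p| ^ k) ν := by
  have := h.isProbabilityMeasure
  refine ((integrable_const 1).add (h.integrable_six p)).mono'
    (Measurable.aestronglyMeasurable (by fun_prop)) (.of_forall fun e => ?_)
  rw [Real.norm_of_nonneg (by positivity)]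
  exact pow_le_one_add_six _ hk

lemma integrable_pow (h : ErrorLaw ν σ2 C) (p : ℕ × Fin T) {k : ℕ} (hk : k ≤ 6) :
    Integrable (fun e => e p ^ k) ν := by
  refine (h.integrable_abs_pow p hk).mono (Measurable.aestronglyMeasurable (by fun_prop))
    (.of_forall fun e => ?_)
  simp

lemma integral_abs_pow_le (h : ErrorLaw ν σ2 C) (p : ℕ × Fin T) {k : ℕ} (hk : k ≤ 6) :
    ∫ e, |e p| ^ k ∂ν ≤ 1 + C := by
  have := h.isProbabilityMeasure
  calc ∫ e, |e p| ^ k ∂ν ≤ ∫ e, (1 + e p ^ 6) ∂ν :=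
        integral_mono (h.integrable_abs_pow p hk) ((integrable_const 1).add (h.integrable_six p))
          fun e => pow_le_one_add_six _ hk
    _ = 1 + ∫ e, e p ^ 6 ∂ν := by
        rw [integral_add (integrable_const _) (h.integrable_six p)]
        simp
    _ ≤ 1 + C := by linarith [h.six p]

lemma indep_unit (h : ErrorLaw ν σ2 C) (i : ℕ) :
    iIndepFun (fun (t : Fin T) (e : ℕ × Fin T → ℝ) => e (i, t)) ν :=
  h.indep.precomp (g := fun t => (i, t)) fun _ _ h => (Prod.ext_iff.1 h).2

/-- Joint independence makes the law of the error array a product over pairs (unit, period).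
Currying turns it into a product over units of products over periods. -/
lemma indep_blocks (h : ErrorLaw ν σ2 C) :
    iIndepFun (fun (i : ℕ) (e : ℕ × Fin T → ℝ) (t : Fin T) => e (i, t)) ν := by
  have := h.isProbabilityMeasure
  have hpr : ∀ (i : ℕ) (t : Fin T),
      IsProbabilityMeasure (ν.map fun e : ℕ × Fin T → ℝ => e (i, t)) :=
    fun i t => Measure.isProbabilityMeasure_map (measurable_pi_apply _).aemeasurable
  rw [iIndepFun_iff_map_fun_eq_infinitePi_map (by fun_prop)]
  have h1 := (iIndepFun_iff_map_fun_eq_infinitePi_map (by fun_prop)).1 h.indep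
  have h2 : ∀ i, (ν.map fun (e : ℕ × Fin T → ℝ) (t : Fin T) => e (i, t)) =
      Measure.infinitePi fun t => ν.map fun e : ℕ × Fin T → ℝ => e (i, t) := fun i =>
    (iIndepFun_iff_map_fun_eq_infinitePi_map (by fun_prop)).1 (h.indep_unit i)
  simp_rw [h2]
  rw [← Measure.infinitePi_map_curry
    (μ := fun (i : ℕ) (t : Fin T) => ν.map fun e : ℕ × Fin T → ℝ => e (i, t)), ← h1,
    Measure.map_map (by fun_prop) (by fun_prop)]
  rfl

/-! #### Linear forms -/

/-- The terms are centred and pairwise independent, so the second moment is a variance and is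
additive. -/
lemma lintegral_linear_sq_le (h : ErrorLaw ν σ2 C) {D : ℝ} (hD : ∀ i, σ2 i ≤ D)
    (A : Finset ℕ) (c : ℕ → Fin T → ℝ) :
    ∫⁻ e, ‖(∑ i ∈ A, ∑ t, c i t * e (i, t)) ^ 2‖ₑ ∂ν ≤
      ENNReal.ofReal (D * ∑ i ∈ A, ∑ t, c i t ^ 2) := by
  have := h.isProbabilityMeasure
  have hL : ∀ p : ℕ × Fin T, MemLp (fun e : ℕ × Fin T → ℝ => c p.1 p.2 * e p) 2 ν := fun p => by
    refine MemLp.const_mul ?_ _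
    rw [memLp_two_iff_integrable_sq (Measurable.aestronglyMeasurable (by fun_prop))]
    exact h.integrable_pow p (by norm_num)
  have hsum : (fun e : ℕ × Fin T → ℝ => ∑ i ∈ A, ∑ t, c i t * e (i, t)) =
      ∑ p ∈ A ×ˢ univ, fun e : ℕ × Fin T → ℝ => c p.1 p.2 * e p := by
    ext e
    rw [Finset.sum_apply, Finset.sum_product]
  have hmem : MemLp (fun e : ℕ × Fin T → ℝ => ∑ i ∈ A, ∑ t, c i t * e (i, t)) 2 ν := by
    rw [hsum]
    exact memLp_finsetSum' _ fun p _ => hL p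
  have hmean : ∫ e, (∑ i ∈ A, ∑ t, c i t * e (i, t)) ∂ν = 0 := by
    have hsum' : ∀ e : ℕ × Fin T → ℝ, ∑ i ∈ A, ∑ t, c i t * e (i, t) =
        ∑ p ∈ A ×ˢ univ, c p.1 p.2 * e p := fun e => by rw [Finset.sum_product]
    simp_rw [hsum']
    rw [integral_finsetSum _ fun p _ => (hL p).integrable one_le_two]
    exact Finset.sum_eq_zero fun p _ => by rw [integral_const_mul, h.mean, mul_zero]
  refine lintegral_enorm_le_ofReal hmem.integrable_sq (fun e => sq_nonneg _) ?_
  rw [← variance_of_integral_eq_zero hmem.aemeasurable hmean, hsum,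
    IndepFun.variance_sum (fun p _ => hL p) fun p _ q _ hpq => ?_, Finset.sum_product,
    Finset.mul_sum]
  · refine Finset.sum_le_sum fun i _ => ?_
    rw [Finset.mul_sum]
    refine Finset.sum_le_sum fun t _ => ?_
    rw [variance_const_mul, variance_of_integral_eq_zero (measurable_pi_apply _).aemeasurable (h.mean _), h.var, mul_comm]
    exact mul_le_mul_of_nonneg_right (hD i) (sq_nonneg _)
  · exact (h.indep.indepFun hpq).comp (φ := fun u => c p.1 p.2 * u) (ψ := fun u => c q.1 q.2 * u)
      (by fun_prop) (by fun_prop)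

/-! #### Products of the errors of one unit -/

/-- Period `t` occurs exactly once, so once the powers are collected by period its factor is a mean.
Coincidences among `a`, `b`, `c` do not matter. -/
lemma integral_mul_eq_zero_of_ne (h : ErrorLaw ν σ2 C) (i : ℕ) {t a b c : Fin T}
    (ha : t ≠ a) (hb : t ≠ b) (hc : t ≠ c) :
    ∫ e, e (i, t) * e (i, a) * e (i, b) * e (i, c) ∂ν = 0 := by
  have := h.isProbabilityMeasure
  -- `n r` is the multiplicity of period `r` in the product.
  let n : Fin T → ℕ := fun r => (if t = r then 1 else 0) + (if a = r then 1 else 0) +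
    (if b = r then 1 else 0) + (if c = r then 1 else 0)
  have h1 : ∀ e : ℕ × Fin T → ℝ,
      e (i, t) * e (i, a) * e (i, b) * e (i, c) = ∏ r, e (i, r) ^ n r := fun e => by
    simp only [n, pow_add, Finset.prod_mul_distrib, Finset.prod_pow_boole, mem_univ, if_true]
  simp_rw [h1]
  rw [(h.indep_unit i).integral_fun_prod_comp (f := fun r u => u ^ n r)
    (fun r => (measurable_pi_apply _).aemeasurable) (fun r => Measurable.aestronglyMeasurable (by fun_prop))]
  refine Finset.prod_eq_zero (mem_univ t) ?_
  have : n t = 1 := by simp [n, ha.symm, hb.symm, hc.symm]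
  simp [this, h.mean]

lemma integral_pow_mul_pow (h : ErrorLaw ν σ2 C) (i : ℕ) {t s : Fin T} (hts : t ≠ s) (k : ℕ) :
    ∫ e, e (i, t) ^ k * e (i, s) ^ k ∂ν = (∫ e, e (i, t) ^ k ∂ν) * ∫ e, e (i, s) ^ k ∂ν :=
  ((h.indep_unit i).indepFun hts).integral_fun_comp_mul_comp (f := fun u => u ^ k)
    (g := fun u => u ^ k) (measurable_pi_apply _).aemeasurable (measurable_pi_apply _).aemeasurable
    (Measurable.aestronglyMeasurable (by fun_prop)) (Measurable.aestronglyMeasurable (by fun_prop))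

lemma integrable_pow_mul_pow (h : ErrorLaw ν σ2 C) (i : ℕ) {t s : Fin T} (hts : t ≠ s) {k : ℕ}
    (hk : k ≤ 6) : Integrable (fun e => e (i, t) ^ k * e (i, s) ^ k) ν :=
  IndepFun.integrable_mul (((h.indep_unit i).indepFun hts).comp (φ := fun u => u ^ k)
    (ψ := fun u => u ^ k) (by fun_prop) (by fun_prop)) (h.integrable_pow _ hk)
    (h.integrable_pow _ hk)

lemma integrable_mul_four (h : ErrorLaw ν σ2 C) (i : ℕ) (t a b c : Fin T) :
    Integrable (fun e => e (i, t) * e (i, a) * e (i, b) * e (i, c)) ν := by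
  refine ((((h.integrable_pow (i, t) (k := 4) (by norm_num)).add
    (h.integrable_pow (i, a) (k := 4) (by norm_num))).add
    (h.integrable_pow (i, b) (k := 4) (by norm_num))).add
    (h.integrable_pow (i, c) (k := 4) (by norm_num))).mono'
    (Measurable.aestronglyMeasurable (by fun_prop)) (.of_forall fun e => ?_)
  simp only [Pi.add_apply, Real.norm_eq_abs]
  rw [abs_le]
  constructor <;>
  nlinarith [sq_nonneg (e (i, t) * e (i, a) - e (i, b) * e (i, c)),
    sq_nonneg (e (i, t) * e (i, a) + e (i, b) * e (i, c)),
    sq_nonneg (e (i, t) ^ 2 - e (i, a) ^ 2), sq_nonneg (e (i, b) ^ 2 - e (i, c) ^ 2),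
    sq_nonneg (e (i, t) ^ 2), sq_nonneg (e (i, a) ^ 2), sq_nonneg (e (i, b) ^ 2),
    sq_nonneg (e (i, c) ^ 2)]

/-- Products over distinct ordered pairs are orthogonal, because some period is unmatched: the later
of `t` and `t'` if they differ, and `s` if they coincide. -/
lemma integral_four (h : ErrorLaw ν σ2 C) (i : ℕ) {t s t' s' : Fin T} (hs : s < t) (hs' : s' < t') :
    ∫ e, e (i, t) * e (i, s) * e (i, t') * e (i, s') ∂ν =
      if t = t' ∧ s = s' then σ2 i ^ 2 else 0 := by
  split_ifs with hc
  · obtain ⟨rfl, rfl⟩ := hc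
    have := h.integral_pow_mul_pow i hs.ne' 2
    rw [h.var, h.var] at this
    rw [sq (σ2 i), ← this]
    exact integral_congr_ae (.of_forall fun e => by dsimp only; ring)
  · rcases lt_trichotomy t t' with ht | ht | ht
    · rw [← h.integral_mul_eq_zero_of_ne i (t := t') (a := t) (b := s) (c := s') ht.ne'
        (hs.trans ht).ne' hs'.ne']
      exact integral_congr_ae (.of_forall fun e => by dsimp only; ring)
    · have hss : s ≠ s' := fun h => hc ⟨ht, h⟩
      rw [← h.integral_mul_eq_zero_of_ne i (t := s) (a := t) (b := t') (c := s') hs.ne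
        (ht ▸ hs.ne) hss]
      exact integral_congr_ae (.of_forall fun e => by dsimp only; ring)
    · exact h.integral_mul_eq_zero_of_ne i hs.ne' ht.ne' (hs'.trans ht).ne'

end ErrorLaw

end ErrorLaw

/-! ### Quadratic and quartic forms in the errors of one unit -/

section Forms

variable {T : ℕ}

/-- The form `∑_{s < t} B t s u_t u_s`. -/
def lowerForm (B : Fin T → Fin T → ℝ) (u : Fin T → ℝ) : ℝ :=
  ∑ t, ∑ s ∈ univ.filter (· < t), B t s * (u t * u s)

/-- The form `∑_{s, p < t} B t s p u_t² u_s u_p`. -/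
def quarticForm (B : Fin T → Fin T → Fin T → ℝ) (u : Fin T → ℝ) : ℝ :=
  ∑ t, ∑ s ∈ univ.filter (· < t), ∑ p ∈ univ.filter (· < t), B t s p * (u t * u s * u t * u p)

lemma measurable_lowerForm (B : Fin T → Fin T → ℝ) : Measurable (lowerForm B) := by
  unfold lowerForm; fun_prop

lemma measurable_quarticForm (B : Fin T → Fin T → Fin T → ℝ) : Measurable (quarticForm B) := by
  unfold quarticForm; fun_prop

lemma abs_apply_le_norm (u : Fin T → ℝ) (t : Fin T) : |u t| ≤ ‖u‖ := norm_le_pi_norm u t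

lemma sum_filter_lt_le {f : Fin T → ℝ} {c : ℝ} (hc : 0 ≤ c) (hf : ∀ s, f s ≤ c) (t : Fin T) :
    ∑ s ∈ univ.filter (· < t), f s ≤ T * c := by
  calc ∑ s ∈ univ.filter (· < t), f s ≤ ∑ s ∈ univ.filter (· < t), c :=
        Finset.sum_le_sum fun s _ => hf s
    _ = (#(univ.filter (· < t)) : ℝ) * c := by rw [Finset.sum_const, nsmul_eq_mul]
    _ ≤ T * c := by
        gcongr
        exact (card_filter_le _ _).trans (by simp)

lemma sum_univ_le {f : Fin T → ℝ} {c : ℝ} (hf : ∀ s, f s ≤ c) :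
    ∑ s, f s ≤ T * c := by
  refine (Finset.sum_le_sum fun s _ => hf s).trans ?_
  simp

/-- The form has degree two, so its cube is dominated by the sixth power of the norm, whose moment
is the highest one available. -/
lemma abs_lowerForm_le {B : Fin T → Fin T → ℝ} {β : ℝ} (hB : ∀ t s, |B t s| ≤ β)
    (hβ : 0 ≤ β) (u : Fin T → ℝ) : |lowerForm B u| ≤ T ^ 2 * β * ‖u‖ ^ 2 := by
  have h1 : ∀ t s, |B t s * (u t * u s)| ≤ β * ‖u‖ ^ 2 := fun t s => by
    rw [abs_mul, abs_mul, sq]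
    exact mul_le_mul (hB t s) (mul_le_mul (abs_apply_le_norm u t) (abs_apply_le_norm u s)
      (abs_nonneg _) (norm_nonneg _)) (by positivity) hβ
  calc |lowerForm B u| ≤ ∑ t, ∑ s ∈ univ.filter (· < t), |B t s * (u t * u s)| :=
        (abs_sum_le_sum_abs _ _).trans (Finset.sum_le_sum fun t _ => abs_sum_le_sum_abs _ _)
    _ ≤ T * (T * (β * ‖u‖ ^ 2)) :=
        sum_univ_le fun t => sum_filter_lt_le (by positivity) (h1 t) t
    _ = _ := by ring

lemma norm_pow_le_sum (u : Fin T → ℝ) {k : ℕ} (hk : k ≠ 0) : ‖u‖ ^ k ≤ ∑ t, |u t| ^ k := by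
  rcases isEmpty_or_nonempty (Fin T) with h | h
  · simp [Subsingleton.elim u 0, hk]
  · obtain ⟨t, ht⟩ : ∃ t, ‖u t‖ = ‖u‖ := by
      obtain ⟨t, -, ht⟩ := Finset.exists_mem_eq_sup' (univ_nonempty (α := Fin T)) fun t => ‖u t‖
      refine ⟨t, le_antisymm (norm_le_pi_norm u t) ?_⟩
      rw [← ht]
      exact (pi_norm_le_iff_of_nonempty _).2 fun b => Finset.le_sup' (fun t => ‖u t‖) (mem_univ b)
    rw [← ht, Real.norm_eq_abs]
    exact Finset.single_le_sum (f := fun t => |u t| ^ k) (fun s _ => by positivity) (mem_univ t)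

/-- A bound by `‖u‖ ^ 8` would need eighth moments. Cauchy–Schwarz over the periods instead leaves
products `u_t⁴ u_s⁴` with `s < t`, which factor under independence and need only fourth moments. -/
lemma quarticForm_sq_le {B : Fin T → Fin T → Fin T → ℝ} {β : ℝ} (hB : ∀ t s p, |B t s p| ≤ β)
    (u : Fin T → ℝ) :
    quarticForm B u ^ 2 ≤
      T ^ 4 * β ^ 2 * ∑ t, ∑ s ∈ univ.filter (· < t), u t ^ 4 * u s ^ 4 := by
  have hcard : ∀ t : Fin T, (#(univ.filter (· < t)) : ℝ) ≤ T := fun t => by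
    exact_mod_cast (card_filter_le _ _).trans (by simp)
  have h1 : ∀ t, |∑ s ∈ univ.filter (· < t), ∑ p ∈ univ.filter (· < t),
      B t s p * (u t * u s * u t * u p)| ≤ β * (T * ∑ s ∈ univ.filter (· < t), u t ^ 2 * u s ^ 2) := by
    intro t
    by_cases hβ : 0 ≤ β
    · calc _ ≤ ∑ s ∈ univ.filter (· < t), ∑ p ∈ univ.filter (· < t),
            β * (u t ^ 2 * (|u s| * |u p|)) := by
            refine (abs_sum_le_sum_abs _ _).trans (Finset.sum_le_sum fun s _ =>
              (abs_sum_le_sum_abs _ _).trans (Finset.sum_le_sum fun p _ => ?_))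
            rw [abs_mul]
            refine mul_le_mul (hB t s p) (le_of_eq ?_) (abs_nonneg _) hβ
            rw [abs_mul, abs_mul, abs_mul, ← sq_abs (u t)]
            ring
        _ = β * (u t ^ 2 * (∑ s ∈ univ.filter (· < t), |u s|) ^ 2) := by
            rw [sq (∑ s ∈ univ.filter (· < t), |u s|), Finset.sum_mul_sum, Finset.mul_sum,
              Finset.mul_sum]
            exact Finset.sum_congr rfl fun s _ => by rw [Finset.mul_sum, Finset.mul_sum]
        _ ≤ β * (u t ^ 2 * (T * ∑ s ∈ univ.filter (· < t), |u s| ^ 2)) := by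
            have hsq := sq_sum_le_card_mul_sum_sq (s := univ.filter (· < t)) (f := fun s => |u s|)
            have h0 : 0 ≤ ∑ s ∈ univ.filter (· < t), |u s| ^ 2 :=
              Finset.sum_nonneg fun s _ => by positivity
            exact mul_le_mul_of_nonneg_left (mul_le_mul_of_nonneg_left
              (hsq.trans (mul_le_mul_of_nonneg_right (hcard t) h0)) (sq_nonneg _)) hβ
        _ = _ := by
            rw [← Finset.mul_sum]
            simp only [sq_abs]
            ring
    · exact absurd ((abs_nonneg _).trans (hB t t t)) hβ
  have h2 : |quarticForm B u| ≤
      T * (β * ∑ t, ∑ s ∈ univ.filter (· < t), u t ^ 2 * u s ^ 2) := by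
    refine (abs_sum_le_sum_abs _ _).trans ((Finset.sum_le_sum fun t _ => h1 t).trans (le_of_eq ?_))
    rw [← Finset.mul_sum, ← Finset.mul_sum]
    ring
  have h3 : (∑ t, ∑ s ∈ univ.filter (· < t), u t ^ 2 * u s ^ 2) ^ 2 ≤
      T ^ 2 * ∑ t, ∑ s ∈ univ.filter (· < t), u t ^ 4 * u s ^ 4 := by
    refine (sq_sum_le_card_mul_sum_sq (s := univ)
      (f := fun t => ∑ s ∈ univ.filter (· < t), u t ^ 2 * u s ^ 2)).trans ?_
    rw [card_univ, Fintype.card_fin, sq (T : ℝ), mul_assoc]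
    refine mul_le_mul_of_nonneg_left ?_ (Nat.cast_nonneg _)
    rw [Finset.mul_sum]
    refine Finset.sum_le_sum fun t _ => ?_
    refine sq_sum_le_card_mul_sum_sq.trans ?_
    refine (mul_le_mul_of_nonneg_right (hcard t) (Finset.sum_nonneg fun s _ => by positivity)).trans
      (le_of_eq ?_)
    congr 1
    exact Finset.sum_congr rfl fun s _ => by ring
  calc quarticForm B u ^ 2 = |quarticForm B u| ^ 2 := (sq_abs _).symm
    _ ≤ (T * (β * ∑ t, ∑ s ∈ univ.filter (· < t), u t ^ 2 * u s ^ 2)) ^ 2 :=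
        pow_le_pow_left₀ (abs_nonneg _) h2 2
    _ = T ^ 2 * β ^ 2 * (∑ t, ∑ s ∈ univ.filter (· < t), u t ^ 2 * u s ^ 2) ^ 2 := by ring
    _ ≤ T ^ 2 * β ^ 2 * (T ^ 2 * ∑ t, ∑ s ∈ univ.filter (· < t), u t ^ 4 * u s ^ 4) :=
        mul_le_mul_of_nonneg_left h3 (by positivity)
    _ = _ := by ring

namespace ErrorLaw

variable {ν : Measure (ℕ × Fin T → ℝ)} {σ2 : ℕ → ℝ} {C : ℝ}

lemma measurable_unit (i : ℕ) : Measurable fun (e : ℕ × Fin T → ℝ) (t : Fin T) => e (i, t) := by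
  fun_prop

lemma integrable_norm_pow (h : ErrorLaw ν σ2 C) (i : ℕ) {k : ℕ} (hk : k ≤ 6) :
    Integrable (fun e => ‖fun t => e (i, t)‖ ^ k) ν := by
  have := h.isProbabilityMeasure
  rcases Nat.eq_zero_or_pos k with rfl | hk0
  · simp
  refine (integrable_finsetSum univ fun t _ => h.integrable_abs_pow (i, t) hk).mono'
    ((measurable_unit i).norm.pow_const k).aestronglyMeasurable (.of_forall fun e => ?_)
  rw [Real.norm_of_nonneg (by positivity)]
  exact norm_pow_le_sum (fun t => e (i, t)) hk0.ne'

lemma integral_norm_pow_le (h : ErrorLaw ν σ2 C) (i : ℕ) {k : ℕ} (hk0 : k ≠ 0) (hk : k ≤ 6) :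
    ∫ e, ‖fun t => e (i, t)‖ ^ k ∂ν ≤ T * (1 + C) := by
  calc ∫ e, ‖fun t => e (i, t)‖ ^ k ∂ν ≤ ∫ e, ∑ t, |e (i, t)| ^ k ∂ν :=
        integral_mono (h.integrable_norm_pow i hk)
          (integrable_finsetSum univ fun t _ => h.integrable_abs_pow (i, t) hk)
          fun e => norm_pow_le_sum (fun t => e (i, t)) hk0
    _ = ∑ t, ∫ e, |e (i, t)| ^ k ∂ν :=
        integral_finsetSum _ fun t _ => h.integrable_abs_pow (i, t) hk
    _ ≤ T * (1 + C) := sum_univ_le fun t => h.integral_abs_pow_le (i, t) hk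

/-! #### The form `lowerForm` -/

variable {B : Fin T → Fin T → ℝ} {β : ℝ}

lemma integrable_lowerForm_pow (h : ErrorLaw ν σ2 C) (i : ℕ) (hB : ∀ t s, |B t s| ≤ β)
    (hβ : 0 ≤ β) {k : ℕ} (hk : k ≤ 3) :
    Integrable (fun e => |lowerForm B fun t => e (i, t)| ^ k) ν := by
  have := h.isProbabilityMeasure
  refine ((h.integrable_norm_pow i (k := 2 * k) (by omega)).const_mul ((T ^ 2 * β) ^ k)).mono'
    (((measurable_lowerForm B).comp (measurable_unit i)).abs.pow_const k).aestronglyMeasurable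
    (.of_forall fun e => ?_)
  rw [Real.norm_of_nonneg (by positivity), pow_mul, ← mul_pow]
  exact pow_le_pow_left₀ (abs_nonneg _) (abs_lowerForm_le hB hβ _) k

lemma integral_lowerForm_cube_le (h : ErrorLaw ν σ2 C) (i : ℕ) (hB : ∀ t s, |B t s| ≤ β)
    (hβ : 0 ≤ β) :
    ∫ e, |lowerForm B fun t => e (i, t)| ^ 3 ∂ν ≤ T ^ 7 * (1 + C) * β ^ 3 := by
  calc ∫ e, |lowerForm B fun t => e (i, t)| ^ 3 ∂ν
      ≤ ∫ e, (T ^ 2 * β) ^ 3 * ‖fun t => e (i, t)‖ ^ 6 ∂ν := by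
        refine integral_mono (h.integrable_lowerForm_pow i hB hβ le_rfl)
          ((h.integrable_norm_pow i le_rfl).const_mul _) fun e => ?_
        dsimp only
        rw [show (6 : ℕ) = 2 * 3 by rfl, pow_mul ‖_‖, ← mul_pow]
        exact pow_le_pow_left₀ (abs_nonneg _) (abs_lowerForm_le hB hβ _) 3
    _ = (T ^ 2 * β) ^ 3 * ∫ e, ‖fun t => e (i, t)‖ ^ 6 ∂ν := integral_const_mul _ _
    _ ≤ (T ^ 2 * β) ^ 3 * (T * (1 + C)) :=
        mul_le_mul_of_nonneg_left (h.integral_norm_pow_le i (by norm_num) le_rfl) (by positivity)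
    _ = _ := by ring

lemma integrable_mul_pair (h : ErrorLaw ν σ2 C) (i : ℕ) (t s : Fin T) :
    Integrable (fun e => e (i, t) * e (i, s)) ν := by
  refine ((h.integrable_pow (i, t) (k := 2) (by norm_num)).add
    (h.integrable_pow (i, s) (k := 2) (by norm_num))).mono'
    (Measurable.aestronglyMeasurable (by fun_prop)) (.of_forall fun e => ?_)
  simp only [Pi.add_apply, Real.norm_eq_abs]
  rw [abs_le]
  constructor <;> nlinarith [sq_nonneg (e (i, t) - e (i, s)), sq_nonneg (e (i, t) + e (i, s)),
    sq_nonneg (e (i, t)), sq_nonneg (e (i, s))]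

lemma integral_lowerForm (h : ErrorLaw ν σ2 C) (i : ℕ) (B : Fin T → Fin T → ℝ) :
    ∫ e, lowerForm B (fun t => e (i, t)) ∂ν = 0 := by
  have hint : ∀ t s, Integrable (fun e => B t s * (e (i, t) * e (i, s))) ν := fun t s =>
    (h.integrable_mul_pair i t s).const_mul _
  unfold lowerForm
  rw [integral_finsetSum _ fun t _ => integrable_finsetSum _ fun s _ => hint t s]
  refine Finset.sum_eq_zero fun t _ => ?_
  rw [integral_finsetSum _ fun s _ => hint t s]
  refine Finset.sum_eq_zero fun s hs => ?_
  have hts : t ≠ s := (mem_filter.1 hs).2.ne'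
  have := h.integral_pow_mul_pow i hts 1
  simp only [pow_one, h.mean, mul_zero] at this
  rw [integral_const_mul, this, mul_zero]

/-- Expanding the square leaves only the diagonal pairs, by the orthogonality in `integral_four`. -/
lemma integral_lowerForm_sq (h : ErrorLaw ν σ2 C) (i : ℕ) (B : Fin T → Fin T → ℝ) :
    ∫ e, lowerForm B (fun t => e (i, t)) ^ 2 ∂ν =
      σ2 i ^ 2 * ∑ t, ∑ s ∈ univ.filter (· < t), B t s ^ 2 := by
  have hint : ∀ t s t' s', Integrable (fun e => B t s * B t' s' *
      (e (i, t) * e (i, s) * e (i, t') * e (i, s'))) ν := fun t s t' s' =>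
    (h.integrable_mul_four i t s t' s').const_mul _
  have hexp : ∀ e : ℕ × Fin T → ℝ, lowerForm B (fun t => e (i, t)) ^ 2 =
      ∑ t, ∑ s ∈ univ.filter (· < t), ∑ t', ∑ s' ∈ univ.filter (· < t'),
        B t s * B t' s' * (e (i, t) * e (i, s) * e (i, t') * e (i, s')) := fun e => by
    rw [sq, lowerForm, Finset.sum_mul]
    refine Finset.sum_congr rfl fun t _ => ?_
    rw [Finset.sum_mul]
    refine Finset.sum_congr rfl fun s _ => ?_
    rw [Finset.mul_sum]
    refine Finset.sum_congr rfl fun t' _ => ?_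
    rw [Finset.mul_sum]
    exact Finset.sum_congr rfl fun s' _ => by ring
  simp_rw [hexp]
  rw [integral_finsetSum _ fun t _ => integrable_finsetSum _ fun s _ => integrable_finsetSum _
    fun t' _ => integrable_finsetSum _ fun s' _ => hint t s t' s', Finset.mul_sum]
  refine Finset.sum_congr rfl fun t _ => ?_
  rw [integral_finsetSum _ fun s _ => integrable_finsetSum _
    fun t' _ => integrable_finsetSum _ fun s' _ => hint t s t' s', Finset.mul_sum]
  refine Finset.sum_congr rfl fun s hs => ?_
  rw [integral_finsetSum _ fun t' _ => integrable_finsetSum _ fun s' _ => hint t s t' s']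
  have hs' := (mem_filter.1 hs).2
  rw [Finset.sum_eq_single_of_mem t (mem_univ t)]
  · rw [integral_finsetSum _ fun s' _ => hint t s t s', Finset.sum_eq_single_of_mem s hs]
    · rw [integral_const_mul, h.integral_four i hs' hs', if_pos ⟨rfl, rfl⟩]
      ring
    · intro s' hs1 hne
      rw [integral_const_mul, h.integral_four i hs' (mem_filter.1 hs1).2,
        if_neg fun hh => hne hh.2.symm, mul_zero]
  · intro t' _ hne
    rw [integral_finsetSum _ fun s' _ => hint t s t' s']
    refine Finset.sum_eq_zero fun s' hs1 => ?_
    rw [integral_const_mul, h.integral_four i hs' (mem_filter.1 hs1).2,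
      if_neg fun hh => hne hh.1.symm, mul_zero]

/-! #### The form `quarticForm` -/

variable {Q : Fin T → Fin T → Fin T → ℝ}

/-- Terms with `s ≠ p` have mean zero. For the products of regressors that occur later, the
remaining diagonal is the covariance of two score components; this is why the outer products of
`unitDiff` estimate it. -/
lemma integral_quarticForm (h : ErrorLaw ν σ2 C) (i : ℕ) (Q : Fin T → Fin T → Fin T → ℝ) :
    ∫ e, quarticForm Q (fun t => e (i, t)) ∂ν =
      σ2 i ^ 2 * ∑ t, ∑ s ∈ univ.filter (· < t), Q t s s := by
  have hint : ∀ t s p, Integrable (fun e => Q t s p *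
      (e (i, t) * e (i, s) * e (i, t) * e (i, p))) ν := fun t s p =>
    (h.integrable_mul_four i t s t p).const_mul _
  unfold quarticForm
  rw [integral_finsetSum _ fun t _ => integrable_finsetSum _ fun s _ => integrable_finsetSum _
    fun p _ => hint t s p, Finset.mul_sum]
  refine Finset.sum_congr rfl fun t _ => ?_
  rw [integral_finsetSum _ fun s _ => integrable_finsetSum _ fun p _ => hint t s p, Finset.mul_sum]
  refine Finset.sum_congr rfl fun s hs => ?_
  have hs' := (mem_filter.1 hs).2
  rw [integral_finsetSum _ fun p _ => hint t s p, Finset.sum_eq_single_of_mem s hs]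
  · rw [integral_const_mul, h.integral_four i hs' hs', if_pos ⟨rfl, rfl⟩]
    ring
  · intro p hp hne
    rw [integral_const_mul, h.integral_four i hs' (mem_filter.1 hp).2,
      if_neg fun hh => hne hh.2.symm, mul_zero]

lemma integrable_quarticForm_bound (h : ErrorLaw ν σ2 C) (i : ℕ) :
    Integrable (fun e : ℕ × Fin T → ℝ =>
      ∑ t, ∑ s ∈ univ.filter (· < t), e (i, t) ^ 4 * e (i, s) ^ 4) ν :=
  integrable_finsetSum _ fun t _ => integrable_finsetSum _ fun s hs =>
    h.integrable_pow_mul_pow i (mem_filter.1 hs).2.ne' (by norm_num)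

lemma memLp_quarticForm (h : ErrorLaw ν σ2 C) (i : ℕ) (hQ : ∀ t s p, |Q t s p| ≤ β) :
    MemLp (fun e => quarticForm Q fun t => e (i, t)) 2 ν := by
  have hm := ((measurable_quarticForm Q).comp (measurable_unit i)).aestronglyMeasurable (μ := ν)
  refine (memLp_two_iff_integrable_sq hm).2
    (((h.integrable_quarticForm_bound i).const_mul (T ^ 4 * β ^ 2)).mono' (hm.pow 2)
      (.of_forall fun e => ?_))
  rw [Real.norm_of_nonneg (sq_nonneg _)]
  exact quarticForm_sq_le hQ _

/-- Since `s < t`, independence splits each dominating term into two fourth moments, each at most `1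
+ C`. -/
lemma integral_quarticForm_sq_le (h : ErrorLaw ν σ2 C) (i : ℕ) (hQ : ∀ t s p, |Q t s p| ≤ β) :
    ∫ e, quarticForm Q (fun t => e (i, t)) ^ 2 ∂ν ≤ T ^ 6 * (1 + C) ^ 2 * β ^ 2 := by
  calc ∫ e, quarticForm Q (fun t => e (i, t)) ^ 2 ∂ν
      ≤ ∫ e, T ^ 4 * β ^ 2 * ∑ t, ∑ s ∈ univ.filter (· < t), e (i, t) ^ 4 * e (i, s) ^ 4 ∂ν :=
        integral_mono (h.memLp_quarticForm i hQ).integrable_sq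
          ((h.integrable_quarticForm_bound i).const_mul _) fun e => quarticForm_sq_le hQ _
    _ = T ^ 4 * β ^ 2 * ∑ t, ∑ s ∈ univ.filter (· < t),
          (∫ e, e (i, t) ^ 4 ∂ν) * ∫ e, e (i, s) ^ 4 ∂ν := by
        rw [integral_const_mul, integral_finsetSum _ fun t _ => integrable_finsetSum _ fun s hs =>
          h.integrable_pow_mul_pow i (mem_filter.1 hs).2.ne' (by norm_num)]
        congr 1
        refine Finset.sum_congr rfl fun t _ => ?_
        rw [integral_finsetSum _ fun s hs =>
          h.integrable_pow_mul_pow i (mem_filter.1 hs).2.ne' (by norm_num)]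
        exact Finset.sum_congr rfl fun s hs =>
          h.integral_pow_mul_pow i (mem_filter.1 hs).2.ne' 4
    _ ≤ T ^ 4 * β ^ 2 * (T * (T * (1 + C) ^ 2)) := by
        have h4 : ∀ t, 0 ≤ ∫ e, e (i, t) ^ 4 ∂ν ∧ ∫ e, e (i, t) ^ 4 ∂ν ≤ 1 + C := fun t => by
          refine ⟨integral_nonneg fun e => by positivity, ?_⟩
          refine le_trans (le_of_eq ?_) (h.integral_abs_pow_le (i, t) (k := 4) (by norm_num))
          exact integral_congr_ae (.of_forall fun e => by dsimp only; rw [Even.pow_abs (by decide)])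
        refine mul_le_mul_of_nonneg_left (sum_univ_le fun t => sum_filter_lt_le (by positivity)
          (fun s => ?_) t) (by positivity)
        rw [sq]
        exact mul_le_mul (h4 t).2 (h4 s).2 (h4 s).1 ((h4 t).1.trans (h4 t).2)
    _ = _ := by ring

/-- Sums over units of centred functions of the errors of one unit. -/
lemma lintegral_sum_sq_le (h : ErrorLaw ν σ2 C) (A : Finset ℕ) {f : ℕ → (Fin T → ℝ) → ℝ}
    (hf : ∀ i, Measurable (f i)) (hL : ∀ i, MemLp (fun e => f i fun t => e (i, t)) 2 ν)
    (hmean : ∀ i, ∫ e, f i (fun t => e (i, t)) ∂ν = 0) {b : ℕ → ℝ}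
    (hb : ∀ i, Var[fun e => f i fun t => e (i, t); ν] ≤ b i) :
    ∫⁻ e, ‖(∑ i ∈ A, f i fun t => e (i, t)) ^ 2‖ₑ ∂ν ≤ ENNReal.ofReal (∑ i ∈ A, b i) := by
  have := h.isProbabilityMeasure
  have hsum : (fun e : ℕ × Fin T → ℝ => ∑ i ∈ A, f i fun t => e (i, t)) =
      ∑ i ∈ A, fun e => f i fun t => e (i, t) := by
    ext e
    rw [Finset.sum_apply]
  have hmem : MemLp (fun e => ∑ i ∈ A, f i fun t => e (i, t)) 2 ν := by
    rw [hsum]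
    exact memLp_finsetSum' _ fun i _ => hL i
  have hmean : ∫ e, (∑ i ∈ A, f i fun t => e (i, t)) ∂ν = 0 := by
    rw [integral_finsetSum _ fun i _ => (hL i).integrable one_le_two]
    exact Finset.sum_eq_zero fun i _ => hmean i
  refine lintegral_enorm_le_ofReal hmem.integrable_sq (fun e => sq_nonneg _) ?_
  rw [← variance_of_integral_eq_zero hmem.aemeasurable hmean, hsum,
    IndepFun.variance_sum (fun i _ => hL i) fun i _ j _ hij => ?_]
  · exact Finset.sum_le_sum fun i _ => hb i
  · exact (h.indep_blocks.indepFun hij).comp (hf i) (hf j)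

lemma lintegral_quarticForm_sub_sq_le (h : ErrorLaw ν σ2 C) (A : Finset ℕ)
    {Q : ℕ → Fin T → Fin T → Fin T → ℝ} {β : ℕ → ℝ} (hQ : ∀ i t s p, |Q i t s p| ≤ β i) :
    ∫⁻ e, ‖(∑ i ∈ A, (quarticForm (Q i) (fun t => e (i, t)) -
        σ2 i ^ 2 * ∑ t, ∑ s ∈ univ.filter (· < t), Q i t s s)) ^ 2‖ₑ ∂ν ≤
      ENNReal.ofReal (T ^ 6 * (1 + C) ^ 2 * ∑ i ∈ A, β i ^ 2) := by
  have := h.isProbabilityMeasure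
  rw [Finset.mul_sum]
  refine h.lintegral_sum_sq_le A (f := fun i u => quarticForm (Q i) u -
      σ2 i ^ 2 * ∑ t, ∑ s ∈ univ.filter (· < t), Q i t s s)
    (fun i => (measurable_quarticForm _).sub_const _)
    (fun i => (h.memLp_quarticForm i (hQ i)).sub (memLp_const _)) (fun i => ?_) fun i => ?_
  · rw [integral_sub ((h.memLp_quarticForm i (hQ i)).integrable one_le_two) (integrable_const _),
      h.integral_quarticForm]
    simp
  · rw [variance_sub_const (h.memLp_quarticForm i (hQ i)).aestronglyMeasurable]
    exact (variance_le_expectation_sq (h.memLp_quarticForm i (hQ i)).aestronglyMeasurable).trans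
      (h.integral_quarticForm_sq_le i (hQ i))

lemma lintegral_lowerForm_sq_le (h : ErrorLaw ν σ2 C) (A : Finset ℕ) {D : ℝ} (hσ : ∀ i, 0 ≤ σ2 i)
    (hD : ∀ i, σ2 i ≤ D) {B : ℕ → Fin T → Fin T → ℝ} {β : ℕ → ℝ} (hB : ∀ i t s, |B i t s| ≤ β i)
    (hβ : ∀ i, 0 ≤ β i) :
    ∫⁻ e, ‖(∑ i ∈ A, lowerForm (B i) (fun t => e (i, t))) ^ 2‖ₑ ∂ν ≤
      ENNReal.ofReal (D ^ 2 * T ^ 2 * ∑ i ∈ A, β i ^ 2) := by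
  have := h.isProbabilityMeasure
  have hm : ∀ i, Measurable fun e : ℕ × Fin T → ℝ => lowerForm (B i) fun t => e (i, t) :=
    fun i => (measurable_lowerForm (B i)).comp (measurable_unit i)
  rw [Finset.mul_sum]
  refine h.lintegral_sum_sq_le A (f := fun i u => lowerForm (B i) u)
    (fun i => measurable_lowerForm _) (fun i => ?_) (fun i => h.integral_lowerForm i _) fun i => ?_
  · rw [memLp_two_iff_integrable_sq (hm i).aestronglyMeasurable]
    simpa only [sq_abs] using h.integrable_lowerForm_pow i (hB i) (hβ i) (k := 2) (by norm_num)
  · rw [variance_of_integral_eq_zero (hm i).aemeasurable (h.integral_lowerForm i _),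
      h.integral_lowerForm_sq, mul_assoc]
    refine mul_le_mul (pow_le_pow_left₀ (hσ i) (hD i) 2) ?_
      (Finset.sum_nonneg fun t _ => Finset.sum_nonneg fun s _ => sq_nonneg _) (sq_nonneg _)
    refine (sum_univ_le fun t => sum_filter_lt_le (c := β i ^ 2) (by positivity)
      (fun s => ?_) t).trans (le_of_eq (by ring))
    rw [← sq_abs]
    exact pow_le_pow_left₀ (abs_nonneg _) (hB i t s) 2

end ErrorLaw

end Forms

/-! ### Characteristic functions of sums of forms in the errors -/

section CharFun

-- For `|u| ≤ 1` the Taylor remainder carries a factor of at most `e < 4`. For `|u| ≥ 1` the trivial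
-- bound `2 + |u| + u² / 2` is already below `4 |u|³`.
open Complex in
lemma norm_exp_mul_I_sub_le (u : ℝ) :
    ‖cexp (u * I) - (1 + u * I - u ^ 2 / 2)‖ ≤ 4 * |u| ^ 3 := by
  rcases le_total |u| 1 with hu | hu
  · have h := norm_exp_sub_sum_le_norm_mul_exp (u * I) 3
    have hn : ‖(u * I : ℂ)‖ = |u| := by simp
    rw [hn] at h
    have hs : ∑ m ∈ Finset.range 3, (u * I : ℂ) ^ m / (m.factorial : ℂ) =
        1 + u * I - u ^ 2 / 2 := by
      simp only [Finset.sum_range_succ, Finset.sum_range_zero, Nat.factorial, mul_pow, I_sq]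
      push_cast
      ring
    rw [hs] at h
    refine h.trans ?_
    rw [mul_comm]
    refine mul_le_mul_of_nonneg_right ?_ (by positivity)
    calc Real.exp |u| ≤ Real.exp 1 := Real.exp_le_exp.2 hu
      _ ≤ 4 := by linarith [Real.exp_one_lt_d9]
  · have h1 : ‖cexp (u * I)‖ = 1 := norm_exp_ofReal_mul_I u
    have h2 : ‖(1 + u * I - u ^ 2 / 2 : ℂ)‖ ≤ 1 + |u| + |u| ^ 2 / 2 := by
      refine (norm_sub_le _ _).trans (add_le_add ((norm_add_le _ _).trans ?_) ?_)
      · simp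
      · simp
    have h3 := norm_sub_le (cexp (u * I)) (1 + u * I - u ^ 2 / 2)
    have h4 : |u| ^ 2 ≤ |u| ^ 3 := pow_le_pow_right₀ hu (by norm_num)
    have h5 : |u| ^ 1 ≤ |u| ^ 3 := pow_le_pow_right₀ hu (by norm_num)
    have h6 : |u| ^ 0 ≤ |u| ^ 3 := pow_le_pow_right₀ hu (by norm_num)
    rw [pow_one] at h5
    rw [pow_zero] at h6
    linarith

lemma abs_exp_neg_sub_le {x : ℝ} (hx : 0 ≤ x) : |Real.exp (-x) - (1 - x)| ≤ x ^ 2 := by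
  rcases le_total x 1 with h | h
  · have := Real.norm_exp_sub_one_sub_id_le (x := -x) (by simpa [abs_of_nonneg hx] using h)
    simp only [Real.norm_eq_abs, abs_neg, sq_abs] at this
    convert this using 2
    ring
  · have h1 := Real.add_one_le_exp (-x)
    have h2 : Real.exp (-x) ≤ 1 := Real.exp_le_one_iff.2 (by linarith)
    rw [abs_of_nonneg (by linarith)]
    nlinarith

/-- Exchanging one factor at a time costs one difference, since all other factors have modulus at
most one. -/
lemma norm_prod_sub_prod_le {ι : Type*} (A : Finset ι) {f g : ι → ℂ} (hf : ∀ i, ‖f i‖ ≤ 1)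
    (hg : ∀ i, ‖g i‖ ≤ 1) : ‖∏ i ∈ A, f i - ∏ i ∈ A, g i‖ ≤ ∑ i ∈ A, ‖f i - g i‖ := by
  classical
  induction A using Finset.induction_on with
  | empty => simp
  | insert a s ha ih =>
    rw [prod_insert ha, prod_insert ha, sum_insert ha]
    have hgp : ‖∏ i ∈ s, g i‖ ≤ 1 := by
      rw [norm_prod]
      exact prod_le_one (fun i _ => norm_nonneg _) fun i _ => hg i
    calc ‖f a * ∏ i ∈ s, f i - g a * ∏ i ∈ s, g i‖
        = ‖f a * (∏ i ∈ s, f i - ∏ i ∈ s, g i) + (f a - g a) * ∏ i ∈ s, g i‖ := by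
          congr 1; ring
      _ ≤ 1 * ‖∏ i ∈ s, f i - ∏ i ∈ s, g i‖ + ‖f a - g a‖ * 1 := by
          refine (norm_add_le _ _).trans (add_le_add ?_ ?_)
          · rw [norm_mul]
            exact mul_le_mul_of_nonneg_right (hf a) (norm_nonneg _)
          · rw [norm_mul]
            exact mul_le_mul_of_nonneg_left hgp (norm_nonneg _)
      _ ≤ _ := by linarith

namespace ErrorLaw

open Complex

variable {T : ℕ} {ν : Measure (ℕ × Fin T → ℝ)} {σ2 : ℕ → ℝ} {C : ℝ}

/-- Lindeberg's comparison for one unit: the characteristic function and the Gaussian one of the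
same variance `v` both equal `1 - v / 2`, up to a third absolute moment and a squared variance
respectively. -/
lemma norm_charFun_lowerForm_sub_le (h : ErrorLaw ν σ2 C) (i : ℕ) {B : Fin T → Fin T → ℝ} {β : ℝ}
    (hB : ∀ t s, |B t s| ≤ β) (hβ : 0 ≤ β) :
    ‖∫ e, cexp (lowerForm B (fun t => e (i, t)) * I) ∂ν -
        (Real.exp (-((σ2 i ^ 2 * ∑ t, ∑ s ∈ univ.filter (· < t), B t s ^ 2) / 2)) : ℂ)‖ ≤
      4 * (T ^ 7 * (1 + C) * β ^ 3) + (σ2 i ^ 2 * (T ^ 2 * β ^ 2)) ^ 2 := by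
  have := h.isProbabilityMeasure
  set L : (ℕ × Fin T → ℝ) → ℝ := fun e => lowerForm B fun t => e (i, t) with hLdef
  set v := σ2 i ^ 2 * ∑ t, ∑ s ∈ univ.filter (· < t), B t s ^ 2 with hv
  have hLm : Measurable L := (measurable_lowerForm B).comp (measurable_unit i)
  have hL1 : Integrable L ν := by
    have := h.integrable_lowerForm_pow i hB hβ (k := 1) (by norm_num)
    simp only [pow_one] at this
    exact (integrable_norm_iff hLm.aestronglyMeasurable).1 this
  have hL2 : Integrable (fun e => L e ^ 2) ν := by
    have := h.integrable_lowerForm_pow i hB hβ (k := 2) (by norm_num)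
    simpa only [sq_abs] using this
  have hL3 := h.integrable_lowerForm_pow i hB hβ (k := 3) (by norm_num)
  have hexp : Integrable (fun e => cexp (L e * I)) ν :=
    (integrable_const (1 : ℝ)).mono' (by fun_prop)
      (.of_forall fun e => (norm_exp_ofReal_mul_I _).le)
  have hc1 : Integrable (fun e => (L e : ℂ) * I) ν := hL1.ofReal.mul_const I
  have hc2 : Integrable (fun e => (L e : ℂ) ^ 2 / 2) ν := by
    have := (hL2.ofReal (𝕜 := ℂ)).div_const 2
    simpa using this
  have hc : Integrable (fun e => (1 : ℂ) + L e * I - (L e : ℂ) ^ 2 / 2) ν :=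
    ((integrable_const 1).add hc1).sub hc2
  have hmain : ∫ e, ((1 : ℂ) + L e * I - (L e : ℂ) ^ 2 / 2) ∂ν = ((1 - v / 2 : ℝ) : ℂ) := by
    have i1 : ∫ e, (L e : ℂ) * I ∂ν = 0 := by
      rw [integral_mul_const, integral_complex_ofReal, h.integral_lowerForm]
      simp
    have i2 : ∫ e, (L e : ℂ) ^ 2 / 2 ∂ν = ((v / 2 : ℝ) : ℂ) := by
      have : ∀ e, (L e : ℂ) ^ 2 / 2 = ((L e ^ 2 / 2 : ℝ) : ℂ) := fun e => by push_cast; ring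
      simp_rw [this]
      rw [integral_complex_ofReal, integral_div, h.integral_lowerForm_sq]
    have hc0 : Integrable (fun e => (1 : ℂ) + L e * I) ν := (integrable_const 1).add hc1
    rw [integral_sub hc0 hc2, integral_add (integrable_const 1) hc1, i1, i2]
    simp
  have hv0 : 0 ≤ v := mul_nonneg (sq_nonneg _)
    (Finset.sum_nonneg fun t _ => Finset.sum_nonneg fun s _ => sq_nonneg _)
  have hvle : v ≤ σ2 i ^ 2 * (T ^ 2 * β ^ 2) := by
    refine mul_le_mul_of_nonneg_left ?_ (sq_nonneg _)
    refine (sum_univ_le fun t => sum_filter_lt_le (c := β ^ 2) (by positivity)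
      (fun s => ?_) t).trans (le_of_eq (by ring))
    rw [← sq_abs]
    exact pow_le_pow_left₀ (abs_nonneg _) (hB t s) 2
  have hA : ‖∫ e, cexp (L e * I) ∂ν - ((1 - v / 2 : ℝ) : ℂ)‖ ≤ 4 * (T ^ 7 * (1 + C) * β ^ 3) := by
    rw [← hmain, ← integral_sub hexp hc]
    calc _ ≤ ∫ e, 4 * |L e| ^ 3 ∂ν :=
          norm_integral_le_of_norm_le (hL3.const_mul 4) (.of_forall fun e =>
            norm_exp_mul_I_sub_le (L e))
      _ = 4 * ∫ e, |L e| ^ 3 ∂ν := integral_const_mul _ _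
      _ ≤ _ := mul_le_mul_of_nonneg_left (h.integral_lowerForm_cube_le i hB hβ) (by norm_num)
  have hBd : ‖((1 - v / 2 : ℝ) : ℂ) - (Real.exp (-(v / 2)) : ℂ)‖ ≤
      (σ2 i ^ 2 * (T ^ 2 * β ^ 2)) ^ 2 := by
    rw [← ofReal_sub, norm_real, Real.norm_eq_abs, abs_sub_comm]
    refine (abs_exp_neg_sub_le (by positivity)).trans (pow_le_pow_left₀ (by positivity) ?_ 2)
    linarith
  calc _ = ‖(∫ e, cexp (L e * I) ∂ν - ((1 - v / 2 : ℝ) : ℂ)) +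
        (((1 - v / 2 : ℝ) : ℂ) - (Real.exp (-(v / 2)) : ℂ))‖ := by congr 1; ring
    _ ≤ _ := (norm_add_le _ _).trans (add_le_add hA hBd)

/-- A quantitative central limit theorem for sums over units of quadratic forms in the errors. -/
lemma norm_charFun_sum_lowerForm_sub_le (h : ErrorLaw ν σ2 C) {D : ℝ} (hσ : ∀ i, 0 ≤ σ2 i)
    (hD : ∀ i, σ2 i ≤ D) (A : Finset ℕ) {B : ℕ → Fin T → Fin T → ℝ} {β : ℕ → ℝ}
    (hB : ∀ i t s, |B i t s| ≤ β i) (hβ : ∀ i, 0 ≤ β i) :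
    ‖∫ e, cexp ((∑ i ∈ A, lowerForm (B i) (fun t => e (i, t)) : ℝ) * I) ∂ν -
        (Real.exp (-((∑ i ∈ A, σ2 i ^ 2 * ∑ t, ∑ s ∈ univ.filter (· < t), B i t s ^ 2) / 2)) : ℂ)‖ ≤
      4 * (T ^ 7 * (1 + C)) * ∑ i ∈ A, β i ^ 3 + D ^ 4 * T ^ 4 * ∑ i ∈ A, β i ^ 4 := by
  have := h.isProbabilityMeasure
  -- The error blocks of distinct units are independent, so the characteristic function factors over
  -- units, as does the Gaussian one in `hexp`.
  have hprod : ∫ e, cexp ((∑ i ∈ A, lowerForm (B i) (fun t => e (i, t)) : ℝ) * I) ∂ν =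
      ∏ i ∈ A, ∫ e, cexp (lowerForm (B i) (fun t => e (i, t)) * I) ∂ν := by
    have hA : iIndepFun (fun (i : A) (e : ℕ × Fin T → ℝ) (t : Fin T) => e ((i : ℕ), t)) ν :=
      h.indep_blocks.precomp (g := fun i : A => (i : ℕ)) Subtype.val_injective
    have h1 := hA.integral_fun_prod_comp
      (f := fun (i : A) (u : Fin T → ℝ) => cexp (lowerForm (B i) u * I))
      (fun i => (measurable_unit (i : ℕ)).aemeasurable)
      (fun i => Measurable.aestronglyMeasurable (by
        have := measurable_lowerForm (B i)
        fun_prop))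
    rw [← Finset.prod_coe_sort A, ← h1]
    refine integral_congr_ae (.of_forall fun e => ?_)
    dsimp only
    rw [← Complex.exp_sum, ← Finset.sum_coe_sort A, ofReal_sum, Finset.sum_mul]
  have hexp : (Real.exp (-((∑ i ∈ A, σ2 i ^ 2 * ∑ t, ∑ s ∈ univ.filter (· < t),
      B i t s ^ 2) / 2)) : ℂ) = ∏ i ∈ A,
      (Real.exp (-((σ2 i ^ 2 * ∑ t, ∑ s ∈ univ.filter (· < t), B i t s ^ 2) / 2)) : ℂ) := by
    rw [← ofReal_prod, ← Real.exp_sum, Finset.sum_neg_distrib, Finset.sum_div]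
  rw [hprod, hexp]
  refine (norm_prod_sub_prod_le A (fun i => ?_) fun i => ?_).trans ?_
  · refine (norm_integral_le_integral_norm _).trans ?_
    simp [norm_exp_ofReal_mul_I]
  · rw [norm_real, Real.norm_of_nonneg (Real.exp_pos _).le, Real.exp_le_one_iff, neg_nonpos]
    exact div_nonneg (mul_nonneg (sq_nonneg _)
      (Finset.sum_nonneg fun t _ => Finset.sum_nonneg fun s _ => sq_nonneg _)) two_pos.le
  · rw [Finset.mul_sum, Finset.mul_sum, ← Finset.sum_add_distrib]
    refine Finset.sum_le_sum fun i _ =>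
      (h.norm_charFun_lowerForm_sub_le i (hB i) (hβ i)).trans (add_le_add (by linarith) ?_)
    calc (σ2 i ^ 2 * (T ^ 2 * β i ^ 2)) ^ 2 = σ2 i ^ 4 * (T ^ 4 * β i ^ 4) := by ring
      _ ≤ D ^ 4 * (T ^ 4 * β i ^ 4) :=
          mul_le_mul_of_nonneg_right (pow_le_pow_left₀ (hσ i) (hD i) 4)
            (mul_nonneg (by positivity) (by have := hβ i; positivity))
      _ = _ := by ring

end ErrorLaw

end CharFun

/-! ### Moments of the regressors -/

section RegressorMoments

/-- The fourth root of a natural number. -/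
def quartRoot (n : ℕ) : ℝ := (n : ℝ) ^ (1 / 4 : ℝ)

lemma quartRoot_nonneg (n : ℕ) : 0 ≤ quartRoot n := by unfold quartRoot; positivity

lemma quartRoot_pow_four (n : ℕ) : quartRoot n ^ 4 = n := by
  rw [quartRoot, ← Real.rpow_natCast, ← Real.rpow_mul (Nat.cast_nonneg n)]
  norm_num

lemma quartRoot_sq (n : ℕ) : quartRoot n ^ 2 = √(n : ℝ) := by
  rw [quartRoot, ← Real.rpow_natCast, ← Real.rpow_mul (Nat.cast_nonneg n), Real.sqrt_eq_rpow]
  norm_num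

lemma quartRoot_pos {n : ℕ} (hn : 0 < n) : 0 < quartRoot n := by
  unfold quartRoot
  have : (0 : ℝ) < n := Nat.cast_pos.2 hn
  positivity

lemma tendsto_quartRoot : Tendsto quartRoot atTop atTop :=
  (tendsto_rpow_atTop (by norm_num)).comp tendsto_natCast_atTop_atTop

/-- The scaled power sum `∑ i ∈ A, (a i / (#A) ^ (1 / 4)) ^ p`. -/
def powSum (A : Finset ℕ) (a : ℕ → ℝ) (p : ℝ) : ℝ := ∑ i ∈ A, (a i / quartRoot #A) ^ p

/-- With `c_i = a i / (#A)^(1/4)`, the sum of `c_i^j` is at most the sum of `c_i^p` times the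
largest `c_i^(j-p)`, and the largest `c_i^p` is at most `powSum`. Thus the smallness of one power
sum passes to all higher powers, without higher moments. -/
lemma sum_pow_le_powSum {A : Finset ℕ} {a : ℕ → ℝ} (ha : ∀ i, 0 ≤ a i) {p : ℝ} (hp : 0 < p) {j : ℕ}
    (hj : p < j) :
    (∑ i ∈ A, a i ^ j) / quartRoot #A ^ j ≤
      powSum A a p * powSum A a p ^ ((j - p) / p) := by
  have hc : ∀ i, 0 ≤ a i / quartRoot #A := fun i => div_nonneg (ha i) (quartRoot_nonneg _)
  rw [Finset.sum_div]
  conv_rhs => enter [1]; rw [powSum]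
  rw [Finset.sum_mul]
  refine Finset.sum_le_sum fun i hi => ?_
  rw [← div_pow, ← Real.rpow_natCast]
  set c := a i / quartRoot #A
  have h1 : c ^ p ≤ powSum A a p :=
    Finset.single_le_sum (f := fun i => (a i / quartRoot #A) ^ p)
      (fun i _ => Real.rpow_nonneg (hc i) _) hi
  have h2 : c ^ (j : ℝ) = c ^ p * (c ^ p) ^ ((j - p) / p) := by
    rw [← Real.rpow_mul (hc i), mul_div_cancel₀ _ hp.ne', ← Real.rpow_add_of_nonneg (hc i) hp.le
      (sub_nonneg.2 hj.le)]
    congr 1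
    ring
  rw [h2]
  have h3 : 0 ≤ c ^ p := Real.rpow_nonneg (hc i) _
  exact mul_le_mul_of_nonneg_left
    (Real.rpow_le_rpow h3 h1 (div_nonneg (sub_nonneg.2 hj.le) hp.le)) h3

lemma tendsto_sum_pow {l : Filter ℕ} {A : ℕ → Finset ℕ} {a : ℕ → ℝ} (ha : ∀ i, 0 ≤ a i) {p : ℝ}
    (hp : 0 < p) {j : ℕ} (hj : p < j) (h : Tendsto (fun N => powSum (A N) a p) l (𝓝 0)) :
    Tendsto (fun N => (∑ i ∈ A N, a i ^ j) / quartRoot #(A N) ^ j) l (𝓝 0) := by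
  have h1 : Tendsto (fun N => powSum (A N) a p * powSum (A N) a p ^ ((j - p) / p)) l (𝓝 0) := by
    have hpos : 0 < ((j : ℝ) - p) / p := div_pos (sub_pos.2 hj) hp
    have := h.mul (h.rpow_const (p := ((j : ℝ) - p) / p) (Or.inr hpos.le))
    simpa [Real.zero_rpow hpos.ne'] using this
  exact squeeze_zero (fun N => div_nonneg (Finset.sum_nonneg fun i _ => pow_nonneg (ha i) _)
    (pow_nonneg (quartRoot_nonneg _) _)) (fun N => sum_pow_le_powSum ha hp hj) h1

variable {Ω : Type*} [MeasurableSpace Ω] {μ : Measure Ω} [IsProbabilityMeasure μ] {T K : ℕ}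

/-- The moments of order `4 + q` of the regressors are bounded by `D`. -/
structure MomentBound (μ : Measure Ω) (x : ℕ → Ω → Fin T → Fin K → ℝ) (q D : ℝ) : Prop where
  measurable : ∀ i, Measurable (x i)
  pos : 0 < q
  le_one : q ≤ 1
  integrable : ∀ i, Integrable (fun ω => ‖x i ω‖ ^ (4 + q)) μ
  bound : ∀ i, ∫ ω, ‖x i ω‖ ^ (4 + q) ∂μ ≤ D

lemma rpow_le_one_add_rpow {u p p' : ℝ} (hu : 0 ≤ u) (hp : 0 ≤ p) (h : p ≤ p') :
    u ^ p ≤ 1 + u ^ p' := by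
  rcases le_total u 1 with h1 | h1
  · have := Real.rpow_le_one hu h1 hp
    have := Real.rpow_nonneg hu p'
    linarith
  · have := Real.rpow_le_rpow_of_exponent_le h1 h
    linarith

lemma norm_rpow_le_sum {ι : Type*} [Fintype ι] {E : Type*} [SeminormedAddCommGroup E] (u : ι → E)
    {p : ℝ} (hp : 0 < p) : ‖u‖ ^ p ≤ ∑ t, ‖u t‖ ^ p := by
  have h0 : 0 ≤ ∑ t, ‖u t‖ ^ p := Finset.sum_nonneg fun t _ => by positivity
  have h1 : ‖u‖ ≤ (∑ t, ‖u t‖ ^ p) ^ p⁻¹ := by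
    refine (pi_norm_le_iff_of_nonneg (by positivity)).2 fun t => ?_
    rw [Real.le_rpow_inv_iff_of_pos (norm_nonneg _) h0 hp]
    exact Finset.single_le_sum (f := fun t => ‖u t‖ ^ p) (fun s _ => by positivity) (mem_univ t)
  rwa [Real.le_rpow_inv_iff_of_pos (norm_nonneg _) h0 hp] at h1

/-- The surplus exponent is cut down to `min d 1`: then `4 + q ≤ 5` lies below the powers six and
eight that are needed, and `q ≤ 1` permits the interpolation in `min_le_rpow`. -/
lemma Regressors.momentBound {x : ℕ → Ω → Fin T → Fin K → ℝ} {G : ℕ → Finset ℕ}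
    {S SG : Matrix (Fin K) (Fin K) ℝ} (h : Regressors μ x G S SG) :
    ∃ q D, MomentBound μ x q D := by
  obtain ⟨d, hd, C, hC⟩ := h.moments
  have hle : ∀ i ω, ‖x i ω‖ ^ (4 + min d 1) ≤ 1 + ∑ t, ∑ k, |x i ω t k| ^ (4 + d) := by
    intro i ω
    refine (rpow_le_one_add_rpow (norm_nonneg _) (by positivity)
      (add_le_add_right (min_le_left d 1) 4)).trans (add_le_add_right ?_ 1)
    refine (norm_rpow_le_sum _ (by positivity)).trans (Finset.sum_le_sum fun t _ => ?_)
    exact norm_rpow_le_sum _ (by positivity)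
  have hint : ∀ i, Integrable (fun ω => 1 + ∑ t, ∑ k, |x i ω t k| ^ (4 + d)) μ := fun i =>
    (integrable_const 1).add (integrable_finsetSum _ fun t _ => integrable_finsetSum _
      fun k _ => (hC i t k).1)
  have hI : ∀ i, Integrable (fun ω => ‖x i ω‖ ^ (4 + min d 1)) μ := fun i => by
    refine (hint i).mono' ((h.measurable i).norm.pow_const _).aestronglyMeasurable
      (.of_forall fun ω => ?_)
    rw [Real.norm_of_nonneg (by positivity)]
    exact hle i ω
  refine ⟨min d 1, 1 + ∑ t : Fin T, ∑ k : Fin K, C, h.measurable, by positivity, min_le_right _ _,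
    hI, fun i => ?_⟩
  refine (integral_mono (hI i) (hint i) (hle i)).trans ?_
  rw [integral_add (integrable_const 1) (integrable_finsetSum _ fun t _ =>
    integrable_finsetSum _ fun k _ => (hC i t k).1), integral_finsetSum _ fun t _ =>
    integrable_finsetSum _ fun k _ => (hC i t k).1]
  refine add_le_add (by simp) (Finset.sum_le_sum fun t _ => ?_)
  rw [integral_finsetSum _ fun k _ => (hC i t k).1]
  exact Finset.sum_le_sum fun k _ => (hC i t k).2

namespace MomentBound

variable {x : ℕ → Ω → Fin T → Fin K → ℝ} {q D : ℝ}

lemma integrable_rpow (h : MomentBound μ x q D) (i : ℕ) {p : ℝ} (hp : 0 ≤ p) (hp' : p ≤ 4 + q) :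
    Integrable (fun ω => ‖x i ω‖ ^ p) μ := by
  refine ((integrable_const 1).add (h.integrable i)).mono'
    ((h.measurable i).norm.pow_const _).aestronglyMeasurable (.of_forall fun ω => ?_)
  rw [Real.norm_of_nonneg (by positivity)]
  exact rpow_le_one_add_rpow (norm_nonneg _) hp hp'

lemma integral_rpow_le (h : MomentBound μ x q D) (i : ℕ) {p : ℝ} (hp : 0 ≤ p) (hp' : p ≤ 4 + q) :
    ∫ ω, ‖x i ω‖ ^ p ∂μ ≤ 1 + D := by
  refine (integral_mono (h.integrable_rpow i hp hp') ((integrable_const 1).add (h.integrable i))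
    fun ω => rpow_le_one_add_rpow (norm_nonneg _) hp hp').trans ?_
  simp only [Pi.add_apply]
  rw [integral_add (integrable_const 1) (h.integrable i)]
  simpa using h.bound i

/-- Averages of moments of order at most `4 + q` vanish after multiplication by a null sequence. -/
lemma tendsto_mul_sum_rpow (h : MomentBound μ x q D) {p : ℝ} (hp : 0 ≤ p) (hp' : p ≤ 4 + q)
    (A : ℕ → Finset ℕ) {c : ℕ → ℝ} (hc : Tendsto (fun N => c N * #(A N)) atTop (𝓝 0)) :
    TendstoInMeasure μ (fun N ω => c N * ∑ i ∈ A N, ‖x i ω‖ ^ p) atTop 0 := by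
  refine tendstoInMeasure_zero_of_lintegral_le (b := fun N => |c N * #(A N)| * (1 + D))
    (fun N => (Finset.measurable_sum _ fun i _ => (h.measurable i).norm.pow_const _).const_mul _)
    (fun N => ?_) ?_
  · have hi : Integrable (fun ω => |c N| * ∑ i ∈ A N, ‖x i ω‖ ^ p) μ :=
      (integrable_finsetSum _ fun i _ => h.integrable_rpow i hp hp').const_mul _
    have h0 : ∀ ω, 0 ≤ ∑ i ∈ A N, ‖x i ω‖ ^ p := fun ω =>
      Finset.sum_nonneg fun i _ => by positivity
    have h1 : ∀ ω, ‖c N * ∑ i ∈ A N, ‖x i ω‖ ^ p‖ₑ = ‖|c N| * ∑ i ∈ A N, ‖x i ω‖ ^ p‖ₑ := fun ω => by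
      rw [enorm_mul, enorm_mul]
      congr 1
      rw [← ofReal_norm, ← ofReal_norm, Real.norm_eq_abs, Real.norm_eq_abs, abs_abs]
    simp_rw [h1]
    refine lintegral_enorm_le_ofReal hi (fun ω => mul_nonneg (abs_nonneg _) (h0 ω)) ?_
    rw [integral_const_mul, integral_finsetSum _ fun i _ => h.integrable_rpow i hp hp', abs_mul,
      mul_assoc]
    refine mul_le_mul_of_nonneg_left ?_ (abs_nonneg _)
    refine (Finset.sum_le_sum fun i _ => h.integral_rpow_le i hp hp').trans (le_of_eq ?_)
    rw [Finset.sum_const, nsmul_eq_mul, Nat.abs_cast]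
  · simpa using hc.abs.mul_const (1 + D)

/-- For `n` units the mean is of order `n · n^(-(4+q)/4) = n^(-q/4)`. This is where more than four
moments matter. -/
lemma tendsto_powSum (h : MomentBound μ x q D) {A : ℕ → Finset ℕ}
    (hA : Tendsto (fun N => #(A N)) atTop atTop) :
    TendstoInMeasure μ (fun N ω => powSum (A N) (fun i => ‖x i ω‖) (4 + q)) atTop 0 := by
  have hq := h.pos
  refine (h.tendsto_mul_sum_rpow (p := 4 + q) (by positivity) le_rfl A
    (c := fun N => (quartRoot #(A N) ^ (4 + q))⁻¹) ?_).congr_left fun N => .of_forall fun ω => ?_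
  · have h1 : Tendsto (fun n : ℕ => quartRoot n ^ (-q)) atTop (𝓝 0) :=
      (tendsto_rpow_neg_atTop hq).comp tendsto_quartRoot
    refine (h1.comp hA).congr' ?_
    filter_upwards [hA.eventually_gt_atTop 0] with N hN
    have hp := quartRoot_pos hN
    simp only [Function.comp]
    have h4 : ((#(A N) : ℕ) : ℝ) = quartRoot #(A N) ^ (4 : ℝ) := by
      rw [← quartRoot_pow_four, ← Real.rpow_natCast]
      norm_num
    rw [h4]
    rw [← Real.rpow_neg hp.le, ← Real.rpow_add hp]
    congr 1
    ring
  · simp only [powSum]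
    rw [Finset.mul_sum]
    refine Finset.sum_congr rfl fun i _ => ?_
    rw [Real.div_rpow (norm_nonneg _) (quartRoot_nonneg _)]
    ring

lemma tendsto_sum_pow (h : MomentBound μ x q D) {A : ℕ → Finset ℕ}
    (hA : Tendsto (fun N => #(A N)) atTop atTop) {j : ℕ} (hj : 5 < j) :
    TendstoInMeasure μ (fun N ω => (∑ i ∈ A N, ‖x i ω‖ ^ j) / quartRoot #(A N) ^ j) atTop 0 := by
  refine ASAlong.tendstoInMeasure (fun N => Measurable.aestronglyMeasurable
    ((Finset.measurable_sum _ fun i _ => (h.measurable i).norm.pow_const _).div_const _)) ?_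
  refine (ASAlong.of_tendstoInMeasure (h.tendsto_powSum hA)).mono fun l ω _ _ hl => ?_
  have : (5 : ℝ) < j := by exact_mod_cast hj
  exact PanelLM.tendsto_sum_pow (fun i => norm_nonneg _) (by linarith [h.pos])
    (by linarith [h.le_one]) hl

end MomentBound

end RegressorMoments

/-! ### The contributions of a unit -/

section Unit

variable {T K : ℕ}

/-- The coefficients of the form `∑_{s < t} x_t,k x_s,k (u_t x_s,l + u_s x_t,l)` in `u`. -/
def crossCoef (xi : Fin T → Fin K → ℝ) (k l : Fin K) (t : Fin T) : ℝ :=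
  ∑ s ∈ univ.filter (· ≠ t), xi t k * xi s k * xi s l

/-- The contribution of a unit with regressors `xi` and residuals `u` to the score. -/
def unitScore (xi : Fin T → Fin K → ℝ) (u : Fin T → ℝ) (k : Fin K) : ℝ :=
  lowerForm (fun t s => xi t k * xi s k) u

/-- The martingale differences that make up `unitScore`. -/
def unitDiff (xi : Fin T → Fin K → ℝ) (u : Fin T → ℝ) (t : Fin T) (k : Fin K) : ℝ :=
  u t * xi t k * ∑ s ∈ univ.filter (· < t), u s * xi s k

lemma abs_entry_le (xi : Fin T → Fin K → ℝ) (t : Fin T) (k : Fin K) : |xi t k| ≤ ‖xi‖ :=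
  (norm_le_pi_norm (xi t) k).trans (norm_le_pi_norm xi t)

lemma abs_entry_mul_le (xi : Fin T → Fin K → ℝ) (t s : Fin T) (k l : Fin K) :
    |xi t k * xi s l| ≤ ‖xi‖ ^ 2 := by
  rw [abs_mul, sq]
  exact mul_le_mul (abs_entry_le _ _ _) (abs_entry_le _ _ _) (abs_nonneg _) (norm_nonneg _)

lemma abs_crossCoef_le (xi : Fin T → Fin K → ℝ) (k l : Fin K) (t : Fin T) :
    |crossCoef xi k l t| ≤ T * ‖xi‖ ^ 3 := by
  refine (abs_sum_le_sum_abs _ _).trans ?_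
  calc ∑ s ∈ univ.filter (· ≠ t), |xi t k * xi s k * xi s l|
      ≤ ∑ s ∈ univ.filter (· ≠ t), ‖xi‖ ^ 3 := Finset.sum_le_sum fun s _ => by
        rw [abs_mul, pow_succ]
        exact mul_le_mul (abs_entry_mul_le _ _ _ _ _) (abs_entry_le _ _ _) (abs_nonneg _)
          (by positivity)
    _ ≤ T * ‖xi‖ ^ 3 := by
        rw [Finset.sum_const, nsmul_eq_mul]
        gcongr
        exact (card_filter_le _ _).trans (by simp)

lemma sum_unitDiff_mul (xi : Fin T → Fin K → ℝ) (u : Fin T → ℝ) (k l : Fin K) :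
    ∑ t, unitDiff xi u t k * unitDiff xi u t l =
      quarticForm (fun t s p => xi t k * xi t l * (xi s k * xi p l)) u := by
  refine Finset.sum_congr rfl fun t _ => ?_
  rw [unitDiff, unitDiff, show ∀ a b c d : ℝ, a * b * (c * d) = a * c * (b * d) by intros; ring,
    Finset.sum_mul_sum, Finset.mul_sum]
  refine Finset.sum_congr rfl fun s _ => ?_
  rw [Finset.mul_sum]
  exact Finset.sum_congr rfl fun p _ => by ring

lemma measurable_unitScore (k : Fin K) :
    Measurable fun p : (Fin T → Fin K → ℝ) × (Fin T → ℝ) => unitScore p.1 p.2 k := by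
  unfold unitScore lowerForm; fun_prop

lemma measurable_unitDiff (t : Fin T) (k : Fin K) :
    Measurable fun p : (Fin T → Fin K → ℝ) × (Fin T → ℝ) => unitDiff p.1 p.2 t k := by
  unfold unitDiff; fun_prop

end Unit

/-! ### Convergence in probability of the terms of the statistic -/

section Terms

variable {Ω : Type*} [MeasurableSpace Ω] {μ : Measure Ω} [IsProbabilityMeasure μ] {T K : ℕ}
  {x : ℕ → Ω → Fin T → Fin K → ℝ} {ε : ℕ → Ω → Fin T → ℝ} {σ2 : ℕ → ℝ} {q D : ℝ}

/-- The conditional law of the errors given the regressors. -/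
def errorKernel (μ : Measure Ω) [IsProbabilityMeasure μ] (x : ℕ → Ω → Fin T → Fin K → ℝ)
    (ε : ℕ → Ω → Fin T → ℝ) : Kernel (ℕ → Fin T → Fin K → ℝ) (ℕ × Fin T → ℝ) :=
  condDistrib (fun ω (p : ℕ × Fin T) => ε p.1 ω p.2) (fun ω i => x i ω) μ

lemma Errors.errorLaw (h : Errors μ x ε σ2) :
    ∃ C, ∀ᵐ ω ∂μ, ErrorLaw (errorKernel μ x ε fun i => x i ω) σ2 C := by
  obtain ⟨C, hC⟩ := h.cond
  refine ⟨C, ?_⟩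
  filter_upwards [hC] with ω hω
  exact ⟨hω.1, fun p => (hω.2.2 p).1, fun p => (hω.2.2 p).2.1, fun p => (hω.2.2 p).2.2.1,
    fun p => (hω.2.2 p).2.2.2⟩

lemma Errors.measurable_errors (h : Errors μ x ε σ2) :
    Measurable fun ω (p : ℕ × Fin T) => ε p.1 ω p.2 :=
  measurable_pi_lambda _ fun p => (measurable_pi_apply p.2).comp (h.measurable p.1)

lemma MomentBound.measurable_regressors (h : MomentBound μ x q D) :
    Measurable fun ω (i : ℕ) => x i ω := measurable_pi_lambda _ h.measurable

/-- Linear forms in the errors whose coefficients are bounded by cubes of the regressors. -/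
lemma tendsto_linear_cube (hx : MomentBound μ x q D) (hε : Errors μ x ε σ2) {A : ℕ → Finset ℕ}
    (hA : Tendsto (fun N => #(A N)) atTop atTop) (k l : Fin K) :
    TendstoInMeasure μ (fun N ω =>
      (∑ i ∈ A N, ∑ t, crossCoef (x i ω) k l t * ε i ω t) / quartRoot #(A N) ^ 3) atTop 0 := by
  obtain ⟨C, hC⟩ := hε.errorLaw
  obtain ⟨B, hB⟩ := hε.var_bdd
  have hB0 : 0 ≤ B := (hε.var_pos 0).le.trans (hB 0)
  refine tendstoInMeasure_zero_of_condDistrib_sq hx.measurable_regressors hε.measurable_errors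
    (f := fun N X e => (∑ i ∈ A N, ∑ t, crossCoef (X i) k l t * e (i, t)) / quartRoot #(A N) ^ 3)
    (b := fun N X => B * T ^ 3 * ((∑ i ∈ A N, ‖X i‖ ^ 6) / quartRoot #(A N) ^ 6))
    (fun N => ?_) (fun N => ?_) ?_
  · refine (Finset.measurable_sum _ fun i _ => Finset.measurable_sum _ fun t _ => ?_).div_const _
    unfold crossCoef
    fun_prop
  · filter_upwards [hC] with ω hω
    have h1 := hω.lintegral_linear_sq_le hB (A N)
      (fun i t => crossCoef (x i ω) k l t / quartRoot #(A N) ^ 3)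
    have h2 : ∀ e : ℕ × Fin T → ℝ,
        ∑ i ∈ A N, ∑ t, crossCoef (x i ω) k l t / quartRoot #(A N) ^ 3 * e (i, t) =
        (∑ i ∈ A N, ∑ t, crossCoef (x i ω) k l t * e (i, t)) / quartRoot #(A N) ^ 3 := fun e => by
      simp only [Finset.sum_div, div_mul_eq_mul_div]
    simp only [h2] at h1
    refine h1.trans (ENNReal.ofReal_le_ofReal ?_)
    rw [mul_assoc]
    refine mul_le_mul_of_nonneg_left ?_ hB0
    rw [Finset.sum_div, Finset.mul_sum]
    refine Finset.sum_le_sum fun i _ => ?_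
    have h3 : ∀ t, (crossCoef (x i ω) k l t / quartRoot #(A N) ^ 3) ^ 2 ≤
        T ^ 2 * (‖x i ω‖ ^ 6 / quartRoot #(A N) ^ 6) := fun t => by
      rw [div_pow, ← sq_abs, ← pow_mul, ← mul_div_assoc]
      refine div_le_div_of_nonneg_right ?_ (pow_nonneg (quartRoot_nonneg _) _)
      refine (pow_le_pow_left₀ (abs_nonneg _) (abs_crossCoef_le _ k l t) 2).trans (le_of_eq ?_)
      ring
    refine (sum_univ_le h3).trans (le_of_eq ?_)
    ring
  · have h := hx.tendsto_sum_pow hA (j := 6) (by norm_num)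
    refine ASAlong.tendstoInMeasure (fun N => Measurable.aestronglyMeasurable
      (((Finset.measurable_sum _ fun i _ =>
        (hx.measurable i).norm.pow_const _).div_const _).const_mul _)) ?_
    refine (ASAlong.of_tendstoInMeasure h).mono fun l ω _ _ hl => ?_
    simpa using hl.const_mul (B * T ^ 3)

/-- The normal equations have negligible right-hand sides. -/
lemma tendsto_sum_mul_error (hx : MomentBound μ x q D) (hε : Errors μ x ε σ2) (k : Fin K) :
    TendstoInMeasure μ (fun N ω =>
      (∑ i ∈ range N, ∑ t, x i ω t k * ε i ω t) / quartRoot N ^ 3) atTop 0 := by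
  obtain ⟨C, hC⟩ := hε.errorLaw
  obtain ⟨B, hB⟩ := hε.var_bdd
  have hB0 : 0 ≤ B := (hε.var_pos 0).le.trans (hB 0)
  refine tendstoInMeasure_zero_of_condDistrib_sq hx.measurable_regressors hε.measurable_errors
    (f := fun N X e => (∑ i ∈ range N, ∑ t, X i t k * e (i, t)) / quartRoot N ^ 3)
    (b := fun N X => (B * T * (quartRoot N ^ 6)⁻¹) * ∑ i ∈ range N, ‖X i‖ ^ (2 : ℝ))
    (fun N => ?_) (fun N => ?_) ?_
  · refine (Finset.measurable_sum _ fun i _ => Finset.measurable_sum _ fun t _ => ?_).div_const _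
    fun_prop
  · filter_upwards [hC] with ω hω
    have h1 := hω.lintegral_linear_sq_le hB (range N) (fun i t => x i ω t k / quartRoot N ^ 3)
    have h2 : ∀ e : ℕ × Fin T → ℝ,
        ∑ i ∈ range N, ∑ t, x i ω t k / quartRoot N ^ 3 * e (i, t) =
        (∑ i ∈ range N, ∑ t, x i ω t k * e (i, t)) / quartRoot N ^ 3 := fun e => by
      simp only [Finset.sum_div, div_mul_eq_mul_div]
    simp only [h2] at h1
    refine h1.trans (ENNReal.ofReal_le_ofReal ?_)
    rw [mul_assoc, mul_assoc, ← mul_assoc (T : ℝ)]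
    refine mul_le_mul_of_nonneg_left ?_ hB0
    rw [Finset.mul_sum]
    refine Finset.sum_le_sum fun i _ => ?_
    have h3 : ∀ t, (x i ω t k / quartRoot N ^ 3) ^ 2 ≤ (quartRoot N ^ 6)⁻¹ * ‖x i ω‖ ^ (2 : ℝ) :=
        fun t => by
      rw [div_pow, ← sq_abs, ← pow_mul, Real.rpow_two, div_eq_inv_mul]
      refine mul_le_mul_of_nonneg_left ?_ (inv_nonneg.2 (pow_nonneg (quartRoot_nonneg _) _))
      exact pow_le_pow_left₀ (abs_nonneg _) (abs_entry_le _ _ _) 2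
    refine (sum_univ_le h3).trans (le_of_eq ?_)
    ring
  · refine hx.tendsto_mul_sum_rpow (by norm_num) (by linarith [hx.pos]) range ?_
    have h1 : Tendsto (fun N => B * T * (quartRoot N ^ 2)⁻¹) atTop (𝓝 0) := by
      simpa using (((tendsto_pow_atTop two_ne_zero).comp
        tendsto_quartRoot).inv_tendsto_atTop.const_mul (B * T))
    refine h1.congr' ?_
    filter_upwards [eventually_gt_atTop 0] with N hN
    have := quartRoot_pos hN
    have h4 : (#(range N) : ℝ) = quartRoot N ^ 4 := by rw [card_range, quartRoot_pow_four]
    rw [h4]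
    field_simp

/-- Controls the mixed term in the square of `diffError`, which has six regressor factors and two
error factors. Given the regressors, the errors contribute a bounded factor, so the sixth power sum
decides. -/
lemma tendsto_sum_pow_mul_sq (hx : MomentBound μ x q D) (hε : Errors μ x ε σ2) {A : ℕ → Finset ℕ}
    (hA : Tendsto (fun N => #(A N)) atTop atTop) :
    TendstoInMeasure μ (fun N ω =>
      (∑ i ∈ A N, ‖x i ω‖ ^ 6 * ‖ε i ω‖ ^ 2) / quartRoot #(A N) ^ 6) atTop 0 := by
  obtain ⟨C, hC⟩ := hε.errorLaw
  refine tendstoInMeasure_zero_of_condDistrib hx.measurable_regressors hε.measurable_errors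
    (f := fun N X e => (∑ i ∈ A N, ‖X i‖ ^ 6 * ‖fun t => e (i, t)‖ ^ 2) / quartRoot #(A N) ^ 6)
    (b := fun N X => (T * (1 + C)) * ((∑ i ∈ A N, ‖X i‖ ^ 6) / quartRoot #(A N) ^ 6))
    (fun N => ?_) (fun N => ?_) ?_
  · refine (Finset.measurable_sum _ fun i _ => ?_).div_const _
    fun_prop
  · filter_upwards [hC] with ω hω
    have hint : ∀ i, Integrable (fun e : ℕ × Fin T → ℝ => ‖x i ω‖ ^ 6 * ‖fun t => e (i, t)‖ ^ 2)
        (errorKernel μ x ε fun i => x i ω) := fun i =>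
      (hω.integrable_norm_pow i (k := 2) (by norm_num)).const_mul _
    refine lintegral_enorm_le_ofReal ((integrable_finsetSum _ fun i _ => hint i).div_const _)
      (fun e => div_nonneg (Finset.sum_nonneg fun i _ => by positivity)
        (pow_nonneg (quartRoot_nonneg _) _)) ?_
    refine (integral_div _ _).le.trans ?_
    refine (div_le_div_of_nonneg_right ?_ (pow_nonneg (quartRoot_nonneg _) _)).trans
      (mul_div_assoc _ _ _).le
    refine (integral_finsetSum _ fun i _ => hint i).le.trans ?_
    rw [Finset.mul_sum]
    refine Finset.sum_le_sum fun i _ => ?_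
    rw [integral_const_mul, mul_comm]
    exact mul_le_mul_of_nonneg_right (hω.integral_norm_pow_le i two_ne_zero (by norm_num))
      (by positivity)
  · have h := hx.tendsto_sum_pow hA (j := 6) (by norm_num)
    refine ASAlong.tendstoInMeasure (fun N => Measurable.aestronglyMeasurable
      (((Finset.measurable_sum _ fun i _ =>
        (hx.measurable i).norm.pow_const _).div_const _).const_mul _)) ?_
    refine (ASAlong.of_tendstoInMeasure h).mono fun l ω _ _ hl => ?_
    simpa using hl.const_mul (T * (1 + C))

/-- The average has bounded mean, since fourth error moments are bounded conditionally and `4 + q`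
regressor moments unconditionally; a null factor therefore removes it. It is the remainder in the
lower bound for the variance estimator. -/
lemma tendsto_sum_rpow_mul_pow (hx : MomentBound μ x q D) (hε : Errors μ x ε σ2) {c : ℕ → ℝ}
    (hc : Tendsto c atTop (𝓝 0)) :
    TendstoInMeasure μ (fun N ω =>
      c N * ((∑ i ∈ range N, ‖x i ω‖ ^ (4 + q) * (1 + ‖ε i ω‖ ^ 4)) / N)) atTop 0 := by
  obtain ⟨C, hC⟩ := hε.errorLaw
  refine tendstoInMeasure_zero_of_condDistrib hx.measurable_regressors hε.measurable_errors
    (f := fun N X e =>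
      c N * ((∑ i ∈ range N, ‖X i‖ ^ (4 + q) * (1 + ‖fun t => e (i, t)‖ ^ 4)) / N))
    (b := fun N X => (|c N| * (1 + T * (1 + C)) / N) * ∑ i ∈ range N, ‖X i‖ ^ (4 + q))
    (fun N => ?_) (fun N => ?_) ?_
  · refine ((Finset.measurable_sum _ fun i _ => ?_).div_const _).const_mul _
    fun_prop
  · filter_upwards [hC] with ω hω
    have := hω.isProbabilityMeasure
    have hint1 : ∀ i, Integrable (fun e : ℕ × Fin T → ℝ => 1 + ‖fun t => e (i, t)‖ ^ 4)
        (errorKernel μ x ε fun i => x i ω) := fun i =>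
      (integrable_const 1).add (hω.integrable_norm_pow i (k := 4) (by norm_num))
    have hint : ∀ i, Integrable (fun e : ℕ × Fin T → ℝ =>
        ‖x i ω‖ ^ (4 + q) * (1 + ‖fun t => e (i, t)‖ ^ 4))
        (errorKernel μ x ε fun i => x i ω) := fun i => (hint1 i).const_mul _
    have h0 : ∀ e : ℕ × Fin T → ℝ,
        0 ≤ (∑ i ∈ range N, ‖x i ω‖ ^ (4 + q) * (1 + ‖fun t => e (i, t)‖ ^ 4)) / (N : ℝ) := fun e =>
      div_nonneg (Finset.sum_nonneg fun i _ => by positivity) (Nat.cast_nonneg _)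
    have h1 : ∀ e : ℕ × Fin T → ℝ,
        ‖c N * ((∑ i ∈ range N, ‖x i ω‖ ^ (4 + q) * (1 + ‖fun t => e (i, t)‖ ^ 4)) / N)‖ₑ =
        ‖|c N| * ((∑ i ∈ range N, ‖x i ω‖ ^ (4 + q) * (1 + ‖fun t => e (i, t)‖ ^ 4)) / N)‖ₑ :=
      fun e => by
        rw [enorm_mul, enorm_mul]
        congr 1
        rw [← ofReal_norm, ← ofReal_norm, Real.norm_eq_abs, Real.norm_eq_abs, abs_abs]
    refine (lintegral_congr h1).le.trans ?_
    refine lintegral_enorm_le_ofReal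
      (((integrable_finsetSum _ fun i _ => hint i).div_const _).const_mul _)
      (fun e => mul_nonneg (abs_nonneg _) (h0 e)) ?_
    refine (integral_const_mul _ _).le.trans ?_
    rw [mul_div_assoc, mul_assoc]
    refine mul_le_mul_of_nonneg_left ?_ (abs_nonneg _)
    refine (integral_div _ _).le.trans ?_
    rw [div_mul_eq_mul_div]
    refine div_le_div_of_nonneg_right ?_ (Nat.cast_nonneg _)
    refine (integral_finsetSum _ fun i _ => hint i).le.trans ?_
    rw [Finset.mul_sum]
    refine Finset.sum_le_sum fun i _ => ?_
    rw [integral_const_mul, mul_comm]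
    refine mul_le_mul_of_nonneg_right ?_ (by positivity)
    rw [integral_add (integrable_const 1) (hω.integrable_norm_pow i (k := 4) (by norm_num))]
    exact add_le_add (by simp) (hω.integral_norm_pow_le i (by norm_num) (by norm_num))
  · refine hx.tendsto_mul_sum_rpow (by linarith [hx.pos]) le_rfl range ?_
    have h1 := (hc.abs.mul_const (1 + T * (1 + C)))
    rw [abs_zero, zero_mul] at h1
    refine h1.congr' ?_
    filter_upwards [eventually_gt_atTop 0] with N hN
    have : (N : ℝ) ≠ 0 := by positivity
    rw [card_range, div_mul_cancel₀ _ this]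

/-- The outer products of the martingale differences have the same limit as their conditional
expectations. -/
lemma tendsto_sum_unitDiff (hx : MomentBound μ x q D) (hε : Errors μ x ε σ2)
    {V : Matrix (Fin K) (Fin K) ℝ}
    (hV : PLim μ (fun N ω => groupAvg (range N) fun i => σ2 i ^ 2 • unitV (x i ω)) V)
    (k l : Fin K) :
    TendstoInMeasure μ (fun N ω =>
      (∑ i ∈ range N, ∑ t, unitDiff (x i ω) (ε i ω) t k * unitDiff (x i ω) (ε i ω) t l) / N)
      atTop (fun _ => V k l) := by
  obtain ⟨C, hC⟩ := hε.errorLaw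
  -- Given the regressors, the quartic forms are independent over units, and the subtracted terms
  -- are their means. The variance of their average is of order `∑ ‖x_i‖^8 / N²`.
  have hdiff : TendstoInMeasure μ (fun N ω => (∑ i ∈ range N,
      (quarticForm (fun t s p => x i ω t k * x i ω t l * (x i ω s k * x i ω p l)) (ε i ω) -
        σ2 i ^ 2 * ∑ t, ∑ s ∈ univ.filter (· < t),
          x i ω t k * x i ω t l * (x i ω s k * x i ω s l))) / N) atTop 0 := by
    refine tendstoInMeasure_zero_of_condDistrib_sq hx.measurable_regressors hε.measurable_errors
      (f := fun N X e => (∑ i ∈ range N,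
        (quarticForm (fun t s p => X i t k * X i t l * (X i s k * X i p l)) (fun t => e (i, t)) -
          σ2 i ^ 2 * ∑ t, ∑ s ∈ univ.filter (· < t), X i t k * X i t l * (X i s k * X i s l))) / N)
      (b := fun N X => (T ^ 6 * (1 + C) ^ 2) * ((∑ i ∈ range N, ‖X i‖ ^ 8) / quartRoot N ^ 8))
      (fun N => ?_) (fun N => ?_) ?_
    · refine (Finset.measurable_sum _ fun i _ => ?_).div_const _
      unfold quarticForm
      fun_prop
    · filter_upwards [hC] with ω hω
      have h1 := hω.lintegral_quarticForm_sub_sq_le (range N)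
        (Q := fun i t s p => x i ω t k * x i ω t l * (x i ω s k * x i ω p l))
        (β := fun i => ‖x i ω‖ ^ 4) fun i t s p => by
          rw [abs_mul, show (4 : ℕ) = 2 + 2 by rfl, pow_add]
          exact mul_le_mul (abs_entry_mul_le _ _ _ _ _) (abs_entry_mul_le _ _ _ _ _) (abs_nonneg _)
            (by positivity)
      have h2 : ENNReal.ofReal ((T ^ 6 * (1 + C) ^ 2) *
          ((∑ i ∈ range N, ‖x i ω‖ ^ 8) / quartRoot N ^ 8)) =
          ENNReal.ofReal (((N : ℝ) ^ 2)⁻¹) *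
            ENNReal.ofReal (T ^ 6 * (1 + C) ^ 2 * ∑ i ∈ range N, (‖x i ω‖ ^ 4) ^ 2) := by
        rw [← ENNReal.ofReal_mul (by positivity)]
        congr 1
        simp only [← pow_mul]
        rw [show quartRoot N ^ 8 = (quartRoot N ^ 4) ^ 2 by ring, quartRoot_pow_four]
        ring
      rw [h2]
      refine le_trans (le_of_eq ?_) (mul_le_mul_right h1 _)
      rw [← lintegral_const_mul']
      · refine lintegral_congr fun e => ?_
        rw [div_pow, div_eq_inv_mul, enorm_mul]
        congr 1
        exact Real.enorm_of_nonneg (by positivity)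
      · exact ENNReal.ofReal_ne_top
    · have h := hx.tendsto_sum_pow (A := range) (by simpa using! tendsto_id) (j := 8) (by norm_num)
      refine ASAlong.tendstoInMeasure (fun N => Measurable.aestronglyMeasurable
        (((Finset.measurable_sum _ fun i _ =>
          (hx.measurable i).norm.pow_const _).div_const _).const_mul _)) ?_
      refine (ASAlong.of_tendstoInMeasure h).mono fun l ω _ _ hl => ?_
      simpa using hl.const_mul (T ^ 6 * (1 + C) ^ 2)
  have hmx := hx.measurable
  have hme := hε.measurable
  refine ASAlong.tendstoInMeasure (fun N => Measurable.aestronglyMeasurable ?_) ?_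
  · refine (Finset.measurable_sum _ fun i _ => Finset.measurable_sum _ fun t _ => ?_).div_const _
    exact ((measurable_unitDiff t k).comp ((hmx i).prodMk (hme i))).mul
      ((measurable_unitDiff t l).comp ((hmx i).prodMk (hme i)))
  refine ((ASAlong.of_tendstoInMeasure hdiff).and (ASAlong.of_tendstoInMeasure (hV k l))).mono
    fun f ω _ _ hl => ?_
  have := hl.1.add hl.2
  rw [Pi.zero_apply, zero_add] at this
  refine this.congr fun N => ?_
  simp only [sum_unitDiff_mul, Finset.sum_sub_distrib, sub_div]
  have : groupAvg (range N) (fun i => σ2 i ^ 2 • unitV (x i ω)) k l =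
      (∑ i ∈ range N, σ2 i ^ 2 * ∑ t, ∑ s ∈ univ.filter (· < t),
        x i ω t k * x i ω t l * (x i ω s k * x i ω s l)) / N := by
    rw [groupAvg, Matrix.smul_apply, Matrix.sum_apply, card_range, smul_eq_mul, div_eq_inv_mul]
    congr 1
    refine Finset.sum_congr rfl fun i _ => ?_
    rw [Matrix.smul_apply, smul_eq_mul]
    congr 1
    rw [unitV, Matrix.of_apply]
    refine Finset.sum_congr rfl fun t _ => Finset.sum_congr rfl fun s _ => ?_
    ring
  rw [this]
  ring

/-- The score of the true errors is of order `√N`. -/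
lemma tendsto_mul_sum_unitScore (hx : MomentBound μ x q D) (hε : Errors μ x ε σ2) {c : ℕ → ℝ}
    (hc : Tendsto c atTop (𝓝 0)) (k : Fin K) :
    TendstoInMeasure μ (fun N ω =>
      c N * ((∑ i ∈ range N, unitScore (x i ω) (ε i ω) k) / quartRoot N ^ 2)) atTop 0 := by
  obtain ⟨C, hC⟩ := hε.errorLaw
  obtain ⟨B, hB⟩ := hε.var_bdd
  refine tendstoInMeasure_zero_of_condDistrib_sq hx.measurable_regressors hε.measurable_errors
    (f := fun N X e => c N *
      ((∑ i ∈ range N, unitScore (X i) (fun t => e (i, t)) k) / quartRoot N ^ 2))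
    (b := fun N X => (B ^ 2 * T ^ 2 * c N ^ 2 * (N : ℝ)⁻¹) * ∑ i ∈ range N, ‖X i‖ ^ (4 : ℝ))
    (fun N => ?_) (fun N => ?_) ?_
  · refine ((Finset.measurable_sum _ fun i _ => ?_).div_const _).const_mul _
    unfold unitScore lowerForm
    fun_prop
  · filter_upwards [hC] with ω hω
    have h1 := hω.lintegral_lowerForm_sq_le (range N) (fun i => (hε.var_pos i).le) hB
        (B := fun i t s => x i ω t k * x i ω s k) (β := fun i => ‖x i ω‖ ^ 2)
        (fun i t s => abs_entry_mul_le _ _ _ _ _) fun i => by positivity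
    have h2 : ENNReal.ofReal ((B ^ 2 * T ^ 2 * c N ^ 2 * (N : ℝ)⁻¹) *
        ∑ i ∈ range N, ‖x i ω‖ ^ (4 : ℝ)) = ENNReal.ofReal (c N ^ 2 * (N : ℝ)⁻¹) *
          ENNReal.ofReal (B ^ 2 * T ^ 2 * ∑ i ∈ range N, (‖x i ω‖ ^ 2) ^ 2) := by
      rw [← ENNReal.ofReal_mul (by positivity)]
      congr 1
      have : ∀ i, ‖x i ω‖ ^ (4 : ℝ) = (‖x i ω‖ ^ 2) ^ 2 := fun i => by
        rw [← pow_mul, ← Real.rpow_natCast]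
        norm_num
      simp only [this]
      ring
    rw [h2]
    refine le_trans (le_of_eq ?_) (mul_le_mul_right h1 _)
    rw [← lintegral_const_mul']
    · refine lintegral_congr fun e => ?_
      rw [mul_pow, div_pow, ← pow_mul, quartRoot_pow_four, div_eq_inv_mul, ← mul_assoc, enorm_mul]
      congr 1
      exact Real.enorm_of_nonneg (by positivity)
    · exact ENNReal.ofReal_ne_top
  · refine hx.tendsto_mul_sum_rpow (by norm_num) (by linarith [hx.pos]) range ?_
    have h1 := (hc.pow 2).const_mul (B ^ 2 * T ^ 2)
    rw [zero_pow two_ne_zero, mul_zero] at h1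
    refine h1.congr' ?_
    filter_upwards [eventually_gt_atTop 0] with N hN
    have : (N : ℝ) ≠ 0 := by positivity
    rw [card_range, inv_mul_cancel_right₀ this]

end Terms

/-! ### The central limit theorem for the score of the true errors -/

section CLT

lemma tendsto_integral_of_asAlong {Ω : Type*} [MeasurableSpace Ω] {μ : Measure Ω}
    [IsProbabilityMeasure μ] {f : ℕ → Ω → ℂ} {c : ℂ} (hf : ∀ n, AEStronglyMeasurable (f n) μ)
    (hb : ∀ n ω, ‖f n ω‖ ≤ 1) (h : ASAlong μ fun l ω => Tendsto (fun n => f n ω) l (𝓝 c)) :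
    Tendsto (fun n => ∫ ω, f n ω ∂μ) atTop (𝓝 c) := by
  refine tendsto_of_subseq_tendsto fun ns hns => ?_
  obtain ⟨ks, hks, hns'⟩ := strictMono_subseq_of_tendsto_atTop hns
  obtain ⟨ms, -, hae⟩ := h _ hns'
  refine ⟨ks ∘ ms, ?_⟩
  have hc : c = ∫ _, c ∂μ := by simp
  rw [hc]
  refine tendsto_integral_of_dominated_convergence (fun _ => (1 : ℝ)) (fun n => hf _)
    (integrable_const _) (fun n => .of_forall fun ω => hb _ ω) ?_
  filter_upwards [hae] with ω hω
  exact tendsto_map'_iff.1 (hω _ inferInstance le_rfl)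

lemma integral_eq_integral_condDistrib {Ω 𝓧 𝓔 : Type*} [MeasurableSpace Ω] {μ : Measure Ω}
    [IsProbabilityMeasure μ] [MeasurableSpace 𝓧] [MeasurableSpace 𝓔] [StandardBorelSpace 𝓔]
    [Nonempty 𝓔] {X : Ω → 𝓧} {E : Ω → 𝓔} (hX : Measurable X) (hE : Measurable E)
    {f : 𝓧 × 𝓔 → ℂ} (hf : Measurable f) (hb : ∀ p, ‖f p‖ ≤ 1) :
    ∫ ω, f (X ω, E ω) ∂μ = ∫ ω, ∫ e, f (X ω, e) ∂condDistrib E X μ (X ω) ∂μ := by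
  have hint : Integrable f (μ.map X ⊗ₘ condDistrib E X μ) :=
    (integrable_const (1 : ℝ)).mono' hf.aestronglyMeasurable (.of_forall hb)
  rw [← integral_map (hX.prodMk hE).aemeasurable hf.aestronglyMeasurable,
    ← compProd_map_condDistrib hE.aemeasurable, Measure.integral_compProd hint,
    integral_map hX.aemeasurable
      hf.stronglyMeasurable.integral_kernel_prod_right'.aestronglyMeasurable]

variable {Ω : Type*} [MeasurableSpace Ω] {μ : Measure Ω} [IsProbabilityMeasure μ] {T K : ℕ}
  {x : ℕ → Ω → Fin T → Fin K → ℝ} {ε : ℕ → Ω → Fin T → ℝ} {σ2 : ℕ → ℝ} {q D : ℝ}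

/-- The Cramér–Wold step: a linear combination of score components is again a `lowerForm`, so the
scalar comparison applies to it. -/
lemma sum_mul_unitScore (xi : Fin T → Fin K → ℝ) (u : Fin T → ℝ) (θ : Fin K → ℝ) (r : ℝ) :
    ∑ k, θ k * (unitScore xi u k / r) =
      lowerForm (fun t s => (∑ k, θ k * (xi t k * xi s k)) / r) u := by
  simp only [unitScore, lowerForm, Finset.mul_sum, Finset.sum_div, Finset.sum_mul]
  rw [Finset.sum_comm]
  refine Finset.sum_congr rfl fun t _ => ?_
  rw [Finset.sum_comm]
  refine Finset.sum_congr rfl fun s _ => Finset.sum_congr rfl fun k _ => ?_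
  ring

/-- The right-hand side is, apart from the factor `σ_i⁴` and the scaling, the variance of the form
in `sum_mul_unitScore`. -/
lemma dotProduct_unitV (xi : Fin T → Fin K → ℝ) (θ : Fin K → ℝ) :
    θ ⬝ᵥ (unitV xi *ᵥ θ) =
      ∑ t, ∑ s ∈ univ.filter (· < t), (∑ k, θ k * (xi t k * xi s k)) ^ 2 := by
  simp only [dotProduct, mulVec, unitV, Matrix.of_apply, sq, Finset.sum_mul_sum]
  simp only [Finset.mul_sum, Finset.sum_mul]
  conv_lhs => enter [2, l]; rw [Finset.sum_comm]
  rw [Finset.sum_comm]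
  refine Finset.sum_congr rfl fun t _ => ?_
  conv_lhs => enter [2, l]; rw [Finset.sum_comm]
  rw [Finset.sum_comm]
  refine Finset.sum_congr rfl fun s _ => ?_
  refine Finset.sum_congr rfl fun k _ => Finset.sum_congr rfl fun l _ => ?_
  ring

/-- Moving `A` to the other side of the inner product gives the standard Gaussian characteristic
function at `Aᵀ θ`, whose squared norm is `θ' A A' θ`. -/
lemma charFun_map_mulVec_pi (A : Matrix (Fin K) (Fin K) ℝ) (θ : EuclideanSpace ℝ (Fin K)) :
    charFun ((Measure.pi fun _ : Fin K => gaussianReal 0 1).map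
      fun z => WithLp.toLp 2 (A *ᵥ z)) θ =
      (Real.exp (-(θ.ofLp ⬝ᵥ ((A * Aᵀ) *ᵥ θ.ofLp) / 2)) : ℂ) := by
  have hm : Measurable fun z : Fin K → ℝ => WithLp.toLp 2 (A *ᵥ z) := by
    refine (PiLp.continuous_toLp 2 _).measurable.comp ?_
    exact (Continuous.matrix_mulVec continuous_const continuous_id).measurable
  have h1 := charFun_stdGaussian (WithLp.toLp 2 (Aᵀ *ᵥ θ.ofLp) : EuclideanSpace ℝ (Fin K))
  rw [← map_pi_eq_stdGaussian, charFun_apply, integral_map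
    (PiLp.continuous_toLp 2 _).measurable.aemeasurable (by fun_prop)] at h1
  rw [charFun_apply, integral_map hm.aemeasurable (by fun_prop)]
  have h2 : ∀ z : Fin K → ℝ, inner ℝ (WithLp.toLp 2 (A *ᵥ z) : EuclideanSpace ℝ (Fin K)) θ =
      inner ℝ (WithLp.toLp 2 z : EuclideanSpace ℝ (Fin K)) (WithLp.toLp 2 (Aᵀ *ᵥ θ.ofLp)) :=
    fun z => by
      simp only [EuclideanSpace.inner_eq_star_dotProduct, star_trivial]
      rw [dotProduct_mulVec, mulVec_transpose]
  simp_rw [h2]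
  have h3 : ‖(WithLp.toLp 2 (Aᵀ *ᵥ θ.ofLp) : EuclideanSpace ℝ (Fin K))‖ ^ 2 =
      θ.ofLp ⬝ᵥ ((A * Aᵀ) *ᵥ θ.ofLp) := by
    rw [EuclideanSpace.norm_sq_eq, ← mulVec_mulVec, dotProduct_mulVec, ← mulVec_transpose, dotProduct]
    refine Finset.sum_congr rfl fun i _ => ?_
    rw [Real.norm_eq_abs, sq_abs, sq]
  rw [h1, ← Complex.ofReal_pow, h3]
  push_cast
  congr 1
  ring

-- The quantitative comparison is applied under the conditional law of the errors. Along
-- subsequences the conditional characteristic functions converge almost surely to a nonrandom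
-- limit, and as they are bounded by one the expectation over the regressors follows.
open Complex in
lemma tendsto_charFun_score (hx : MomentBound μ x q D) (hε : Errors μ x ε σ2)
    {V : Matrix (Fin K) (Fin K) ℝ}
    (hV : PLim μ (fun N ω => groupAvg (range N) fun i => σ2 i ^ 2 • unitV (x i ω)) V)
    (θ : Fin K → ℝ) :
    Tendsto (fun N => ∫ ω, cexp ((∑ k, θ k *
      ((∑ i ∈ range N, unitScore (x i ω) (ε i ω) k) / quartRoot N ^ 2) : ℝ) * I) ∂μ) atTop
      (𝓝 (Real.exp (-(θ ⬝ᵥ (V *ᵥ θ) / 2)) : ℂ)) := by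
  obtain ⟨C, hC⟩ := hε.errorLaw
  obtain ⟨B, hB⟩ := hε.var_bdd
  let β : ℕ → (ℕ → Fin T → Fin K → ℝ) → ℕ → Fin T → Fin T → ℝ := fun N X i t s =>
    (∑ k, θ k * (X i t k * X i s k)) / quartRoot N ^ 2
  let F : ℕ → (ℕ → Fin T → Fin K → ℝ) × (ℕ × Fin T → ℝ) → ℂ := fun N p =>
    cexp ((∑ i ∈ range N, lowerForm (β N p.1 i) (fun t => p.2 (i, t)) : ℝ) * I)
  have hFm : ∀ N, Measurable (F N) := fun N => by
    simp only [F, β, lowerForm]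
    fun_prop
  have hFb : ∀ N p, ‖F N p‖ ≤ 1 := fun N p => (norm_exp_ofReal_mul_I _).le
  have hF : ∀ N ω, cexp ((∑ k, θ k *
      ((∑ i ∈ range N, unitScore (x i ω) (ε i ω) k) / quartRoot N ^ 2) : ℝ) * I) =
      F N (fun i => x i ω, fun p => ε p.1 ω p.2) := fun N ω => by
    simp only [F, β]
    congr 3
    simp only [Finset.sum_div, Finset.mul_sum]
    rw [Finset.sum_comm]
    refine Finset.sum_congr rfl fun i _ => ?_
    rw [sum_mul_unitScore]
    simp only [Finset.sum_div]
  simp_rw [hF]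
  have hdis : ∀ N, ∫ ω, F N (fun i => x i ω, fun p => ε p.1 ω p.2) ∂μ =
      ∫ ω, ∫ e, F N (fun i => x i ω, e) ∂errorKernel μ x ε (fun i => x i ω) ∂μ := fun N =>
    integral_eq_integral_condDistrib hx.measurable_regressors hε.measurable_errors (hFm N) (hFb N)
  simp_rw [hdis]
  have hmeas : ∀ N, AEStronglyMeasurable
      (fun ω => ∫ e, F N (fun i => x i ω, e) ∂errorKernel μ x ε (fun i => x i ω)) μ := fun N =>
    ((hFm N).stronglyMeasurable.integral_condDistrib
      (X := fun ω i => x i ω) (Y := fun ω (p : ℕ × Fin T) => ε p.1 ω p.2) (μ := μ)).measurable.comp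
      hx.measurable_regressors |>.aestronglyMeasurable
  have hprob : ∀ X, IsProbabilityMeasure (errorKernel μ x ε X) := fun X => by
    unfold errorKernel; infer_instance
  refine tendsto_integral_of_asAlong hmeas (fun N ω => ?_) ?_
  · refine (norm_integral_le_integral_norm _).trans ?_
    refine (integral_mono_of_nonneg (.of_forall fun _ => norm_nonneg _) (integrable_const (1 : ℝ))
      (.of_forall fun e => hFb N _)).trans ?_
    simp
  have h6 := ASAlong.of_tendstoInMeasure
    (hx.tendsto_sum_pow (A := range) (by simpa using! tendsto_id) (j := 6) (by norm_num))
  have h8 := ASAlong.of_tendstoInMeasure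
    (hx.tendsto_sum_pow (A := range) (by simpa using! tendsto_id) (j := 8) (by norm_num))
  have hVa : ASAlong μ fun l ω => ∀ k j, Tendsto (fun N =>
      groupAvg (range N) (fun i => σ2 i ^ 2 • unitV (x i ω)) k j) l (𝓝 (V k j)) :=
    ASAlong.forall fun k => ASAlong.forall fun j => ASAlong.of_tendstoInMeasure (hV k j)
  -- A property that holds almost surely and does not involve `N` is put in this form only to be
  -- combined with the limits.
  have hlaw : ASAlong μ fun _ ω => ErrorLaw (errorKernel μ x ε fun i => x i ω) σ2 C := by
    intro ns _
    refine ⟨id, strictMono_id, ?_⟩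
    filter_upwards [hC] with ω hω l _ _ using hω
  refine (((h6.and h8).and hVa).and hlaw).mono fun l ω _ hl ⟨⟨⟨h6, h8⟩, hVl⟩, hω⟩ => ?_
  set c := ∑ k, |θ k|
  have hc : 0 ≤ c := Finset.sum_nonneg fun k _ => abs_nonneg _
  have hβ : ∀ N i t s, |β N (fun i => x i ω) i t s| ≤ c * ‖x i ω‖ ^ 2 / quartRoot N ^ 2 := by
    intro N i t s
    rw [abs_div, abs_of_nonneg (pow_nonneg (quartRoot_nonneg N) 2), Finset.sum_mul]
    refine div_le_div_of_nonneg_right ((abs_sum_le_sum_abs _ _).trans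
      (Finset.sum_le_sum fun k _ => ?_)) (pow_nonneg (quartRoot_nonneg N) 2)
    rw [abs_mul]
    exact mul_le_mul_of_nonneg_left (abs_entry_mul_le _ _ _ _ _) (abs_nonneg _)
  have hv : Tendsto (fun N => ∑ i ∈ range N, σ2 i ^ 2 *
      ∑ t, ∑ s ∈ univ.filter (· < t), β N (fun i => x i ω) i t s ^ 2) l (𝓝 (θ ⬝ᵥ (V *ᵥ θ))) := by
    have h1 : Tendsto (fun N => θ ⬝ᵥ
        (groupAvg (range N) (fun i => σ2 i ^ 2 • unitV (x i ω)) *ᵥ θ)) l (𝓝 (θ ⬝ᵥ (V *ᵥ θ))) := by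
      simp only [dotProduct, mulVec]
      exact tendsto_finsetSum _ fun k _ => (tendsto_finsetSum _ fun j _ =>
        (hVl k j).mul_const _).const_mul _
    refine h1.congr fun N => ?_
    rw [groupAvg, smul_mulVec, dotProduct_smul, Matrix.sum_mulVec, dotProduct_sum, card_range,
      smul_eq_mul, Finset.mul_sum]
    refine Finset.sum_congr rfl fun i _ => ?_
    rw [smul_mulVec, dotProduct_smul, smul_eq_mul, dotProduct_unitV]
    have h4 : (quartRoot N ^ 2) ^ 2 = (N : ℝ) := by rw [← pow_mul, quartRoot_pow_four]
    simp only [β, div_pow, h4, ← Finset.sum_div]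
    rw [div_eq_inv_mul]
    exact mul_left_comm _ _ _
  have hlim : Tendsto (fun N => (Real.exp (-((∑ i ∈ range N, σ2 i ^ 2 *
      ∑ t, ∑ s ∈ univ.filter (· < t), β N (fun i => x i ω) i t s ^ 2) / 2)) : ℂ)) l
      (𝓝 (Real.exp (-(θ ⬝ᵥ (V *ᵥ θ) / 2)) : ℂ)) :=
    (continuous_ofReal.tendsto _).comp
      ((Real.continuous_exp.tendsto _).comp (hv.div_const 2).neg)
  have hdiff : Tendsto (fun N => (∫ e, F N (fun i => x i ω, e) ∂errorKernel μ x ε fun i => x i ω) -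
      (Real.exp (-((∑ i ∈ range N, σ2 i ^ 2 *
      ∑ t, ∑ s ∈ univ.filter (· < t), β N (fun i => x i ω) i t s ^ 2) / 2)) : ℂ)) l (𝓝 0) := by
    -- The coefficients are bounded by `c ‖x_i‖² / √N`; their third and fourth powers yield the
    -- sixth and eighth power sums.
    have hb : Tendsto (fun N => 4 * (T ^ 7 * (1 + C)) * (c ^ 3 *
        ((∑ i ∈ range N, ‖x i ω‖ ^ 6) / quartRoot N ^ 6)) + B ^ 4 * T ^ 4 * (c ^ 4 *
        ((∑ i ∈ range N, ‖x i ω‖ ^ 8) / quartRoot N ^ 8))) l (𝓝 0) := by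
      simp only [card_range, Pi.zero_apply] at h6 h8
      simpa using ((h6.const_mul (c ^ 3)).const_mul (4 * (T ^ 7 * (1 + C)))).add
        ((h8.const_mul (c ^ 4)).const_mul (B ^ 4 * T ^ 4))
    refine squeeze_zero_norm (fun N => ?_) hb
    refine (hω.norm_charFun_sum_lowerForm_sub_le (fun i => (hε.var_pos i).le) hB (range N) (hβ N)
      fun i => by have := quartRoot_nonneg N; positivity).trans (le_of_eq ?_)
    congr 2
    · rw [Finset.sum_div, Finset.mul_sum]
      refine Finset.sum_congr rfl fun i _ => ?_
      ring
    · rw [Finset.sum_div, Finset.mul_sum]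
      refine Finset.sum_congr rfl fun i _ => ?_
      ring
  simpa using hdiff.add hlim

/-- The central limit theorem for the score of the true errors. -/
theorem tendstoInDistribution_score (hx : MomentBound μ x q D) (hε : Errors μ x ε σ2)
    {V A : Matrix (Fin K) (Fin K) ℝ}
    (hV : PLim μ (fun N ω => groupAvg (range N) fun i => σ2 i ^ 2 • unitV (x i ω)) V)
    (hA : A * Aᵀ = V) :
    TendstoInDistribution (fun N ω k =>
      (∑ i ∈ range N, unitScore (x i ω) (ε i ω) k) / quartRoot N ^ 2) atTop
      (fun z : Fin K → ℝ => A *ᵥ z) (fun _ => μ) (Measure.pi fun _ => gaussianReal 0 1) := by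
  have hZm : ∀ N, Measurable fun ω k =>
      (∑ i ∈ range N, unitScore (x i ω) (ε i ω) k) / quartRoot N ^ 2 := fun N => by
    refine measurable_pi_lambda _ fun k => Measurable.div_const ?_ _
    refine Finset.measurable_sum _ fun i _ => ?_
    have h := (measurable_unitScore (T := T) k).comp ((hx.measurable i).prodMk (hε.measurable i))
    exact h
  have hAm : Measurable fun z : Fin K → ℝ => A *ᵥ z :=
    (Continuous.matrix_mulVec continuous_const continuous_id).measurable
  have hLm : Measurable (WithLp.toLp 2 : (Fin K → ℝ) → EuclideanSpace ℝ (Fin K)) :=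
    (PiLp.continuous_toLp 2 _).measurable
  have hE : TendstoInDistribution (fun N ω => (WithLp.toLp 2 fun k =>
      (∑ i ∈ range N, unitScore (x i ω) (ε i ω) k) / quartRoot N ^ 2 : EuclideanSpace ℝ (Fin K)))
      atTop (fun z : Fin K → ℝ => (WithLp.toLp 2 (A *ᵥ z) : EuclideanSpace ℝ (Fin K)))
      (fun _ => μ) (Measure.pi fun _ => gaussianReal 0 1) := by
    refine ⟨fun N => (hLm.comp (hZm N)).aemeasurable, (hLm.comp hAm).aemeasurable, ?_⟩
    refine ProbabilityMeasure.tendsto_iff_tendsto_charFun.2 fun θ => ?_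
    simp only [ProbabilityMeasure.coe_mk]
    rw [charFun_map_mulVec_pi, hA]
    refine (tendsto_charFun_score hx hε hV θ.ofLp).congr fun N => ?_
    have hm : Measurable fun ω => (WithLp.toLp 2 fun k =>
      (∑ i ∈ range N, unitScore (x i ω) (ε i ω) k) / quartRoot N ^ 2 :
        EuclideanSpace ℝ (Fin K)) := hLm.comp (hZm N)
    rw [charFun_apply, integral_map hm.aemeasurable (by fun_prop)]
    refine integral_congr_ae (.of_forall fun ω => ?_)
    simp only [EuclideanSpace.inner_eq_star_dotProduct, star_trivial, dotProduct]
  exact hE.continuous_comp (g := WithLp.ofLp) (PiLp.continuous_ofLp 2 _)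

end CLT

/-! ### Expansions of the statistic in the true errors -/

section Expansion

variable {T K : ℕ}

/-- Renaming the two periods in one half turns `s < t` into `t < s`. This symmetrisation is what
produces the range `s ≠ t` in `crossCoef`. -/
lemma sum_lt_add_sum_lt_swap (f : Fin T → Fin T → ℝ) :
    ∑ t, ∑ s ∈ univ.filter (· < t), (f t s + f s t) = ∑ t, ∑ s ∈ univ.filter (· ≠ t), f t s := by
  have h : ∑ t, ∑ s ∈ univ.filter (· < t), f s t = ∑ t : Fin T, ∑ s ∈ univ.filter (t < ·), f t s := by
    simp only [Finset.sum_filter]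
    exact Finset.sum_comm
  simp only [Finset.sum_add_distrib]
  rw [h, ← Finset.sum_add_distrib]
  refine Finset.sum_congr rfl fun t _ => ?_
  simp only [Finset.sum_filter, ← Finset.sum_add_distrib]
  refine Finset.sum_congr rfl fun s _ => ?_
  rcases lt_trichotomy s t with h | h | h
  · simp [h, h.ne, h.not_gt]
  · simp [h]
  · simp [h, h.ne', h.not_gt]

lemma dotProduct_unitU_mulVec (xi : Fin T → Fin K → ℝ) (k : Fin K) (v w : Fin K → ℝ) :
    v ⬝ᵥ (unitU xi k *ᵥ w) =
      ∑ t, ∑ s ∈ univ.filter (· < t), xi t k * xi s k * ((xi t ⬝ᵥ v) * (xi s ⬝ᵥ w)) := by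
  simp only [unitU, Matrix.sum_mulVec, dotProduct_sum, smul_mulVec, dotProduct_smul,
    vecMulVec_mulVec, smul_eq_mul, op_smul_eq_smul]
  refine Finset.sum_congr rfl fun t _ => Finset.sum_congr rfl fun s _ => ?_
  rw [dotProduct_comm v]
  ring

/-- Each product `(u_t + x_t'η)(u_s + x_s'η)` is multiplied out. The two mixed terms combine, by the
symmetrisation above, into one form linear in `u`, and the last term is the quadratic form of
`unitU`. -/
lemma unitScore_add (xi : Fin T → Fin K → ℝ) (u : Fin T → ℝ) (η : Fin K → ℝ) (k : Fin K) :
    unitScore xi (fun t => u t + xi t ⬝ᵥ η) k = unitScore xi u k +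
      η ⬝ᵥ (fun l => ∑ t, crossCoef xi k l t * u t) + η ⬝ᵥ (unitU xi k *ᵥ η) := by
  have h1 : η ⬝ᵥ (fun l => ∑ t, crossCoef xi k l t * u t) =
      ∑ t, ∑ s ∈ univ.filter (· ≠ t), xi t k * xi s k * (xi s ⬝ᵥ η * u t) := by
    simp only [dotProduct, crossCoef, Finset.mul_sum, Finset.sum_mul]
    rw [Finset.sum_comm]
    refine Finset.sum_congr rfl fun t _ => ?_
    rw [Finset.sum_comm]
    exact Finset.sum_congr rfl fun s _ => Finset.sum_congr rfl fun l _ => by ring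
  rw [h1, dotProduct_unitU_mulVec, ← sum_lt_add_sum_lt_swap, unitScore, unitScore, lowerForm,
    lowerForm, ← Finset.sum_add_distrib, ← Finset.sum_add_distrib]
  refine Finset.sum_congr rfl fun t _ => ?_
  rw [← Finset.sum_add_distrib, ← Finset.sum_add_distrib]
  exact Finset.sum_congr rfl fun s _ => by ring

/-- Here `c` is the deviation of the slopes in the group `B` and `b` the estimation error common to
all units. The matrices `unitU` need not be symmetric, so the mixed term involves the sum with the
transpose. -/
lemma sum_unitScore_add {A B : Finset ℕ} (hBA : B ⊆ A) (X : ℕ → Fin T → Fin K → ℝ)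
    (E : ℕ → Fin T → ℝ) (b c : Fin K → ℝ) (k : Fin K) :
    ∑ i ∈ A, unitScore (X i) (fun t => E i t + X i t ⬝ᵥ ((if i ∈ B then c else 0) - b)) k =
      ∑ i ∈ A, unitScore (X i) (E i) k +
      (c ⬝ᵥ (fun l => ∑ i ∈ B, ∑ t, crossCoef (X i) k l t * E i t) -
        b ⬝ᵥ (fun l => ∑ i ∈ A, ∑ t, crossCoef (X i) k l t * E i t)) +
      (c ⬝ᵥ ((∑ i ∈ B, unitU (X i) k) *ᵥ c) -
        c ⬝ᵥ ((∑ i ∈ B, unitU (X i) k + (∑ i ∈ B, unitU (X i) k)ᵀ) *ᵥ b) +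
        b ⬝ᵥ ((∑ i ∈ A, unitU (X i) k) *ᵥ b)) := by
  have hsum : ∀ f : ℕ → ℝ, ∑ i ∈ B, f i = ∑ i ∈ A, if i ∈ B then f i else 0 := fun f => by
    rw [← Finset.sum_filter, Finset.filter_mem_eq_inter, Finset.inter_eq_right.2 hBA]
  have hW : ∀ (C : Finset ℕ) (v : Fin K → ℝ),
      v ⬝ᵥ (fun l => ∑ i ∈ C, ∑ t, crossCoef (X i) k l t * E i t) =
        ∑ i ∈ C, v ⬝ᵥ (fun l => ∑ t, crossCoef (X i) k l t * E i t) := fun C v => by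
    simp only [dotProduct, Finset.mul_sum]
    rw [Finset.sum_comm]
  have hU : ∀ (C : Finset ℕ) (v w : Fin K → ℝ), v ⬝ᵥ ((∑ i ∈ C, unitU (X i) k) *ᵥ w) =
      ∑ i ∈ C, v ⬝ᵥ (unitU (X i) k *ᵥ w) := fun C v w => by
    rw [Matrix.sum_mulVec, dotProduct_sum]
  have hUt : c ⬝ᵥ ((∑ i ∈ B, unitU (X i) k)ᵀ *ᵥ b) = ∑ i ∈ B, b ⬝ᵥ (unitU (X i) k *ᵥ c) := by
    rw [mulVec_transpose, dotProduct_comm, ← dotProduct_mulVec, hU]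
  rw [add_mulVec, dotProduct_add, hUt, hW, hW, hU, hU, hU, hsum, hsum, hsum, hsum]
  simp only [← Finset.sum_add_distrib, ← Finset.sum_sub_distrib]
  refine Finset.sum_congr rfl fun i _ => ?_
  rw [unitScore_add]
  split_ifs
  · simp only [mulVec_sub, dotProduct_sub, sub_dotProduct]
    ring
  · simp only [zero_sub, mulVec_neg, dotProduct_neg, neg_dotProduct]
    ring

lemma gram_mulVec (xi : Fin T → Fin K → ℝ) (v : Fin K → ℝ) :
    gram xi *ᵥ v = ∑ t, (xi t ⬝ᵥ v) • xi t := by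
  simp only [gram, Matrix.sum_mulVec, vecMulVec_mulVec, op_smul_eq_smul]

/-- Least squares is linear in `y` and reproduces the common slope `β`; what remains of the
estimator is `c` weighted by the Gram matrix of the group, and the errors. -/
lemma residual_eq {N : ℕ} {B : Finset ℕ} (hB : B ⊆ range N) (X : ℕ → Fin T → Fin K → ℝ)
    (E : ℕ → Fin T → ℝ) (β c : Fin K → ℝ) (hdet : (∑ i ∈ range N, gram (X i)).det ≠ 0) (i : ℕ)
    (t : Fin T) :
    residual N (fun i t => X i t ⬝ᵥ (if i ∈ B then β + c else β) + E i t) X i t =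
      E i t + X i t ⬝ᵥ ((if i ∈ B then c else 0) - (∑ i ∈ range N, gram (X i))⁻¹ *ᵥ
        ((∑ i ∈ B, gram (X i)) *ᵥ c + ∑ i ∈ range N, ∑ t, E i t • X i t)) := by
  have hy : ∀ i t, X i t ⬝ᵥ (if i ∈ B then β + c else β) =
      X i t ⬝ᵥ β + X i t ⬝ᵥ (if i ∈ B then c else 0) := fun i t => by
    split_ifs <;> simp
  have hLS : pooledLS N (fun i t => X i t ⬝ᵥ (if i ∈ B then β + c else β) + E i t) X =
      β + (∑ i ∈ range N, gram (X i))⁻¹ *ᵥ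
        ((∑ i ∈ B, gram (X i)) *ᵥ c + ∑ i ∈ range N, ∑ t, E i t • X i t) := by
    have h1 : ∑ i ∈ range N, ∑ t,
        (X i t ⬝ᵥ (if i ∈ B then β + c else β) + E i t) • X i t =
        (∑ i ∈ range N, gram (X i)) *ᵥ β +
          ((∑ i ∈ B, gram (X i)) *ᵥ c + ∑ i ∈ range N, ∑ t, E i t • X i t) := by
      have h2 : (∑ i ∈ B, gram (X i)) *ᵥ c =
          ∑ i ∈ range N, gram (X i) *ᵥ (if i ∈ B then c else 0) := by
        rw [Matrix.sum_mulVec, ← Finset.inter_eq_right.2 hB, ← Finset.filter_mem_eq_inter,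
          Finset.sum_filter]
        refine Finset.sum_congr rfl fun i hi => ?_
        rw [Finset.filter_mem_eq_inter, Finset.inter_eq_right.2 hB]
        split_ifs <;> simp
      rw [h2, Matrix.sum_mulVec, ← Finset.sum_add_distrib, ← Finset.sum_add_distrib]
      refine Finset.sum_congr rfl fun i _ => ?_
      rw [gram_mulVec, gram_mulVec, ← Finset.sum_add_distrib, ← Finset.sum_add_distrib]
      refine Finset.sum_congr rfl fun t _ => ?_
      rw [hy, add_smul, add_smul, add_assoc]
    rw [pooledLS, h1, mulVec_add, mulVec_mulVec, nonsing_inv_mul _ (isUnit_iff_ne_zero.2 hdet),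
      one_mulVec]
  rw [residual, hLS, hy, dotProduct_sub, dotProduct_add]
  ring

lemma score_apply (N : ℕ) (y : ℕ → Fin T → ℝ) (X : ℕ → Fin T → Fin K → ℝ) (k : Fin K) :
    score N y X k = ∑ i ∈ range N, unitScore (X i) (residual N y X i) k := by
  refine Finset.sum_congr rfl fun i _ => Finset.sum_congr rfl fun t _ =>
    Finset.sum_congr rfl fun s _ => ?_
  ring

lemma scoreVar_apply (N : ℕ) (y : ℕ → Fin T → ℝ) (X : ℕ → Fin T → Fin K → ℝ) (k l : Fin K) :
    scoreVar N y X k l = ∑ i ∈ range N, ∑ t,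
      unitDiff (X i) (residual N y X i) t k * unitDiff (X i) (residual N y X i) t l := by
  rw [scoreVar, Matrix.of_apply]
  refine Finset.sum_congr rfl fun i _ => ?_
  rw [sum_unitDiff_mul]
  refine Finset.sum_congr rfl fun t _ => Finset.sum_congr rfl fun s _ =>
    Finset.sum_congr rfl fun p _ => ?_
  ring

lemma abs_dotProduct_le (v w : Fin K → ℝ) : |v ⬝ᵥ w| ≤ K * (‖v‖ * ‖w‖) := by
  refine (abs_sum_le_sum_abs _ _).trans (sum_univ_le fun k => ?_)
  rw [abs_mul]
  exact mul_le_mul (norm_le_pi_norm v k) (norm_le_pi_norm w k) (abs_nonneg _) (norm_nonneg _)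

lemma abs_unitDiff_le (xi : Fin T → Fin K → ℝ) (u : Fin T → ℝ) (t : Fin T) (k : Fin K) :
    |unitDiff xi u t k| ≤ T * (‖xi‖ ^ 2 * ‖u‖ ^ 2) := by
  rw [unitDiff, Finset.mul_sum]
  refine (abs_sum_le_sum_abs _ _).trans (sum_filter_lt_le (by positivity) (fun s => ?_) t)
  rw [show u t * xi t k * (u s * xi s k) = xi t k * xi s k * (u t * u s) by ring, abs_mul,
    abs_mul (u t), sq ‖u‖]
  exact mul_le_mul (abs_entry_mul_le _ _ _ _ _) (mul_le_mul (abs_apply_le_norm u t)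
    (abs_apply_le_norm u s) (abs_nonneg _) (norm_nonneg _)) (by positivity) (by positivity)

lemma abs_unitDiff_add_sub_le (xi : Fin T → Fin K → ℝ) (u : Fin T → ℝ) (η : Fin K → ℝ)
    (t : Fin T) (k : Fin K) :
    |unitDiff xi (fun t => u t + xi t ⬝ᵥ η) t k - unitDiff xi u t k| ≤
      T * (‖xi‖ ^ 2 * (2 * ‖u‖ * (K * (‖xi‖ * ‖η‖)) + (K * (‖xi‖ * ‖η‖)) ^ 2)) := by
  have hz : ∀ t, |xi t ⬝ᵥ η| ≤ K * (‖xi‖ * ‖η‖) := fun t =>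
    (abs_dotProduct_le _ _).trans (by gcongr; exact norm_le_pi_norm xi t)
  rw [unitDiff, unitDiff, Finset.mul_sum, Finset.mul_sum, ← Finset.sum_sub_distrib]
  refine (abs_sum_le_sum_abs _ _).trans (sum_filter_lt_le (by positivity) (fun s => ?_) t)
  rw [show (u t + xi t ⬝ᵥ η) * xi t k * ((u s + xi s ⬝ᵥ η) * xi s k) -
      u t * xi t k * (u s * xi s k) = xi t k * xi s k *
      (u t * (xi s ⬝ᵥ η) + u s * (xi t ⬝ᵥ η) + (xi t ⬝ᵥ η) * (xi s ⬝ᵥ η)) by ring, abs_mul]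
  refine mul_le_mul (abs_entry_mul_le _ _ _ _ _) ?_ (abs_nonneg _) (by positivity)
  refine (abs_add_three _ _ _).trans ?_
  simp only [abs_mul]
  have h1 := mul_le_mul (abs_apply_le_norm u t) (hz s) (abs_nonneg _) (norm_nonneg _)
  have h2 := mul_le_mul (abs_apply_le_norm u s) (hz t) (abs_nonneg _) (norm_nonneg _)
  have h3 := mul_le_mul (hz t) (hz s) (abs_nonneg _) (by positivity)
  linarith

/-- The squared difference between the contributions of residuals and errors. -/
lemma sq_unitDiff_add_sub_le (xi : Fin T → Fin K → ℝ) (u : Fin T → ℝ) (η : Fin K → ℝ)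
    (t : Fin T) (k : Fin K) :
    (unitDiff xi (fun t => u t + xi t ⬝ᵥ η) t k - unitDiff xi u t k) ^ 2 ≤
      8 * T ^ 2 * (1 + K) ^ 4 * (‖xi‖ ^ 6 * ‖u‖ ^ 2 * ‖η‖ ^ 2 + ‖xi‖ ^ 8 * ‖η‖ ^ 4) := by
  have h0 := pow_le_pow_left₀ (abs_nonneg _) (abs_unitDiff_add_sub_le xi u η t k) 2
  rw [sq_abs] at h0
  refine h0.trans ?_
  clear h0
  set a := ‖xi‖
  set b := ‖u‖
  set h := ‖η‖
  have hK : (0 : ℝ) ≤ K := Nat.cast_nonneg K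
  have h1 : (K : ℝ) ^ 2 ≤ (1 + K) ^ 4 := by nlinarith [pow_nonneg hK 3, pow_nonneg hK 4]
  have h2 : (K : ℝ) ^ 4 ≤ (1 + K) ^ 4 := pow_le_pow_left₀ hK (by linarith) 4
  calc (T * (a ^ 2 * (2 * b * (K * (a * h)) + (K * (a * h)) ^ 2))) ^ 2
      ≤ T ^ 2 * a ^ 4 * (2 * ((2 * b * (K * (a * h))) ^ 2 + ((K * (a * h)) ^ 2) ^ 2)) := by
        rw [mul_pow, mul_pow, ← mul_assoc, ← pow_mul]
        exact mul_le_mul_of_nonneg_left (add_sq_le) (by positivity)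
    _ = 8 * T ^ 2 * (K ^ 2 * (a ^ 6 * b ^ 2 * h ^ 2)) + 2 * T ^ 2 * (K ^ 4 * (a ^ 8 * h ^ 4)) := by
        ring
    _ ≤ 8 * T ^ 2 * ((1 + K) ^ 4 * (a ^ 6 * b ^ 2 * h ^ 2)) +
        8 * T ^ 2 * ((1 + K) ^ 4 * (a ^ 8 * h ^ 4)) := by
        gcongr
        norm_num
    _ = _ := by ring

/-- For `z ≤ 1` the second argument is of order `z^q (1 + b⁴)`; for `z ≥ 1` the first is at most
`z^q b⁴`. With `z = ‖x‖ ‖η‖` the minimum costs only `q` additional regressor moments, where `z⁴`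
would cost four. -/
lemma min_le_rpow {b z q : ℝ} (hz : 0 ≤ z) (hq : 0 ≤ q) (hq' : q ≤ 1) :
    min (b ^ 4) (b ^ 2 * z ^ 2 + z ^ 4) ≤ 2 * (z ^ q * (1 + b ^ 4)) := by
  have hb : 0 ≤ b ^ 4 := by positivity
  rcases le_total z 1 with h | h
  · have h1 : z ^ 2 ≤ z ^ q := by
      rw [← Real.rpow_natCast z 2]
      exact Real.rpow_le_rpow_of_exponent_ge_of_imp hz h (by norm_num; linarith) (by norm_num)
    have h2 : z ^ 4 ≤ z ^ q := (pow_le_pow_of_le_one hz h (by norm_num)).trans h1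
    have h0 := Real.rpow_nonneg hz q
    have h3 : b ^ 2 ≤ 1 + b ^ 4 := by nlinarith [sq_nonneg (b ^ 2 - 1)]
    have h4 := mul_le_mul h3 h1 (sq_nonneg _) (by positivity)
    refine (min_le_right _ _).trans ?_
    nlinarith [mul_nonneg h0 hb]
  · have h1 := Real.one_le_rpow h hq
    refine (min_le_left _ _).trans ?_
    nlinarith

end Expansion

/-! ### Limits along a filter for fixed data -/

section Pathwise

variable {T K : ℕ}

lemma tendsto_matrix_inv {ι : Type*} {l : Filter ι} {A : ι → Matrix (Fin K) (Fin K) ℝ}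
    {B : Matrix (Fin K) (Fin K) ℝ} (h : Tendsto A l (𝓝 B)) (hB : B.det ≠ 0) :
    Tendsto (fun n => (A n)⁻¹) l (𝓝 B⁻¹) := by
  simp only [Matrix.inv_def, Ring.inverse_eq_inv']
  exact (((continuous_id.matrix_det.tendsto B).comp h).inv₀ hB).smul
    ((continuous_id.matrix_adjugate.tendsto B).comp h)

lemma tendsto_mulVec {ι : Type*} {l : Filter ι} {A : ι → Matrix (Fin K) (Fin K) ℝ}
    {B : Matrix (Fin K) (Fin K) ℝ} {v : ι → Fin K → ℝ} {w : Fin K → ℝ}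
    (hA : Tendsto A l (𝓝 B)) (hv : Tendsto v l (𝓝 w)) :
    Tendsto (fun n => A n *ᵥ v n) l (𝓝 (B *ᵥ w)) := by
  have h : Continuous fun p : Matrix (Fin K) (Fin K) ℝ × (Fin K → ℝ) => p.1 *ᵥ p.2 :=
    continuous_fst.matrix_mulVec continuous_snd
  exact (h.tendsto (B, w)).comp (hA.prodMk_nhds hv)

lemma tendsto_dotProduct {ι : Type*} {l : Filter ι} {u v : ι → Fin K → ℝ} {w z : Fin K → ℝ}
    (hu : Tendsto u l (𝓝 w)) (hv : Tendsto v l (𝓝 z)) :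
    Tendsto (fun n => u n ⬝ᵥ v n) l (𝓝 (w ⬝ᵥ z)) := by
  have h : Continuous fun p : (Fin K → ℝ) × (Fin K → ℝ) => p.1 ⬝ᵥ p.2 :=
    continuous_fst.dotProduct continuous_snd
  exact (h.tendsto (w, z)).comp (hu.prodMk_nhds hv)

/-- The detection rate `√M / (γ N ^ (1 / 4))`. -/
def detectionRate (G : ℕ → Finset ℕ) (γ : ℕ → ℝ) (N : ℕ) : ℝ :=
  √(#(G N) : ℝ) / (γ N * (N : ℝ) ^ (1 / 4 : ℝ))

/-- The limits along `l` of the averages that determine the statistic, for fixed regressors `X` and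
errors `E`. -/
structure PathLimits (l : Filter ℕ) (X : ℕ → Fin T → Fin K → ℝ) (E : ℕ → Fin T → ℝ)
    (G : ℕ → Finset ℕ) (S SG V : Matrix (Fin K) (Fin K) ℝ)
    (U UG : Fin K → Matrix (Fin K) (Fin K) ℝ) : Prop where
  gram : Tendsto (fun N => groupAvg (range N) fun i => gram (X i)) l (𝓝 S)
  gram_group : Tendsto (fun N => groupAvg (G N) fun i => PanelLM.gram (X i)) l (𝓝 SG)
  quad : ∀ k, Tendsto (fun N => groupAvg (range N) fun i => unitU (X i) k) l (𝓝 (U k))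
  quad_group : ∀ k, Tendsto (fun N => groupAvg (G N) fun i => unitU (X i) k) l (𝓝 (UG k))
  diff : ∀ k j, Tendsto (fun N => (∑ i ∈ range N, ∑ t,
    unitDiff (X i) (E i) t k * unitDiff (X i) (E i) t j) / N) l (𝓝 (V k j))
  cross : ∀ k j, Tendsto (fun N => (∑ i ∈ range N, ∑ t, crossCoef (X i) k j t * E i t) /
    quartRoot N ^ 3) l (𝓝 0)
  cross_group : ∀ k j, Tendsto (fun N => (∑ i ∈ G N, ∑ t, crossCoef (X i) k j t * E i t) /
    quartRoot #(G N) ^ 3) l (𝓝 0)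
  noise : ∀ k, Tendsto (fun N => (∑ i ∈ range N, ∑ t, X i t k * E i t) / quartRoot N ^ 3) l (𝓝 0)
  sixth : Tendsto (fun N => (∑ i ∈ range N, ‖X i‖ ^ 6 * ‖E i‖ ^ 2) / quartRoot N ^ 6) l (𝓝 0)
  sixth_group : Tendsto (fun N => (∑ i ∈ G N, ‖X i‖ ^ 6 * ‖E i‖ ^ 2) / quartRoot #(G N) ^ 6) l (𝓝 0)
  eighth : Tendsto (fun N => (∑ i ∈ range N, ‖X i‖ ^ 8) / quartRoot N ^ 8) l (𝓝 0)
  eighth_group : Tendsto (fun N => (∑ i ∈ G N, ‖X i‖ ^ 8) / quartRoot #(G N) ^ 8) l (𝓝 0)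

variable {l : Filter ℕ} {X : ℕ → Fin T → Fin K → ℝ} {E : ℕ → Fin T → ℝ} {G : ℕ → Finset ℕ}
  {γ : ℕ → ℝ} {β lam : Fin K → ℝ} {m₀ c e : ℝ} {S SG V : Matrix (Fin K) (Fin K) ℝ}
  {U UG : Fin K → Matrix (Fin K) (Fin K) ℝ} {w : ℕ → ℝ}

lemma LocalAlternative.tendsto_quartRoot_div (h : LocalAlternative G γ lam m₀) :
    Tendsto (fun N => quartRoot #(G N) / quartRoot N) atTop (𝓝 (m₀ ^ (1 / 4 : ℝ))) := by
  refine (h.share.rpow_const (p := 1 / 4) (Or.inr (by norm_num))).congr fun N => ?_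
  rw [Real.div_rpow (Nat.cast_nonneg _) (Nat.cast_nonneg _), quartRoot, quartRoot]

lemma LocalAlternative.eventually_pos (h : LocalAlternative G γ lam m₀) :
    ∀ᶠ N in atTop, 0 < quartRoot N ∧ 0 < quartRoot #(G N) ∧ 0 < γ N := by
  filter_upwards [eventually_gt_atTop 0, h.size.eventually_gt_atTop 0,
    h.scale.eventually_gt_atTop 0] with N h1 h2 h3
  exact ⟨quartRoot_pos h1, quartRoot_pos h2, h3⟩

/-- The component of the scaled estimation error due to the second group. -/
def groupShift (X : ℕ → Fin T → Fin K → ℝ) (G : ℕ → Finset ℕ) (lam : Fin K → ℝ) (N : ℕ) :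
    Fin K → ℝ :=
  (groupAvg (range N) fun i => gram (X i))⁻¹ *ᵥ ((groupAvg (G N) fun i => gram (X i)) *ᵥ lam)

/-- The component of the scaled estimation error due to the errors. -/
def noiseShift (X : ℕ → Fin T → Fin K → ℝ) (E : ℕ → Fin T → ℝ) (N : ℕ) : Fin K → ℝ :=
  (groupAvg (range N) fun i => gram (X i))⁻¹ *ᵥ
    fun k => (∑ i ∈ range N, ∑ t, X i t k * E i t) / quartRoot N ^ 3

/-- The estimation error of pooled least squares, scaled by `N ^ (1 / 4)`. -/
def scaledShift (X : ℕ → Fin T → Fin K → ℝ) (E : ℕ → Fin T → ℝ) (G : ℕ → Finset ℕ) (γ : ℕ → ℝ)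
    (lam : Fin K → ℝ) (N : ℕ) : Fin K → ℝ :=
  (detectionRate G γ N * (quartRoot #(G N) / quartRoot N) ^ 2) • groupShift X G lam N +
    noiseShift X E N

/-- The deviation of the slope of unit `i` from the pooled least squares estimator. -/
def slopeError (X : ℕ → Fin T → Fin K → ℝ) (E : ℕ → Fin T → ℝ) (G : ℕ → Finset ℕ) (γ : ℕ → ℝ)
    (lam : Fin K → ℝ) (N i : ℕ) : Fin K → ℝ :=
  (if i ∈ G N then (γ N)⁻¹ • lam else 0) - (quartRoot N)⁻¹ • scaledShift X E G γ lam N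

/-- The data of the panel with `N` units. -/
def altData (X : ℕ → Fin T → Fin K → ℝ) (E : ℕ → Fin T → ℝ) (G : ℕ → Finset ℕ) (γ : ℕ → ℝ)
    (β lam : Fin K → ℝ) (N i : ℕ) (t : Fin T) : ℝ :=
  X i t ⬝ᵥ slope β lam G γ N i + E i t

lemma sum_eq_smul_groupAvg {A : Finset ℕ} (f : ℕ → Matrix (Fin K) (Fin K) ℝ)
    (hA : 0 < quartRoot #A) : ∑ i ∈ A, f i = quartRoot #A ^ 4 • groupAvg A f := by
  have h : (#A : ℝ) ≠ 0 := by rw [← quartRoot_pow_four]; positivity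
  rw [groupAvg, quartRoot_pow_four, smul_smul, mul_inv_cancel₀ h, one_smul]

lemma detectionRate_mul {N : ℕ} (h1 : 0 < quartRoot N) (h3 : 0 < γ N) :
    detectionRate G γ N * (γ N * quartRoot N) = quartRoot #(G N) ^ 2 := by
  have h : detectionRate G γ N = quartRoot #(G N) ^ 2 / (γ N * quartRoot N) := by
    rw [quartRoot_sq]; rfl
  rw [h]
  field_simp

/-- Eliminates `γ`, so that the expansions involve only the rate and the ratio of the group size to
`N`. -/
lemma inv_scale_eq {N : ℕ} (h1 : 0 < quartRoot N) (h2 : 0 < quartRoot #(G N)) (h3 : 0 < γ N) :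
    (γ N)⁻¹ = detectionRate G γ N * quartRoot N / quartRoot #(G N) ^ 2 := by
  rw [← detectionRate_mul (G := G) h1 h3]
  have h4 : detectionRate G γ N ≠ 0 := fun h => by
    have := detectionRate_mul (G := G) h1 h3
    rw [h, zero_mul] at this
    exact (pow_pos h2 2).ne this
  field_simp

lemma residual_altData {N : ℕ} (hG : G N ⊆ range N) (h1 : 0 < quartRoot N)
    (h2 : 0 < quartRoot #(G N)) (h3 : 0 < γ N)
    (hdet : (groupAvg (range N) fun i => gram (X i)).det ≠ 0) (i : ℕ) :
    residual N (altData X E G γ β lam N) X i =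
      fun t => E i t + X i t ⬝ᵥ slopeError X E G γ lam N i := by
  funext t
  have hN : ∑ i ∈ range N, gram (X i) =
      quartRoot N ^ 4 • groupAvg (range N) fun i => gram (X i) := by
    simpa using sum_eq_smul_groupAvg (A := range N) (fun i => gram (X i)) (by simpa using h1)
  have hM := sum_eq_smul_groupAvg (fun i => gram (X i)) h2
  have hdet' : (∑ i ∈ range N, gram (X i)).det ≠ 0 := by
    rw [hN, det_smul]
    exact mul_ne_zero (by positivity) hdet
  have h := residual_eq hG X E β ((γ N)⁻¹ • lam) hdet' i t
  -- This is the estimation error of the pooled estimator. Scaled by `N^(1/4)`, the contribution of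
  -- the group is `N^(1/4) (M/N) / γ`, which is the rate times `√(M/N)`; that of the errors is
  -- normalised by `N^(3/4)`.
  have hs : (quartRoot N)⁻¹ • scaledShift X E G γ lam N = (∑ i ∈ range N, gram (X i))⁻¹ *ᵥ
      ((∑ i ∈ G N, gram (X i)) *ᵥ ((γ N)⁻¹ • lam) + ∑ i ∈ range N, ∑ t, E i t • X i t) := by
    have hinv : (quartRoot N ^ 4 • groupAvg (range N) fun i => gram (X i))⁻¹ =
        (quartRoot N ^ 4)⁻¹ • (groupAvg (range N) fun i => gram (X i))⁻¹ := by
      have := Matrix.inv_smul' (groupAvg (range N) fun i => gram (X i))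
        (Units.mk0 (quartRoot N ^ 4) (by positivity)) (isUnit_iff_ne_zero.2 hdet)
      simpa [Units.smul_def] using this
    have hnoise : ∑ i ∈ range N, ∑ t, E i t • X i t = quartRoot N ^ 3 •
        fun k => (∑ i ∈ range N, ∑ t, X i t k * E i t) / quartRoot N ^ 3 := by
      funext k
      simp only [Finset.sum_apply, Pi.smul_apply, smul_eq_mul]
      rw [mul_div_cancel₀ _ (by positivity)]
      exact Finset.sum_congr rfl fun i _ => Finset.sum_congr rfl fun t _ => mul_comm _ _
    rw [hN, hM, hinv, hnoise, scaledShift, groupShift, noiseShift]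
    simp only [smul_mulVec, mulVec_smul, mulVec_add, smul_add, smul_smul]
    congr 2
    · rw [inv_scale_eq (G := G) h1 h2 h3]
      field_simp
    · field_simp
  rw [← hs] at h
  rw [← slopeError] at h
  rw [← h]
  rfl

/-- The score of the residuals, compared with the score of the errors. -/
lemma score_altData {N : ℕ} (hG : G N ⊆ range N) (h1 : 0 < quartRoot N)
    (h2 : 0 < quartRoot #(G N)) (h3 : 0 < γ N)
    (hdet : (groupAvg (range N) fun i => gram (X i)).det ≠ 0) (k : Fin K) (w : ℝ) :
    w ^ 2 * (score N (altData X E G γ β lam N) X k / quartRoot N ^ 2 -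
      (∑ i ∈ range N, unitScore (X i) (E i) k) / quartRoot N ^ 2) =
    (w * detectionRate G γ N) * w * (quartRoot #(G N) / quartRoot N) *
      (lam ⬝ᵥ fun j => (∑ i ∈ G N, ∑ t, crossCoef (X i) k j t * E i t) / quartRoot #(G N) ^ 3) -
    w * ((w • scaledShift X E G γ lam N) ⬝ᵥ
      fun j => (∑ i ∈ range N, ∑ t, crossCoef (X i) k j t * E i t) / quartRoot N ^ 3) +
    ((w * detectionRate G γ N) ^ 2 *
      (lam ⬝ᵥ ((groupAvg (G N) fun i => unitU (X i) k) *ᵥ lam)) -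
    (w * detectionRate G γ N) * (quartRoot #(G N) / quartRoot N) ^ 2 *
      (lam ⬝ᵥ (((groupAvg (G N) fun i => unitU (X i) k) +
        (groupAvg (G N) fun i => unitU (X i) k)ᵀ) *ᵥ (w • scaledShift X E G γ lam N))) +
    (w • scaledShift X E G γ lam N) ⬝ᵥ ((groupAvg (range N) fun i => unitU (X i) k) *ᵥ
      (w • scaledShift X E G γ lam N))) := by
  have hN : ∑ i ∈ range N, unitU (X i) k =
      quartRoot N ^ 4 • groupAvg (range N) fun i => unitU (X i) k := by
    simpa using sum_eq_smul_groupAvg (A := range N) (fun i => unitU (X i) k) (by simpa using h1)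
  have hM := sum_eq_smul_groupAvg (fun i => unitU (X i) k) h2
  have hW : ∀ (A : Finset ℕ) (r : ℝ), 0 < r →
      (fun j => ∑ i ∈ A, ∑ t, crossCoef (X i) k j t * E i t) =
        r ^ 3 • fun j => (∑ i ∈ A, ∑ t, crossCoef (X i) k j t * E i t) / r ^ 3 := fun A r hr => by
    funext j
    rw [Pi.smul_apply, smul_eq_mul, mul_div_cancel₀ _ (by positivity)]
  rw [score_apply]
  simp only [residual_altData hG h1 h2 h3 hdet, slopeError]
  rw [sum_unitScore_add hG, hN, hM, hW (range N) _ h1, hW (G N) _ h2, inv_scale_eq h1 h2 h3]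
  simp only [transpose_smul, ← smul_add, smul_mulVec, mulVec_smul, smul_dotProduct,
    dotProduct_smul, smul_eq_mul]
  generalize (lam ⬝ᵥ fun j => (∑ i ∈ G N, ∑ t, crossCoef (X i) k j t * E i t) /
    quartRoot #(G N) ^ 3) = W₁
  generalize (scaledShift X E G γ lam N ⬝ᵥ fun j =>
    (∑ i ∈ range N, ∑ t, crossCoef (X i) k j t * E i t) / quartRoot N ^ 3) = W₂
  field_simp
  ring

lemma PathLimits.tendsto_groupShift (h : PathLimits l X E G S SG V U UG) (hS : S.PosDef) :
    Tendsto (groupShift X G lam) l (𝓝 (S⁻¹ *ᵥ (SG *ᵥ lam))) :=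
  tendsto_mulVec (tendsto_matrix_inv h.gram hS.det_pos.ne')
    (tendsto_mulVec h.gram_group tendsto_const_nhds)

lemma PathLimits.tendsto_noiseShift (h : PathLimits l X E G S SG V U UG) (hS : S.PosDef) :
    Tendsto (noiseShift X E) l (𝓝 0) := by
  have := tendsto_mulVec (tendsto_matrix_inv h.gram hS.det_pos.ne') (tendsto_pi_nhds.2 h.noise)
  rwa [show (fun _ : Fin K => (0 : ℝ)) = 0 from rfl, mulVec_zero] at this

/-- The weight `w` lets the regimes share one computation: `w = 1` and `e = 1` if the rate converges
to `c`, and `w` the inverse rate with `c = 1`, `e = 0` if it diverges. -/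
lemma PathLimits.tendsto_scaledShift (h : PathLimits l X E G S SG V U UG) (hl : l ≤ atTop)
    (hAlt : LocalAlternative G γ lam m₀) (hS : S.PosDef)
    (hc : Tendsto (fun N => w N * detectionRate G γ N) l (𝓝 c)) (he : Tendsto w l (𝓝 e)) :
    Tendsto (fun N => w N • scaledShift X E G γ lam N) l
      (𝓝 ((c * (m₀ ^ (1 / 4 : ℝ)) ^ 2) • (S⁻¹ *ᵥ (SG *ᵥ lam)))) := by
  have := ((hc.mul ((hAlt.tendsto_quartRoot_div.mono_left hl).pow 2)).smul
    (h.tendsto_groupShift (lam := lam) hS)).add (he.smul (h.tendsto_noiseShift hS))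
  rw [smul_zero, add_zero] at this
  refine this.congr fun N => ?_
  rw [scaledShift, smul_add, smul_smul, mul_assoc]

lemma PathLimits.eventually_regular (h : PathLimits l X E G S SG V U UG) (hl : l ≤ atTop)
    (hAlt : LocalAlternative G γ lam m₀) (hS : S.PosDef) :
    ∀ᶠ N in l, G N ⊆ range N ∧ 0 < quartRoot N ∧ 0 < quartRoot #(G N) ∧ 0 < γ N ∧
      (groupAvg (range N) fun i => PanelLM.gram (X i)).det ≠ 0 := by
  have hd := (continuous_id.matrix_det.tendsto S).comp h.gram
  filter_upwards [hl hAlt.eventually_pos, hd.eventually_ne hS.det_pos.ne'] with N h1 h2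
  exact ⟨hAlt.subset N, h1.1, h1.2.1, h1.2.2, h2⟩

/-- The effect of the alternative on the score. -/
lemma PathLimits.tendsto_score_sub (h : PathLimits l X E G S SG V U UG) (hl : l ≤ atTop)
    (hAlt : LocalAlternative G γ lam m₀) (hS : S.PosDef) (hSG : SG.IsSymm)
    (hc : Tendsto (fun N => w N * detectionRate G γ N) l (𝓝 c)) (he : Tendsto w l (𝓝 e))
    (k : Fin K) :
    Tendsto (fun N => w N ^ 2 * (score N (altData X E G γ β lam N) X k / quartRoot N ^ 2 -
      (∑ i ∈ range N, unitScore (X i) (E i) k) / quartRoot N ^ 2)) l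
      (𝓝 ((c ^ 2 • drift m₀ lam S SG U UG) k)) := by
  have hh := h.tendsto_scaledShift hl hAlt hS hc he
  have hν := hAlt.tendsto_quartRoot_div.mono_left hl
  have hlam : Tendsto (fun _ : ℕ => lam) l (𝓝 lam) := tendsto_const_nhds
  have hUt : Tendsto (fun N => (groupAvg (G N) fun i => unitU (X i) k)ᵀ) l (𝓝 (UG k)ᵀ) :=
    (continuous_id.matrix_transpose.tendsto _).comp (h.quad_group k)
  have ht := ((((hc.mul he).mul hν).mul (tendsto_dotProduct hlam
    (tendsto_pi_nhds.2 (h.cross_group k)))).sub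
    (he.mul (tendsto_dotProduct hh (tendsto_pi_nhds.2 (h.cross k))))).add
    ((((hc.pow 2).mul (tendsto_dotProduct hlam (tendsto_mulVec (h.quad_group k) hlam))).sub
    ((hc.mul (hν.pow 2)).mul (tendsto_dotProduct hlam
      (tendsto_mulVec ((h.quad_group k).add hUt) hh)))).add
    (tendsto_dotProduct hh (tendsto_mulVec (h.quad k) hh)))
  -- Separates the identification of the limit value with the drift from the convergence itself.
  have hlim : ∀ f : ℝ, f = (c ^ 2 • drift m₀ lam S SG U UG) k → ∀ g : ℕ → ℝ,
      Tendsto g l (𝓝 f) → Tendsto g l (𝓝 ((c ^ 2 • drift m₀ lam S SG U UG) k)) := by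
    rintro f rfl g hg
    exact hg
  refine (hlim _ ?_ _ ht).congr' ?_
  -- Each term with `m₀` collects `√m₀` twice: the quadratic one from two shifts, the mixed one from
  -- a shift and from the weight `√(M/N)` of the group.
  · have hm : (m₀ ^ (1 / 4 : ℝ)) ^ 2 * (m₀ ^ (1 / 4 : ℝ)) ^ 2 = m₀ := by
      rw [← pow_add, ← Real.rpow_natCast, ← Real.rpow_mul hAlt.share_nonneg]
      norm_num
    have hS' : (S⁻¹)ᵀ = S⁻¹ := by
      rw [transpose_nonsing_inv]
      congr 1
      simpa using hS.isHermitian.eq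
    have e1 : lam ⬝ᵥ ((SG * S⁻¹ * U k * S⁻¹ * SG) *ᵥ lam) =
        (S⁻¹ *ᵥ (SG *ᵥ lam)) ⬝ᵥ (U k *ᵥ (S⁻¹ *ᵥ (SG *ᵥ lam))) := by
      simp only [← mulVec_mulVec]
      rw [dotProduct_mulVec, ← mulVec_transpose, hSG.eq, dotProduct_mulVec, ← mulVec_transpose, hS']
    have e2 : lam ⬝ᵥ ((SG * S⁻¹ * (UG k + (UG k)ᵀ)) *ᵥ lam) =
        lam ⬝ᵥ ((UG k + (UG k)ᵀ) *ᵥ (S⁻¹ *ᵥ (SG *ᵥ lam))) := by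
      simp only [← mulVec_mulVec]
      rw [dotProduct_mulVec, ← mulVec_transpose, hSG.eq, dotProduct_mulVec, ← mulVec_transpose, hS',
        dotProduct_mulVec, ← mulVec_transpose, transpose_add, transpose_transpose, add_comm (UG k)ᵀ,
        dotProduct_comm]
    rw [Pi.smul_apply, smul_eq_mul, drift, e1, e2]
    simp only [← Pi.zero_def, dotProduct_zero, mul_zero, sub_zero, zero_add, mulVec_smul,
      dotProduct_smul, smul_dotProduct, smul_eq_mul]
    linear_combination (c ^ 2 * ((S⁻¹ *ᵥ (SG *ᵥ lam)) ⬝ᵥ (U k *ᵥ (S⁻¹ *ᵥ (SG *ᵥ lam))) -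
      lam ⬝ᵥ ((UG k + (UG k)ᵀ) *ᵥ (S⁻¹ *ᵥ (SG *ᵥ lam))))) * hm
  · filter_upwards [h.eventually_regular hl hAlt hS] with N ⟨h0, h1, h2, h3, h4⟩
    exact (score_altData h0 h1 h2 h3 h4 k (w N)).symm

end Pathwise

/-! ### The variance estimator for fixed data -/

section Variance

variable {T K : ℕ}

lemma tendsto_zero_of_sq_le {l : Filter ℕ} {f g : ℕ → ℝ} (hg : Tendsto g l (𝓝 0))
    (h : ∀ N, f N ^ 2 ≤ g N) : Tendsto f l (𝓝 0) := by
  refine squeeze_zero_norm (fun N => ?_) (by simpa using hg.sqrt)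
  rw [Real.norm_eq_abs]
  exact Real.abs_le_sqrt (h N)

lemma sq_sum_sum_mul_le (A : Finset ℕ) (f g : ℕ → Fin T → ℝ) :
    (∑ i ∈ A, ∑ t, f i t * g i t) ^ 2 ≤ (∑ i ∈ A, ∑ t, f i t ^ 2) * ∑ i ∈ A, ∑ t, g i t ^ 2 := by
  have h := Finset.sum_mul_sq_le_sq_mul_sq (A ×ˢ (univ : Finset (Fin T))) (fun p => f p.1 p.2)
    (fun p => g p.1 p.2)
  simpa only [Finset.sum_product] using h

variable {l : Filter ℕ} {X : ℕ → Fin T → Fin K → ℝ} {E : ℕ → Fin T → ℝ} {G : ℕ → Finset ℕ}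
  {γ : ℕ → ℝ} {β lam : Fin K → ℝ} {m₀ c e q : ℝ} {S SG V : Matrix (Fin K) (Fin K) ℝ}
  {U UG : Fin K → Matrix (Fin K) (Fin K) ℝ} {w : ℕ → ℝ}

/-- The differences between the terms of the variance estimator for residuals and for errors. -/
def diffError (X : ℕ → Fin T → Fin K → ℝ) (E : ℕ → Fin T → ℝ) (G : ℕ → Finset ℕ) (γ : ℕ → ℝ)
    (lam : Fin K → ℝ) (N : ℕ) (k : Fin K) (i : ℕ) (t : Fin T) : ℝ :=
  unitDiff (X i) (fun t => E i t + X i t ⬝ᵥ slopeError X E G γ lam N i) t k -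
    unitDiff (X i) (E i) t k

lemma norm_slopeError_sq_le (N i : ℕ) :
    ‖slopeError X E G γ lam N i‖ ^ 2 ≤ 2 * ((if i ∈ G N then ‖(γ N)⁻¹ • lam‖ ^ 2 else 0) +
      ‖(quartRoot N)⁻¹ • scaledShift X E G γ lam N‖ ^ 2) := by
  refine (pow_le_pow_left₀ (norm_nonneg _) (norm_sub_le _ _) 2).trans ?_
  split_ifs
  · exact add_sq_le
  · refine add_sq_le.trans (by simp)

lemma norm_slopeError_pow_four_le (N i : ℕ) :
    ‖slopeError X E G γ lam N i‖ ^ 4 ≤ 8 * ((if i ∈ G N then ‖(γ N)⁻¹ • lam‖ ^ 4 else 0) +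
      ‖(quartRoot N)⁻¹ • scaledShift X E G γ lam N‖ ^ 4) := by
  have h := pow_le_pow_left₀ (by positivity)
    (norm_slopeError_sq_le (X := X) (E := E) (G := G) (γ := γ) (lam := lam) N i) 2
  rw [← pow_mul, mul_pow] at h
  refine h.trans ((mul_le_mul_of_nonneg_left add_sq_le (by norm_num)).trans (le_of_eq ?_))
  split_ifs <;> ring

/-- A slope gap is the `1/γ` deviation on the group plus the common shift. Rewriting `1/γ` through
the rate turns the normalisation by `N` of the group sums into powers of the group size. The
constant `64` is the `8` of `sq_unitDiff_add_sub_le` times the `8` from a fourth power of two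
summands; the third factor `T` comes from the sum over periods. -/
lemma sum_sq_diffError_le {N : ℕ} (hG : G N ⊆ range N) (h1 : 0 < quartRoot N)
    (h2 : 0 < quartRoot #(G N)) (h3 : 0 < γ N) (k : Fin K) (w : ℝ) :
    w ^ 4 * ((∑ i ∈ range N, ∑ t, diffError X E G γ lam N k i t ^ 2) / N) ≤
      64 * T ^ 3 * (1 + K) ^ 4 *
      (w ^ 2 * (w * detectionRate G γ N) ^ 2 * ‖lam‖ ^ 2 * (quartRoot #(G N) / quartRoot N) ^ 2 *
        ((∑ i ∈ G N, ‖X i‖ ^ 6 * ‖E i‖ ^ 2) / quartRoot #(G N) ^ 6) +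
      w ^ 2 * ‖w • scaledShift X E G γ lam N‖ ^ 2 *
        ((∑ i ∈ range N, ‖X i‖ ^ 6 * ‖E i‖ ^ 2) / quartRoot N ^ 6) +
      (w * detectionRate G γ N) ^ 4 * ‖lam‖ ^ 4 *
        ((∑ i ∈ G N, ‖X i‖ ^ 8) / quartRoot #(G N) ^ 8) +
      ‖w • scaledShift X E G γ lam N‖ ^ 4 * ((∑ i ∈ range N, ‖X i‖ ^ 8) / quartRoot N ^ 8)) := by
  set c := ‖(γ N)⁻¹ • lam‖ with hc
  set g := ‖(quartRoot N)⁻¹ • scaledShift X E G γ lam N‖ with hg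
  have hsum : ∀ f : ℕ → ℝ, ∑ i ∈ G N, f i = ∑ i ∈ range N, if i ∈ G N then f i else 0 := fun f => by
    rw [← Finset.sum_filter, Finset.filter_mem_eq_inter, Finset.inter_eq_right.2 hG]
  have hterm : ∀ i, ∑ t, diffError X E G γ lam N k i t ^ 2 ≤ 64 * T ^ 3 * (1 + K) ^ 4 *
      ((if i ∈ G N then c ^ 2 * (‖X i‖ ^ 6 * ‖E i‖ ^ 2) else 0) + g ^ 2 * (‖X i‖ ^ 6 * ‖E i‖ ^ 2) +
      (if i ∈ G N then c ^ 4 * ‖X i‖ ^ 8 else 0) + g ^ 4 * ‖X i‖ ^ 8) := fun i => by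
    refine (sum_univ_le fun t => sq_unitDiff_add_sub_le (X i) (E i) _ t k).trans ?_
    have e2 := mul_le_mul_of_nonneg_left (norm_slopeError_sq_le (X := X) (E := E) (G := G) (γ := γ)
      (lam := lam) N i) (by positivity : 0 ≤ ‖X i‖ ^ 6 * ‖E i‖ ^ 2)
    have e4 := mul_le_mul_of_nonneg_left (norm_slopeError_pow_four_le (X := X) (E := E) (G := G)
      (γ := γ) (lam := lam) N i) (by positivity : 0 ≤ ‖X i‖ ^ 8)
    have hX : 0 ≤ ‖X i‖ ^ 6 * ‖E i‖ ^ 2 := by positivity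
    have hA : 0 ≤ (if i ∈ G N then c ^ 2 else 0) := by split_ifs <;> positivity
    calc (T : ℝ) * (8 * T ^ 2 * (1 + K) ^ 4 * (‖X i‖ ^ 6 * ‖E i‖ ^ 2 *
          ‖slopeError X E G γ lam N i‖ ^ 2 + ‖X i‖ ^ 8 * ‖slopeError X E G γ lam N i‖ ^ 4))
        ≤ T * (8 * T ^ 2 * (1 + K) ^ 4 * (8 * (‖X i‖ ^ 6 * ‖E i‖ ^ 2 *
          ((if i ∈ G N then c ^ 2 else 0) + g ^ 2)) + 8 * (‖X i‖ ^ 8 *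
          ((if i ∈ G N then c ^ 4 else 0) + g ^ 4)))) := by
          refine mul_le_mul_of_nonneg_left (mul_le_mul_of_nonneg_left (add_le_add ?_ ?_)
            (by positivity)) (by positivity)
          · have := mul_nonneg hX (add_nonneg hA (sq_nonneg g))
            linarith
          · linarith
      _ = _ := by
          split_ifs <;> ring
  have htot := Finset.sum_le_sum fun i (_ : i ∈ range N) => hterm i
  rw [← Finset.mul_sum] at htot
  simp only [Finset.sum_add_distrib, ← hsum, ← Finset.mul_sum] at htot
  have hcc : c = detectionRate G γ N * quartRoot N / quartRoot #(G N) ^ 2 * ‖lam‖ := by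
    rw [hc, norm_smul, norm_inv, Real.norm_of_nonneg h3.le, inv_scale_eq (G := G) h1 h2 h3]
  have hgg : ‖w • scaledShift X E G γ lam N‖ = |w| * quartRoot N * g := by
    rw [hg, norm_smul, norm_smul, norm_inv, Real.norm_of_nonneg h1.le, Real.norm_eq_abs]
    field_simp
  have hN : (N : ℝ) = quartRoot N ^ 4 := (quartRoot_pow_four N).symm
  have hw2 : |w| ^ 2 = w ^ 2 := sq_abs w
  have hw4 : |w| ^ 4 = w ^ 4 := by rw [show 4 = 2 * 2 from rfl, pow_mul, hw2, ← pow_mul]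
  have hw4' : 0 ≤ w ^ 4 := hw4 ▸ by positivity
  refine (mul_le_mul_of_nonneg_left (div_le_div_of_nonneg_right htot (Nat.cast_nonneg N))
    hw4').trans (le_of_eq ?_)
  have hgg2 : ‖w • scaledShift X E G γ lam N‖ ^ 2 = w ^ 2 * quartRoot N ^ 2 * g ^ 2 := by
    rw [hgg, mul_pow, mul_pow, hw2]
  have hgg4 : ‖w • scaledShift X E G γ lam N‖ ^ 4 = w ^ 4 * quartRoot N ^ 4 * g ^ 4 := by
    rw [hgg, mul_pow, mul_pow, hw4]
  rw [hgg2, hgg4, hN, hcc]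
  field_simp

lemma PathLimits.tendsto_sum_sq_diffError (h : PathLimits l X E G S SG V U UG) (hl : l ≤ atTop)
    (hAlt : LocalAlternative G γ lam m₀) (hS : S.PosDef)
    (hc : Tendsto (fun N => w N * detectionRate G γ N) l (𝓝 c)) (he : Tendsto w l (𝓝 e))
    (k : Fin K) :
    Tendsto (fun N => w N ^ 4 * ((∑ i ∈ range N, ∑ t, diffError X E G γ lam N k i t ^ 2) / N)) l
      (𝓝 0) := by
  have hh := (h.tendsto_scaledShift hl hAlt hS hc he).norm
  have hν := hAlt.tendsto_quartRoot_div.mono_left hl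
  have ht := (((((((he.pow 2).mul (hc.pow 2)).mul_const (‖lam‖ ^ 2)).mul (hν.pow 2)).mul
    h.sixth_group).add (((he.pow 2).mul (hh.pow 2)).mul h.sixth)).add
    (((hc.pow 4).mul_const (‖lam‖ ^ 4)).mul h.eighth_group)).add ((hh.pow 4).mul h.eighth)
  have ht' := ht.const_mul (64 * (T : ℝ) ^ 3 * (1 + K) ^ 4)
  simp only [mul_zero, add_zero] at ht'
  refine squeeze_zero' (.of_forall fun N => ?_) ?_ ht'
  · have : 0 ≤ w N ^ 4 := by positivity
    exact mul_nonneg this (div_nonneg (Finset.sum_nonneg fun i _ => Finset.sum_nonneg fun t _ =>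
      sq_nonneg _) (Nat.cast_nonneg N))
  · filter_upwards [h.eventually_regular hl hAlt hS] with N ⟨h0, h1, h2, h3, _⟩
    exact sum_sq_diffError_le h0 h1 h2 h3 k (w N)

/-- The variance estimator has the same limit as the average of the squares of the differences. -/
lemma PathLimits.tendsto_scoreVar (h : PathLimits l X E G S SG V U UG) (hl : l ≤ atTop)
    (hAlt : LocalAlternative G γ lam m₀) (hS : S.PosDef)
    (hc : Tendsto (fun N => w N * detectionRate G γ N) l (𝓝 c)) (he : Tendsto w l (𝓝 e))
    (k j : Fin K) :
    Tendsto (fun N => w N ^ 4 * (scoreVar N (altData X E G γ β lam N) X k j / N)) l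
      (𝓝 (e ^ 4 * V k j)) := by
  have hg : ∀ k, Tendsto (fun N => w N ^ 4 * ((∑ i ∈ range N, ∑ t,
      unitDiff (X i) (E i) t k ^ 2) / N)) l (𝓝 (e ^ 4 * V k k)) := fun k => by
    simpa only [sq] using (he.pow 4).mul (h.diff k k)
  have hr := h.tendsto_sum_sq_diffError hl hAlt hS hc he
  -- Cauchy–Schwarz: a product average vanishes if one factor has a vanishing and the other a
  -- convergent weighted mean square. It disposes of three of the four terms of `(a + r)(a' + r')`,
  -- where `a` comes from the errors and `r` is a `diffError`.
  have hcs : ∀ (f g : ℕ → ℕ → Fin T → ℝ) (a : ℝ),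
      Tendsto (fun N => w N ^ 4 * ((∑ i ∈ range N, ∑ t, f N i t ^ 2) / N)) l (𝓝 a) →
      Tendsto (fun N => w N ^ 4 * ((∑ i ∈ range N, ∑ t, g N i t ^ 2) / N)) l (𝓝 0) →
      Tendsto (fun N => w N ^ 4 * ((∑ i ∈ range N, ∑ t, f N i t * g N i t) / N)) l (𝓝 0) := by
    intro f g a hf hg
    have hfg := hf.mul hg
    rw [mul_zero] at hfg
    refine tendsto_zero_of_sq_le hfg fun N => ?_
    have h8 : 0 ≤ w N ^ 8 / (N : ℝ) ^ 2 := by positivity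
    calc (w N ^ 4 * ((∑ i ∈ range N, ∑ t, f N i t * g N i t) / N)) ^ 2
        = w N ^ 8 / (N : ℝ) ^ 2 * (∑ i ∈ range N, ∑ t, f N i t * g N i t) ^ 2 := by ring
      _ ≤ w N ^ 8 / (N : ℝ) ^ 2 * ((∑ i ∈ range N, ∑ t, f N i t ^ 2) *
            ∑ i ∈ range N, ∑ t, g N i t ^ 2) :=
          mul_le_mul_of_nonneg_left (sq_sum_sum_mul_le _ _ _) h8
      _ = _ := by ring
  have ht := ((((he.pow 4).mul (h.diff k j)).add
    (hcs (fun _ i t => unitDiff (X i) (E i) t k) _ _ (hg k) (hr j))).add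
    (hcs (fun _ i t => unitDiff (X i) (E i) t j) _ _ (hg j) (hr k))).add (hcs _ _ _ (hr k) (hr j))
  simp only [add_zero] at ht
  refine ht.congr' ?_
  filter_upwards [h.eventually_regular hl hAlt hS] with N ⟨h0, h1, h2, h3, h4⟩
  rw [scoreVar_apply, ← mul_add, ← mul_add, ← mul_add, ← add_div, ← add_div, ← add_div,
    ← Finset.sum_add_distrib, ← Finset.sum_add_distrib, ← Finset.sum_add_distrib]
  congr 2
  refine Finset.sum_congr rfl fun i _ => ?_
  rw [residual_altData h0 h1 h2 h3 h4, ← Finset.sum_add_distrib, ← Finset.sum_add_distrib,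
    ← Finset.sum_add_distrib]
  refine Finset.sum_congr rfl fun t _ => ?_
  simp only [diffError]
  ring

end Variance

/-! ### Divergence of the statistic for fixed data -/

section Divergence

variable {T K : ℕ}

/-- The constant is the minimum over the unit sphere, which is compact. The sphere is empty only for
`K = 0`, where any constant works. -/
lemma exists_mul_norm_sq_le {V : Matrix (Fin K) (Fin K) ℝ} (hV : V.PosDef) :
    ∃ c > 0, ∀ v : Fin K → ℝ, c * ‖v‖ ^ 2 ≤ v ⬝ᵥ (V *ᵥ v) := by
  have hpos : ∀ v : Fin K → ℝ, v ≠ 0 → 0 < v ⬝ᵥ (V *ᵥ v) := fun v hv => by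
    simpa using hV.dotProduct_mulVec_pos hv
  have hcont : Continuous fun v : Fin K → ℝ => v ⬝ᵥ (V *ᵥ v) :=
    continuous_id.dotProduct (continuous_const.matrix_mulVec continuous_id)
  rcases (Metric.sphere (0 : Fin K → ℝ) 1).eq_empty_or_nonempty with h | h
  · refine ⟨1, one_pos, fun v => ?_⟩
    by_cases hv : v = 0
    · simp [hv]
    · have : ‖v‖⁻¹ • v ∈ Metric.sphere (0 : Fin K → ℝ) 1 := by
        simp [norm_smul, inv_mul_cancel₀ (norm_ne_zero_iff.2 hv)]
      simp [h] at this
  · obtain ⟨u, hu, hmin⟩ := (isCompact_sphere (0 : Fin K → ℝ) 1).exists_isMinOn h hcont.continuousOn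
    have hu0 : u ≠ 0 := by
      rintro rfl
      simp at hu
    refine ⟨u ⬝ᵥ (V *ᵥ u), hpos u hu0, fun v => ?_⟩
    by_cases hv : v = 0
    · simp [hv]
    · have hn : ‖v‖ ≠ 0 := norm_ne_zero_iff.2 hv
      have hmem : ‖v‖⁻¹ • v ∈ Metric.sphere (0 : Fin K → ℝ) 1 := by
        simp [norm_smul, inv_mul_cancel₀ hn]
      have h1 := isMinOn_iff.1 hmin _ hmem
      have h2 : ‖v‖ ^ 2 * ((‖v‖⁻¹ • v) ⬝ᵥ (V *ᵥ (‖v‖⁻¹ • v))) = v ⬝ᵥ (V *ᵥ v) := by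
        rw [mulVec_smul, smul_dotProduct, dotProduct_smul, smul_eq_mul, smul_eq_mul]
        field_simp
      rw [← h2, mul_comm]
      exact mul_le_mul_of_nonneg_left h1 (sq_nonneg _)

/-- Cauchy–Schwarz for `s` and `z = P⁻¹ s` in the inner product of `P`, by the discriminant of `r ↦
(r s - z)' P (r s - z)`. It bounds the statistic from below without a limit for `P⁻¹`, which would
not exist when the rescaled `P` tends to zero. -/
lemma sq_dotProduct_self_le {P : Matrix (Fin K) (Fin K) ℝ} (hP : P.PosDef) (s : Fin K → ℝ) :
    (s ⬝ᵥ s) ^ 2 ≤ (s ⬝ᵥ (P⁻¹ *ᵥ s)) * (s ⬝ᵥ (P *ᵥ s)) := by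
  have hsymm : Pᵀ = P := by simpa using hP.isHermitian.eq
  set z := P⁻¹ *ᵥ s with hz
  have hPz : P *ᵥ z = s := by
    rw [hz, mulVec_mulVec, mul_nonsing_inv _ (isUnit_iff_ne_zero.2 hP.det_pos.ne'), one_mulVec]
  have hzs : z ⬝ᵥ (P *ᵥ s) = s ⬝ᵥ s := by
    rw [dotProduct_mulVec, ← mulVec_transpose, hsymm, hPz]
  have hq : ∀ r : ℝ, 0 ≤ (s ⬝ᵥ (P *ᵥ s)) * (r * r) + (-2 * (s ⬝ᵥ s)) * r + s ⬝ᵥ z := fun r => by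
    have h := hP.posSemidef.dotProduct_mulVec_nonneg (r • s - z)
    simp only [star_trivial, mulVec_sub, mulVec_smul, dotProduct_sub, sub_dotProduct,
      smul_dotProduct, dotProduct_smul, smul_eq_mul, hPz, hzs, dotProduct_comm z s] at h
    linarith
  have h := discrim_le_zero hq
  rw [discrim] at h
  nlinarith

lemma dotProduct_mulVec_eq_sum_sq {A : Finset ℕ} (f : ℕ → Fin T → Fin K → ℝ)
    {P : Matrix (Fin K) (Fin K) ℝ} (hP : ∀ k j, P k j = ∑ i ∈ A, ∑ t, f i t k * f i t j)
    (v : Fin K → ℝ) : v ⬝ᵥ (P *ᵥ v) = ∑ i ∈ A, ∑ t, (v ⬝ᵥ f i t) ^ 2 := by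
  have h1 : P = ∑ i ∈ A, ∑ t, vecMulVec (f i t) (f i t) := by
    ext k j
    simp only [hP, Matrix.sum_apply, vecMulVec_apply]
  simp only [h1, Matrix.sum_mulVec, dotProduct_sum, vecMulVec_mulVec, op_smul_eq_smul,
    dotProduct_smul, smul_eq_mul]
  refine Finset.sum_congr rfl fun i _ => Finset.sum_congr rfl fun t _ => ?_
  rw [dotProduct_comm (f i t), sq]

lemma dotProduct_sq_le {v f : Fin K → ℝ} {B : ℝ} (hf : ∀ k, f k ^ 2 ≤ B) :
    (v ⬝ᵥ f) ^ 2 ≤ K ^ 2 * ‖v‖ ^ 2 * B := by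
  have h := Finset.sum_mul_sq_le_sq_mul_sq univ v f
  refine h.trans ?_
  have h1 : ∑ k, v k ^ 2 ≤ K * ‖v‖ ^ 2 := sum_univ_le fun k => by
    rw [← sq_abs]
    exact pow_le_pow_left₀ (abs_nonneg _) (norm_le_pi_norm v k) 2
  have h2 : ∑ k, f k ^ 2 ≤ K * B := sum_univ_le hf
  refine (mul_le_mul h1 h2 (Finset.sum_nonneg fun k _ => sq_nonneg _) (by positivity)).trans
    (le_of_eq ?_)
  ring

/-- The terms of the variance estimator for the errors are bounded by those for the residuals, up
to a term that has moments of the order of the regressors. -/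
lemma sq_dotProduct_unitDiff_le (xi : Fin T → Fin K → ℝ) (u : Fin T → ℝ) (η v : Fin K → ℝ)
    (t : Fin T) {q B : ℝ} (hq : 0 ≤ q) (hq' : q ≤ 1) (hη : ‖η‖ ≤ B) :
    (v ⬝ᵥ unitDiff xi u t) ^ 2 ≤ 2 * (v ⬝ᵥ unitDiff xi (fun t => u t + xi t ⬝ᵥ η) t) ^ 2 +
      32 * T ^ 2 * K ^ 2 * (1 + K) ^ 4 * ‖v‖ ^ 2 *
        (B ^ q * (‖xi‖ ^ (4 + q) * (1 + ‖u‖ ^ 4))) := by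
  have hB : 0 ≤ B := (norm_nonneg _).trans hη
  set g := unitDiff xi u t
  set r := unitDiff xi (fun t => u t + xi t ⬝ᵥ η) t - g
  have hr : unitDiff xi (fun t => u t + xi t ⬝ᵥ η) t = g + r := by simp [r]
  set a := ‖xi‖
  set b := ‖u‖
  have hz : 0 ≤ a * ‖η‖ := by positivity
  have hK : (1 : ℝ) ≤ (1 + K) ^ 4 := one_le_pow₀ (by simp)
  have h1 : (v ⬝ᵥ g) ^ 2 ≤ 8 * T ^ 2 * K ^ 2 * (1 + K) ^ 4 * ‖v‖ ^ 2 * a ^ 4 * b ^ 4 := by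
    refine (dotProduct_sq_le (B := T ^ 2 * (a ^ 4 * b ^ 4)) fun k => ?_).trans ?_
    · rw [← sq_abs]
      refine (pow_le_pow_left₀ (abs_nonneg _) (abs_unitDiff_le xi u t k) 2).trans (le_of_eq ?_)
      ring
    · have h0 : 0 ≤ (K : ℝ) ^ 2 * ‖v‖ ^ 2 * (T ^ 2 * (a ^ 4 * b ^ 4)) := by positivity
      have := mul_le_mul_of_nonneg_left hK h0
      linarith
  have h2 : (v ⬝ᵥ r) ^ 2 ≤ 8 * T ^ 2 * K ^ 2 * (1 + K) ^ 4 * ‖v‖ ^ 2 * a ^ 4 *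
      (b ^ 2 * (a * ‖η‖) ^ 2 + (a * ‖η‖) ^ 4) := by
    refine (dotProduct_sq_le fun k => sq_unitDiff_add_sub_le xi u η t k).trans (le_of_eq ?_)
    ring
  -- If `v'g` is the smaller one, the minimum alone suffices; otherwise write `v'g` as `v'(g + r)`
  -- minus `v'r`.
  have h3 : (v ⬝ᵥ g) ^ 2 ≤ 2 * (v ⬝ᵥ (g + r)) ^ 2 + 2 * min ((v ⬝ᵥ g) ^ 2) ((v ⬝ᵥ r) ^ 2) := by
    rw [dotProduct_add]
    rcases le_total ((v ⬝ᵥ g) ^ 2) ((v ⬝ᵥ r) ^ 2) with h | h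
    · rw [min_eq_left h]
      nlinarith [sq_nonneg (v ⬝ᵥ g + v ⬝ᵥ r), sq_nonneg (v ⬝ᵥ g)]
    · rw [min_eq_right h]
      nlinarith [sq_nonneg (v ⬝ᵥ g + 2 * v ⬝ᵥ r)]
  rw [hr]
  refine h3.trans (add_le_add le_rfl ?_)
  have h4 := min_le_min h1 h2
  rw [← mul_min_of_nonneg _ _ (by positivity)] at h4
  have h5 := h4.trans (mul_le_mul_of_nonneg_left (min_le_rpow hz hq hq') (by positivity))
  have h6 : (a * ‖η‖) ^ q ≤ a ^ q * B ^ q := by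
    rw [Real.mul_rpow (norm_nonneg _) (norm_nonneg _)]
    exact mul_le_mul_of_nonneg_left (Real.rpow_le_rpow (norm_nonneg _) hη hq) (by positivity)
  have h7 : a ^ (4 + q) = a ^ 4 * a ^ q := by
    rw [Real.rpow_add_of_nonneg (norm_nonneg _) (by norm_num) hq, Real.rpow_ofNat]
  calc 2 * min ((v ⬝ᵥ g) ^ 2) ((v ⬝ᵥ r) ^ 2)
      ≤ 2 * (8 * T ^ 2 * K ^ 2 * (1 + K) ^ 4 * ‖v‖ ^ 2 * a ^ 4 *
        (2 * ((a ^ q * B ^ q) * (1 + b ^ 4)))) := by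
        refine mul_le_mul_of_nonneg_left (h5.trans ?_) (by norm_num)
        refine mul_le_mul_of_nonneg_left ?_ (by positivity)
        refine mul_le_mul_of_nonneg_left ?_ (by norm_num)
        exact mul_le_mul_of_nonneg_right h6 (by positivity)
    _ = _ := by
        rw [h7]
        ring

variable {l : Filter ℕ} {X : ℕ → Fin T → Fin K → ℝ} {E : ℕ → Fin T → ℝ} {G : ℕ → Finset ℕ}
  {γ : ℕ → ℝ} {β lam : Fin K → ℝ} {m₀ q : ℝ} {S SG V : Matrix (Fin K) (Fin K) ℝ}
  {U UG : Fin K → Matrix (Fin K) (Fin K) ℝ}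

/-- The deviations of the slopes from their estimator are of the order `1 / γ + N ^ (-1 / 4)`. -/
lemma PathLimits.exists_norm_slopeError_le (h : PathLimits l X E G S SG V U UG) (hl : l ≤ atTop)
    (hAlt : LocalAlternative G γ lam m₀) (hS : S.PosDef) :
    ∃ C, 0 ≤ C ∧ ∀ᶠ N in l, ∀ i,
      ‖slopeError X E G γ lam N i‖ ≤ C * ((γ N)⁻¹ + (quartRoot N)⁻¹) := by
  have hν := (hAlt.tendsto_quartRoot_div.mono_left hl).pow 4
  have ha := (hν.mul (h.tendsto_groupShift (lam := lam) hS).norm).eventually_lt_const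
    (lt_add_one _)
  have hb := (h.tendsto_noiseShift hS).norm.eventually_lt_const (lt_add_one _)
  set C₁ := (m₀ ^ (1 / 4 : ℝ)) ^ 4 * ‖S⁻¹ *ᵥ (SG *ᵥ lam)‖ + 1
  set C₂ := ‖(0 : Fin K → ℝ)‖ + 1
  have hC₁ : 0 ≤ C₁ := by
    have := Real.rpow_nonneg hAlt.share_nonneg (1 / 4)
    positivity
  refine ⟨‖lam‖ + C₁ + C₂, by positivity, ?_⟩
  filter_upwards [h.eventually_regular hl hAlt hS, ha, hb] with N ⟨_, h1, h2, h3, _⟩ ha hb i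
  have e1 : ‖if i ∈ G N then (γ N)⁻¹ • lam else 0‖ ≤ (γ N)⁻¹ * ‖lam‖ := by
    split_ifs
    · rw [norm_smul, norm_inv, Real.norm_of_nonneg h3.le]
    · rw [norm_zero]; positivity
  -- The rate cancels here: the shift due to the group is `(M/N) / γ` times a convergent vector,
  -- whether or not the rate converges.
  have hr : (quartRoot N)⁻¹ * (detectionRate G γ N * (quartRoot #(G N) / quartRoot N) ^ 2) =
      (γ N)⁻¹ * (quartRoot #(G N) / quartRoot N) ^ 4 := by
    rw [inv_scale_eq (G := G) h1 h2 h3]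
    field_simp
  have e2 : ‖(quartRoot N)⁻¹ • scaledShift X E G γ lam N‖ ≤
      (γ N)⁻¹ * C₁ + (quartRoot N)⁻¹ * C₂ := by
    rw [scaledShift, smul_add, smul_smul, hr, mul_smul]
    refine (norm_add_le _ _).trans ?_
    rw [norm_smul, norm_smul, norm_smul, norm_inv, norm_inv, Real.norm_of_nonneg h3.le,
      Real.norm_of_nonneg h1.le, Real.norm_of_nonneg (by positivity)]
    exact add_le_add (mul_le_mul_of_nonneg_left ha.le (by positivity))
      (mul_le_mul_of_nonneg_left hb.le (by positivity))
  refine (norm_sub_le _ _).trans ((add_le_add e1 e2).trans ?_)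
  have hC₂ : 0 ≤ C₂ := by positivity
  have i1 : 0 ≤ (γ N)⁻¹ := by positivity
  have i2 : 0 ≤ (quartRoot N)⁻¹ := by positivity
  nlinarith [mul_nonneg i1 hC₂, mul_nonneg i2 hC₁, mul_nonneg i2 (norm_nonneg lam)]

lemma dotProduct_mulVec_sub_le (A B : Matrix (Fin K) (Fin K) ℝ) (v : Fin K → ℝ) :
    v ⬝ᵥ (B *ᵥ v) - v ⬝ᵥ (A *ᵥ v) ≤ (∑ k, ∑ j, |A k j - B k j|) * ‖v‖ ^ 2 := by
  have h : v ⬝ᵥ (B *ᵥ v) - v ⬝ᵥ (A *ᵥ v) = -∑ k, ∑ j, (A k j - B k j) * (v k * v j) := by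
    simp only [dotProduct, mulVec, Finset.mul_sum, ← Finset.sum_sub_distrib,
      ← Finset.sum_neg_distrib]
    exact Finset.sum_congr rfl fun k _ => Finset.sum_congr rfl fun j _ => by ring
  rw [h]
  refine (neg_le_abs _).trans ?_
  rw [Finset.sum_mul]
  refine (abs_sum_le_sum_abs _ _).trans (Finset.sum_le_sum fun k _ => ?_)
  rw [Finset.sum_mul]
  refine (abs_sum_le_sum_abs _ _).trans (Finset.sum_le_sum fun j _ => ?_)
  rw [abs_mul, abs_mul, sq ‖v‖]
  exact mul_le_mul_of_nonneg_left (mul_le_mul (norm_le_pi_norm v k) (norm_le_pi_norm v j)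
    (abs_nonneg _) (norm_nonneg _)) (abs_nonneg _)

lemma sum_sq_dotProduct_unitDiff_le (A : Finset ℕ) (η : ℕ → Fin K → ℝ) (v : Fin K → ℝ) {B : ℝ}
    (hq : 0 ≤ q) (hq' : q ≤ 1) (hη : ∀ i, ‖η i‖ ≤ B) :
    ∑ i ∈ A, ∑ t, (v ⬝ᵥ unitDiff (X i) (E i) t) ^ 2 ≤
      2 * ∑ i ∈ A, ∑ t, (v ⬝ᵥ unitDiff (X i) (fun t => E i t + X i t ⬝ᵥ η i) t) ^ 2 +
      32 * T ^ 3 * K ^ 2 * (1 + K) ^ 4 * ‖v‖ ^ 2 *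
        (B ^ q * ∑ i ∈ A, ‖X i‖ ^ (4 + q) * (1 + ‖E i‖ ^ 4)) := by
  rw [Finset.mul_sum, Finset.mul_sum, Finset.mul_sum, ← Finset.sum_add_distrib]
  refine Finset.sum_le_sum fun i _ => ?_
  refine (Finset.sum_le_sum fun t _ => sq_dotProduct_unitDiff_le (X i) (E i) (η i) v t hq hq'
    (hη i)).trans (le_of_eq ?_)
  rw [Finset.sum_add_distrib, ← Finset.mul_sum, Finset.sum_const, card_univ, Fintype.card_fin,
    nsmul_eq_mul]
  ring

/-- The variance estimator is eventually positive definite. -/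
lemma PathLimits.eventually_posDef_scoreVar (h : PathLimits l X E G S SG V U UG) (hl : l ≤ atTop)
    (hAlt : LocalAlternative G γ lam m₀) (hS : S.PosDef) (hV : V.PosDef) (hq : 0 < q) (hq' : q ≤ 1)
    (hmom : Tendsto (fun N => ((γ N)⁻¹ + (quartRoot N)⁻¹) ^ q *
      ((∑ i ∈ range N, ‖X i‖ ^ (4 + q) * (1 + ‖E i‖ ^ 4)) / N)) l (𝓝 0)) :
    ∀ᶠ N in l, (scoreVar N (altData X E G γ β lam N) X).PosDef := by
  obtain ⟨c, hc, hcV⟩ := exists_mul_norm_sq_le hV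
  obtain ⟨C, hC, hη⟩ := h.exists_norm_slopeError_le hl hAlt hS
  have hD : Tendsto (fun N => ∑ k, ∑ j, |(∑ i ∈ range N, ∑ t,
      unitDiff (X i) (E i) t k * unitDiff (X i) (E i) t j) / N - V k j|) l (𝓝 0) := by
    have := tendsto_finsetSum univ fun k _ => tendsto_finsetSum univ fun j _ =>
      ((h.diff k j).sub (tendsto_const_nhds (x := V k j))).abs
    simpa using this
  have hDQ := hD.add (hmom.const_mul (32 * (T : ℝ) ^ 3 * K ^ 2 * (1 + K) ^ 4 * C ^ q))
  rw [mul_zero, add_zero] at hDQ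
  filter_upwards [h.eventually_regular hl hAlt hS, hη, hDQ.eventually_lt_const hc] with
    N ⟨h0, h1, h2, h3, h4⟩ hη hlt
  have hN : (0 : ℝ) < N := by
    rw [← quartRoot_pow_four]
    positivity
  have hτ : 0 ≤ (γ N)⁻¹ + (quartRoot N)⁻¹ := by positivity
  refine Matrix.PosDef.of_dotProduct_mulVec_pos ?_ fun v hv => ?_
  · ext k j
    simp only [conjTranspose_apply, star_trivial, scoreVar_apply, mul_comm]
  rw [star_trivial, dotProduct_mulVec_eq_sum_sq _ (scoreVar_apply N _ X)]
  simp only [residual_altData h0 h1 h2 h3 h4]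
  -- The chain is: `c ‖v‖²` is at most `v'Vv`, which exceeds the averaged form of the errors by at
  -- most `D ‖v‖²`, and this form is at most twice the averaged form of the residuals plus a
  -- remainder. As `D` and the remainder's coefficient add up to less than `c`, the form of the
  -- residuals is positive.
  have e1 := dotProduct_mulVec_eq_sum_sq (A := range N) (fun i t => unitDiff (X i) (E i) t)
    (P := Matrix.of fun k j => ∑ i ∈ range N, ∑ t,
      unitDiff (X i) (E i) t k * unitDiff (X i) (E i) t j) (fun _ _ => rfl) v
  have e2 := dotProduct_mulVec_sub_le ((N : ℝ)⁻¹ • Matrix.of fun k j => ∑ i ∈ range N, ∑ t,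
      unitDiff (X i) (E i) t k * unitDiff (X i) (E i) t j) V v
  have e3 := sum_sq_dotProduct_unitDiff_le (X := X) (E := E) (range N)
    (slopeError X E G γ lam N) v hq.le hq' hη
  have e4 := hcV v
  have e5 := mul_pos (sub_pos.2 hlt) (pow_pos (norm_pos_iff.2 hv) 2)
  rw [smul_mulVec, dotProduct_smul, e1, smul_eq_mul] at e2
  simp only [Matrix.smul_apply, Matrix.of_apply, smul_eq_mul, inv_mul_eq_div] at e2
  rw [Real.mul_rpow hC hτ] at e3
  generalize (∑ k, ∑ j, |(∑ i ∈ range N, ∑ t,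
    unitDiff (X i) (E i) t k * unitDiff (X i) (E i) t j) / N - V k j|) = D at e2 e5
  generalize (∑ i ∈ range N, ∑ t, (v ⬝ᵥ unitDiff (X i) (E i) t) ^ 2) = g at e2 e3
  generalize (∑ i ∈ range N, ‖X i‖ ^ (4 + q) * (1 + ‖E i‖ ^ 4)) = Q at e3 e5
  generalize (∑ i ∈ range N, ∑ t, (v ⬝ᵥ unitDiff (X i)
    (fun t => E i t + X i t ⬝ᵥ slopeError X E G γ lam N i) t) ^ 2) = r at e3 ⊢
  have e6 := div_le_div_of_nonneg_right e3 hN.le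
  rw [← div_pos_iff_of_pos_right hN]
  have e7 : (2 * r + 32 * (T : ℝ) ^ 3 * K ^ 2 * (1 + K) ^ 4 * ‖v‖ ^ 2 *
      (C ^ q * ((γ N)⁻¹ + (quartRoot N)⁻¹) ^ q * Q)) / N = 2 * (r / N) +
      32 * (T : ℝ) ^ 3 * K ^ 2 * (1 + K) ^ 4 * C ^ q *
        (((γ N)⁻¹ + (quartRoot N)⁻¹) ^ q * (Q / N)) * ‖v‖ ^ 2 := by ring
  rw [e7] at e6
  linarith

/-- Divergence of the statistic when the detection rate diverges. -/
lemma PathLimits.tendsto_lmStat_atTop (h : PathLimits l X E G S SG V U UG) (hl : l ≤ atTop)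
    (hAlt : LocalAlternative G γ lam m₀) (hS : S.PosDef) (hSG : SG.IsSymm) (hV : V.PosDef)
    (hq : 0 < q) (hq' : q ≤ 1)
    (hmom : Tendsto (fun N => ((γ N)⁻¹ + (quartRoot N)⁻¹) ^ q *
      ((∑ i ∈ range N, ‖X i‖ ^ (4 + q) * (1 + ‖E i‖ ^ 4)) / N)) l (𝓝 0))
    (hrate : Tendsto (detectionRate G γ) l atTop)
    (hscore : ∀ k, Tendsto (fun N => (detectionRate G γ N)⁻¹ ^ 2 *
      ((∑ i ∈ range N, unitScore (X i) (E i) k) / quartRoot N ^ 2)) l (𝓝 0))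
    (hd : drift m₀ lam S SG U UG ≠ 0) :
    Tendsto (fun N => lmStat N (altData X E G γ β lam N) X) l atTop := by
  set d := drift m₀ lam S SG U UG
  set w : ℕ → ℝ := fun N => (detectionRate G γ N)⁻¹ with hw
  have hc : Tendsto (fun N => w N * detectionRate G γ N) l (𝓝 1) := by
    refine tendsto_const_nhds.congr' ?_
    filter_upwards [hrate.eventually_gt_atTop 0] with N hN
    exact (inv_mul_cancel₀ hN.ne').symm
  have he : Tendsto w l (𝓝 0) := tendsto_inv_atTop_zero.comp hrate
  set s : ℕ → Fin K → ℝ := fun N => (w N ^ 2 / quartRoot N ^ 2) •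
    score N (altData X E G γ β lam N) X with hs
  set P : ℕ → Matrix (Fin K) (Fin K) ℝ := fun N => (w N ^ 4 / quartRoot N ^ 4) •
    scoreVar N (altData X E G γ β lam N) X with hP
  have hslim : Tendsto s l (𝓝 d) := by
    refine tendsto_pi_nhds.2 fun k => ?_
    have := (h.tendsto_score_sub (β := β) hl hAlt hS hSG hc he k).add (hscore k)
    rw [one_pow, one_smul, add_zero] at this
    refine this.congr fun N => ?_
    simp only [hs, Pi.smul_apply, smul_eq_mul, hw]
    ring
  have hPlim : Tendsto P l (𝓝 0) := by
    refine tendsto_pi_nhds.2 fun k => tendsto_pi_nhds.2 fun j => ?_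
    have := h.tendsto_scoreVar (β := β) hl hAlt hS hc he k j
    rw [zero_pow (by norm_num), zero_mul] at this
    refine this.congr fun N => ?_
    simp only [hP, Matrix.smul_apply, smul_eq_mul, quartRoot_pow_four]
    ring
  -- The numerator of the Cauchy–Schwarz bound tends to `(d'd)² > 0` while its denominator tends to
  -- zero.
  have hnum : Tendsto (fun N => (s N ⬝ᵥ s N) ^ 2) l (𝓝 ((d ⬝ᵥ d) ^ 2)) :=
    (tendsto_dotProduct hslim hslim).pow 2
  have hden : Tendsto (fun N => s N ⬝ᵥ (P N *ᵥ s N)) l (𝓝 0) := by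
    simpa using tendsto_dotProduct hslim (tendsto_mulVec hPlim hslim)
  have hpd := h.eventually_posDef_scoreVar (β := β) hl hAlt hS hV hq hq' hmom
  have hbound : ∀ᶠ N in l, 0 < s N ⬝ᵥ (P N *ᵥ s N) ∧ (s N ⬝ᵥ s N) ^ 2 * (s N ⬝ᵥ (P N *ᵥ s N))⁻¹ ≤
      lmStat N (altData X E G γ β lam N) X := by
    filter_upwards [hpd, hslim.eventually_ne hd, h.eventually_regular hl hAlt hS,
      hrate.eventually_gt_atTop 0] with N hpd hsne ⟨_, h1, _⟩ hrpos
    have hwpos : 0 < w N := inv_pos.2 hrpos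
    have hPpd : (P N).PosDef := hpd.smul (by positivity)
    have hpos : 0 < s N ⬝ᵥ (P N *ᵥ s N) := by simpa using hPpd.dotProduct_mulVec_pos hsne
    refine ⟨hpos, ?_⟩
    rw [← div_eq_mul_inv, div_le_iff₀ hpos]
    have := sq_dotProduct_self_le hpd (score N (altData X E G γ β lam N) X)
    -- Both sides of the inequality scale with this eighth power, as the score is multiplied by `(w
    -- / N^(1/4))²` and the variance by its square; the statistic itself is unchanged.
    have h8 : 0 ≤ (w N / quartRoot N) ^ 8 := by positivity
    refine (le_of_eq ?_).trans ((mul_le_mul_of_nonneg_left this h8).trans (le_of_eq ?_))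
    · simp only [hs, smul_dotProduct, dotProduct_smul, smul_eq_mul]
      ring
    · simp only [hs, hP, smul_dotProduct, dotProduct_smul, smul_mulVec, mulVec_smul, smul_eq_mul,
        lmStat]
      ring
  have hden' : Tendsto (fun N => (s N ⬝ᵥ (P N *ᵥ s N))⁻¹) l atTop :=
    tendsto_inv_nhdsGT_zero.comp (tendsto_nhdsWithin_iff.2 ⟨hden, hbound.mono fun N hN => hN.1⟩)
  have hdpos : 0 < (d ⬝ᵥ d) ^ 2 :=
    pow_pos (lt_of_le_of_ne (Finset.sum_nonneg fun k _ => mul_self_nonneg _)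
      fun h0 => hd (dotProduct_self_eq_zero.1 h0.symm)) 2
  exact tendsto_atTop_mono' _ (hbound.mono fun N hN => hN.2) (hnum.pos_mul_atTop hdpos hden')

end Divergence

/-! ### Matrix roots and measurability of the statistic -/

section MatrixRoot

variable {K : ℕ}

open scoped MatrixOrder in
lemma exists_mul_transpose_eq {V : Matrix (Fin K) (Fin K) ℝ} (hV : V.PosDef) :
    ∃ B : Matrix (Fin K) (Fin K) ℝ, B * Bᵀ = V := by
  obtain ⟨B, hB⟩ := CStarAlgebra.nonneg_iff_eq_star_mul_self.mp hV.posSemidef.nonneg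
  refine ⟨Bᵀ, ?_⟩
  rw [hB, star_eq_conjTranspose, conjTranspose_eq_transpose_of_trivial, transpose_transpose]

/-- A reflection that maps one vector to another one of the same length. -/
lemma exists_orthogonal_mulVec_eq {u e : Fin K → ℝ} (h : u ⬝ᵥ u = e ⬝ᵥ e) :
    ∃ Q : Matrix (Fin K) (Fin K) ℝ, Q * Qᵀ = 1 ∧ Q *ᵥ e = u := by
  set w := u - e with hw
  by_cases h0 : w ⬝ᵥ w = 0
  · refine ⟨1, by simp, ?_⟩
    rw [one_mulVec]
    exact (sub_eq_zero.1 (dotProduct_self_eq_zero.1 h0)).symm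
  -- The Householder reflection along `w = u - e`, which exchanges `u` and `e` because they have
  -- equal length.
  · set c := 2 / (w ⬝ᵥ w) with hc
    have hcw : c * (w ⬝ᵥ w) = 2 := div_mul_cancel₀ _ h0
    refine ⟨1 - c • vecMulVec w w, ?_, ?_⟩
    · have ht : (1 - c • vecMulVec w w)ᵀ = 1 - c • vecMulVec w w := by
        rw [transpose_sub, transpose_one, transpose_smul, transpose_vecMulVec]
      rw [ht, sub_mul, mul_sub, mul_sub, one_mul, mul_one, one_mul, smul_mul_smul_comm,
        vecMulVec_mul_vecMulVec, vecMulVec_smul, smul_smul, mul_assoc, hcw]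
      module
    · have h1 : w ⬝ᵥ w = 2 * (u ⬝ᵥ u - u ⬝ᵥ e) := by
        rw [hw, dotProduct_sub, sub_dotProduct, sub_dotProduct, ← h, dotProduct_comm e u]
        ring
      have h2 : c * (w ⬝ᵥ e) = -1 := by
        have : w ⬝ᵥ e = -(w ⬝ᵥ w) / 2 := by
          rw [h1, hw, sub_dotProduct, ← h]
          ring
        rw [this]
        linear_combination (-1 / 2) * hcw
      rw [sub_mulVec, one_mulVec, smul_mulVec, vecMulVec_mulVec, op_smul_eq_smul, smul_smul, h2, hw]
      module

lemma dotProduct_inv_mulVec_mulVec {A : Matrix (Fin K) (Fin K) ℝ} (hA : A.det ≠ 0)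
    (y : Fin K → ℝ) : (A *ᵥ y) ⬝ᵥ ((A * Aᵀ)⁻¹ *ᵥ (A *ᵥ y)) = y ⬝ᵥ y := by
  have hu : IsUnit A.det := isUnit_iff_ne_zero.2 hA
  have hut : IsUnit Aᵀ.det := by rwa [det_transpose]
  rw [Matrix.mul_inv_rev, ← mulVec_mulVec, mulVec_mulVec _ A⁻¹, nonsing_inv_mul _ hu, one_mulVec,
    dotProduct_comm, dotProduct_mulVec, ← mulVec_transpose, mulVec_mulVec, mul_nonsing_inv _ hut,
    one_mulVec]

/-- A square root of `V` that maps the first coordinate direction to that of `δ`. -/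
lemma exists_root_dotProduct_inv (hK : 0 < K) {V : Matrix (Fin K) (Fin K) ℝ} (hV : V.PosDef)
    (δ : Fin K → ℝ) : ∃ A : Matrix (Fin K) (Fin K) ℝ, A * Aᵀ = V ∧
      ∀ z : Fin K → ℝ, (A *ᵥ z + δ) ⬝ᵥ (V⁻¹ *ᵥ (A *ᵥ z + δ)) =
        ∑ k : Fin K, (z k + if (k : ℕ) = 0 then √(δ ⬝ᵥ (V⁻¹ *ᵥ δ)) else 0) ^ 2 := by
  obtain ⟨B, hB⟩ := exists_mul_transpose_eq hV
  have hBdet : B.det ≠ 0 := fun h => hV.det_pos.ne' (by rw [← hB, det_mul, h, zero_mul])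
  set u := B⁻¹ *ᵥ δ with hu
  have hδ : B *ᵥ u = δ := by
    rw [hu, mulVec_mulVec, mul_nonsing_inv _ (isUnit_iff_ne_zero.2 hBdet), one_mulVec]
  have hθ : δ ⬝ᵥ (V⁻¹ *ᵥ δ) = u ⬝ᵥ u := by
    rw [← hδ, ← hB, dotProduct_inv_mulVec_mulVec hBdet]
  set e : Fin K → ℝ := fun k => if (k : ℕ) = 0 then √(δ ⬝ᵥ (V⁻¹ *ᵥ δ)) else 0 with he
  have hee : u ⬝ᵥ u = e ⬝ᵥ e := by
    have h1 : ∀ k : Fin K, e k * e k = if k = ⟨0, hK⟩ then u ⬝ᵥ u else 0 := fun k => by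
      simp only [he, Fin.ext_iff, hθ]
      split_ifs
      · exact Real.mul_self_sqrt (Finset.sum_nonneg fun k _ => mul_self_nonneg _)
      · simp
    rw [dotProduct.eq_1 e e]
    simp only [h1, Finset.sum_ite_eq', mem_univ, if_true]
  obtain ⟨Q, hQ, hQe⟩ := exists_orthogonal_mulVec_eq hee
  have hA : B * Q * (B * Q)ᵀ = V := by
    rw [transpose_mul, mul_assoc, ← mul_assoc Q, hQ, one_mul, hB]
  have hAdet : (B * Q).det ≠ 0 := fun h => hV.det_pos.ne' (by rw [← hA, det_mul, h, zero_mul])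
  -- An orthogonal factor keeps the product a root of `V`. Since it maps `e` to `δ`, adding `δ`
  -- after the map is adding `e` before it, and the quadratic form of `V⁻¹` becomes a sum of
  -- squares.
  refine ⟨B * Q, hA, fun z => ?_⟩
  have h1 : (B * Q) *ᵥ z + δ = (B * Q) *ᵥ (z + e) := by
    rw [mulVec_add, ← mulVec_mulVec e, hQe, hδ]
  have h2 := dotProduct_inv_mulVec_mulVec hAdet (z + e)
  rw [hA] at h2
  rw [h1, h2]
  exact Finset.sum_congr rfl fun k _ => (sq _).symm

/-- The singular case, where both inverses are zero, is included because the rescaling of the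
statistic is used for every outcome, not only where the variance estimator is invertible. -/
lemma inv_smul_of_ne_zero (A : Matrix (Fin K) (Fin K) ℝ) {c : ℝ} (hc : c ≠ 0) :
    (c • A)⁻¹ = c⁻¹ • A⁻¹ := by
  by_cases h : A.det = 0
  · rw [nonsing_inv_apply_not_isUnit, nonsing_inv_apply_not_isUnit A, smul_zero]
    · simpa using h
    · rw [det_smul, h, mul_zero]
      simp
  · simpa [Units.smul_def] using Matrix.inv_smul' A (Units.mk0 c hc) (isUnit_iff_ne_zero.2 h)

variable {Ω : Type*} [MeasurableSpace Ω]

lemma measurable_matrix_det {A : Ω → Matrix (Fin K) (Fin K) ℝ}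
    (hA : ∀ k j, Measurable fun ω => A ω k j) : Measurable fun ω => (A ω).det := by
  simp only [det_apply]
  exact Finset.measurable_sum _ fun σ _ =>
    (Finset.measurable_prod _ fun i _ => hA _ _).const_smul _

lemma measurable_matrix_inv {A : Ω → Matrix (Fin K) (Fin K) ℝ}
    (hA : ∀ k j, Measurable fun ω => A ω k j) (k j : Fin K) :
    Measurable fun ω => (A ω)⁻¹ k j := by
  simp only [Matrix.inv_def, Ring.inverse_eq_inv', Matrix.smul_apply, smul_eq_mul, adjugate_apply]
  refine (measurable_matrix_det hA).inv.mul (measurable_matrix_det fun i i' => ?_)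
  simp only [updateRow_apply]
  split_ifs
  · exact measurable_const
  · exact hA i i'

variable {T : ℕ} {y : ℕ → Ω → Fin T → ℝ} {x : ℕ → Ω → Fin T → Fin K → ℝ}

lemma measurable_residual (hy : ∀ i, Measurable (y i)) (hx : ∀ i, Measurable (x i)) (N i : ℕ)
    (t : Fin T) : Measurable fun ω => residual N (fun i => y i ω) (fun i => x i ω) i t := by
  have hxe : ∀ i t k, Measurable fun ω => x i ω t k := fun i t k => by
    have := hx i
    fun_prop
  have hye : ∀ i t, Measurable fun ω => y i ω t := fun i t => by
    have := hy i
    fun_prop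
  have hinv := measurable_matrix_inv (A := fun ω => ∑ i ∈ range N, gram (x i ω)) fun k j => by
    simp only [Matrix.sum_apply, gram, vecMulVec_apply]
    exact Finset.measurable_sum _ fun i _ => Finset.measurable_sum _ fun t _ =>
      (hxe _ _ _).mul (hxe _ _ _)
  simp only [residual, pooledLS, dotProduct, mulVec, Finset.sum_apply, Pi.smul_apply, smul_eq_mul]
  exact (hye _ _).sub (Finset.measurable_sum _ fun k _ => (hxe _ _ _).mul
    (Finset.measurable_sum _ fun j _ => (hinv _ _).mul (Finset.measurable_sum _ fun i _ =>
      Finset.measurable_sum _ fun t _ => (hye _ _).mul (hxe _ _ _))))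

lemma measurable_score (hy : ∀ i, Measurable (y i)) (hx : ∀ i, Measurable (x i)) (N : ℕ)
    (k : Fin K) : Measurable fun ω => score N (fun i => y i ω) (fun i => x i ω) k := by
  have hr := measurable_residual hy hx N
  have hxe : ∀ i t k, Measurable fun ω => x i ω t k := fun i t k => by
    have := hx i
    fun_prop
  exact Finset.measurable_sum _ fun i _ => Finset.measurable_sum _ fun t _ =>
    Finset.measurable_sum _ fun s _ => (((hr i t).mul (hr i s)).mul (hxe _ _ _)).mul (hxe _ _ _)

lemma measurable_scoreVar (hy : ∀ i, Measurable (y i)) (hx : ∀ i, Measurable (x i)) (N : ℕ)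
    (k j : Fin K) : Measurable fun ω => scoreVar N (fun i => y i ω) (fun i => x i ω) k j := by
  have hr := measurable_residual hy hx N
  have hxe : ∀ i t k, Measurable fun ω => x i ω t k := fun i t k => by
    have := hx i
    fun_prop
  simp only [scoreVar, Matrix.of_apply]
  exact Finset.measurable_sum _ fun i _ => Finset.measurable_sum _ fun t _ =>
    Finset.measurable_sum _ fun s _ => Finset.measurable_sum _ fun p _ =>
      (((((hr i t).pow_const 2).mul (hxe _ _ _)).mul (hxe _ _ _)).mul
        ((hr i s).mul (hr i p))).mul (hxe _ _ _) |>.mul (hxe _ _ _)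

lemma measurable_lmStat (hy : ∀ i, Measurable (y i)) (hx : ∀ i, Measurable (x i)) (N : ℕ) :
    Measurable fun ω => lmStat N (fun i => y i ω) (fun i => x i ω) := by
  have hs := measurable_score hy hx N
  have hi := measurable_matrix_inv (measurable_scoreVar hy hx N)
  simp only [lmStat, dotProduct, mulVec]
  exact Finset.measurable_sum _ fun k _ => (hs k).mul
    (Finset.measurable_sum _ fun j _ => (hi k j).mul (hs j))

end MatrixRoot

/-! ### The three regimes -/

section Regimes

variable {Ω : Type*} [MeasurableSpace Ω] {μ : Measure Ω} [IsProbabilityMeasure μ] {T K : ℕ}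
  {x : ℕ → Ω → Fin T → Fin K → ℝ} {ε : ℕ → Ω → Fin T → ℝ} {σ2 : ℕ → ℝ} {β lam : Fin K → ℝ}
  {G : ℕ → Finset ℕ} {γ : ℕ → ℝ} {m₀ c q D : ℝ} {S SG V : Matrix (Fin K) (Fin K) ℝ}
  {U UG : Fin K → Matrix (Fin K) (Fin K) ℝ}

lemma PLim.asAlong {A : ℕ → Ω → Matrix (Fin K) (Fin K) ℝ} {A₀ : Matrix (Fin K) (Fin K) ℝ}
    (h : PLim μ A A₀) : ASAlong μ fun l ω => Tendsto (fun N => A N ω) l (𝓝 A₀) := by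
  have h1 : ASAlong μ fun l ω => ∀ k j, Tendsto (fun N => A N ω k j) l (𝓝 (A₀ k j)) :=
    ASAlong.forall fun k => ASAlong.forall fun j => ASAlong.of_tendstoInMeasure (h k j)
  exact h1.mono fun l ω _ _ h => tendsto_pi_nhds.2 fun k => tendsto_pi_nhds.2 fun j => h k j

/-- Finitely many convergences in probability are put on one common subsequence, so that the later
arguments concern a fixed realisation. -/
lemma asAlong_pathLimits (hx : MomentBound μ x q D) (hε : Errors μ x ε σ2)
    (hReg : Regressors μ x G S SG) (hAlt : LocalAlternative G γ lam m₀)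
    (hU : ∀ k, PLim μ (fun N ω => groupAvg (range N) fun i => unitU (x i ω) k) (U k))
    (hUG : ∀ k, PLim μ (fun N ω => groupAvg (G N) fun i => unitU (x i ω) k) (UG k))
    (hV : PLim μ (fun N ω => groupAvg (range N) fun i => σ2 i ^ 2 • unitV (x i ω)) V) :
    ASAlong μ fun l ω => PathLimits l (fun i => x i ω) (fun i => ε i ω) G S SG V U UG := by
  have hA : Tendsto (fun N => #(range N)) atTop atTop := by simpa using! tendsto_id
  have hG := hAlt.size
  have h1 := hReg.plim.asAlong.and hReg.plim_group.asAlong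
  have h2 := (ASAlong.forall fun k => (hU k).asAlong).and (ASAlong.forall fun k => (hUG k).asAlong)
  have h3 := (ASAlong.forall fun k => ASAlong.forall fun j =>
    ASAlong.of_tendstoInMeasure (tendsto_sum_unitDiff hx hε hV k j))
  have h4 := (ASAlong.forall fun k => ASAlong.forall fun j =>
    ASAlong.of_tendstoInMeasure (tendsto_linear_cube hx hε hA k j)).and
    (ASAlong.forall fun k => ASAlong.forall fun j =>
    ASAlong.of_tendstoInMeasure (tendsto_linear_cube hx hε hG k j))
  have h5 := ASAlong.forall fun k => ASAlong.of_tendstoInMeasure (tendsto_sum_mul_error hx hε k)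
  have h6 := (ASAlong.of_tendstoInMeasure (tendsto_sum_pow_mul_sq hx hε hA)).and
    (ASAlong.of_tendstoInMeasure (tendsto_sum_pow_mul_sq hx hε hG))
  have h7 := (ASAlong.of_tendstoInMeasure (hx.tendsto_sum_pow hA (j := 8) (by norm_num))).and
    (ASAlong.of_tendstoInMeasure (hx.tendsto_sum_pow hG (j := 8) (by norm_num)))
  refine ((((((h1.and h2).and h3).and h4).and h5).and h6).and h7).mono
    fun l ω _ _ ⟨⟨⟨⟨⟨⟨h1, h2⟩, h3⟩, h4⟩, h5⟩, h6⟩, h7⟩ => ?_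
  simp only [card_range] at h4 h6 h7
  exact ⟨h1.1, h1.2, h2.1, h2.2, h3, h4.1, h4.2, h5, h6.1, h6.2, h7.1, h7.2⟩

lemma measurable_altData (hx : ∀ i, Measurable (x i)) (hε : ∀ i, Measurable (ε i)) (N i : ℕ) :
    Measurable fun ω => altData (fun i => x i ω) (fun i => ε i ω) G γ β lam N i := by
  have h1 := hx i
  have h2 := hε i
  refine measurable_pi_lambda _ fun t => ?_
  simp only [altData, dotProduct]
  fun_prop

/-- Convergence of the statistic to a noncentral chi-squared law. -/
theorem tendstoInDistribution_panelLM (hε : Errors μ x ε σ2) (hReg : Regressors μ x G S SG)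
    (hAlt : LocalAlternative G γ lam m₀)
    (hU : ∀ k, PLim μ (fun N ω => groupAvg (range N) fun i => unitU (x i ω) k) (U k))
    (hUG : ∀ k, PLim μ (fun N ω => groupAvg (G N) fun i => unitU (x i ω) k) (UG k))
    (hV : PLim μ (fun N ω => groupAvg (range N) fun i => σ2 i ^ 2 • unitV (x i ω)) V)
    (hVpos : V.PosDef) {δ : Fin K → ℝ} (hδ : δ = c ^ 2 • drift m₀ lam S SG U UG)
    (hrate : Tendsto (detectionRate G γ) atTop (𝓝 c)) :
    TendstoInDistribution (panelLM x ε β lam G γ) atTop id (fun _ => μ)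
      (noncentralChiSq K (δ ⬝ᵥ (V⁻¹ *ᵥ δ))) := by
  obtain ⟨q, D, hx⟩ := hReg.momentBound
  have hK : 0 < K := by
    obtain ⟨k, -⟩ := Function.ne_iff.1 hAlt.ne_zero
    exact k.pos
  obtain ⟨A, hA, hAz⟩ := exists_root_dotProduct_inv hK hVpos δ
  have hpath := asAlong_pathLimits hx hε hReg hAlt hU hUG hV
  have hSG : SG.IsSymm := by simpa using! hReg.posDef_group.isHermitian.eq
  let y : ℕ → ℕ → Ω → Fin T → ℝ := fun N i ω =>
    altData (fun i => x i ω) (fun i => ε i ω) G γ β lam N i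
  have hy : ∀ N i, Measurable (y N i) := measurable_altData hx.measurable hε.measurable
  let Z : ℕ → Ω → Fin K → ℝ := fun N ω k =>
    (∑ i ∈ range N, unitScore (x i ω) (ε i ω) k) / quartRoot N ^ 2
  -- Slutsky's decomposition: `Z` obeys the central limit theorem, and `Y`, the effect of the
  -- alternative on the scaled score together with the inverse of `V̂ / N`, converges in probability
  -- to a constant. The statistic is the continuous function `g` of the two.
  let Y : ℕ → Ω → (Fin K → ℝ) × (Fin K → Fin K → ℝ) := fun N ω =>
    (fun k => score N (fun i => y N i ω) (fun i => x i ω) k / quartRoot N ^ 2 - Z N ω k,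
      fun k j => ((N : ℝ)⁻¹ • scoreVar N (fun i => y N i ω) (fun i => x i ω))⁻¹ k j)
  let W : Fin K → Fin K → ℝ := fun k j => (V⁻¹ : Matrix (Fin K) (Fin K) ℝ) k j
  have hZ : TendstoInDistribution Z atTop (fun z : Fin K → ℝ => A *ᵥ z) (fun _ => μ)
      (Measure.pi fun _ => gaussianReal 0 1) := tendstoInDistribution_score hx hε hV hA
  have hZm : ∀ N k, Measurable fun ω => Z N ω k := fun N k => by
    refine Measurable.div_const (Finset.measurable_sum _ fun i _ => ?_) _
    have h := (measurable_unitScore (T := T) k).comp ((hx.measurable i).prodMk (hε.measurable i))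
    exact h
  have hYm : ∀ N, Measurable (Y N) := fun N => by
    refine Measurable.prodMk (measurable_pi_lambda _ fun k => ?_)
      (measurable_pi_lambda _ fun k => measurable_pi_lambda _ fun j => ?_)
    · exact ((measurable_score (hy N) hx.measurable N k).div_const _).sub (hZm N k)
    · refine measurable_matrix_inv (fun k j => ?_) k j
      simp only [Matrix.smul_apply, smul_eq_mul]
      exact (measurable_scoreVar (hy N) hx.measurable N k j).const_mul _
  have hY : TendstoInMeasure μ Y atTop fun _ => (δ, W) := by
    refine ASAlong.tendstoInMeasure (fun N => (hYm N).aestronglyMeasurable)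
      (hpath.mono fun l ω _ hl h => ?_)
    have hc : Tendsto (fun N => (1 : ℝ) * detectionRate G γ N) l (𝓝 c) := by
      simpa using hrate.mono_left hl
    have he : Tendsto (fun _ : ℕ => (1 : ℝ)) l (𝓝 1) := tendsto_const_nhds
    refine Tendsto.prodMk_nhds (tendsto_pi_nhds.2 fun k => ?_) ?_
    · have := h.tendsto_score_sub (β := β) hl hAlt hReg.posDef hSG hc he k
      simpa only [one_pow, one_mul, hδ] using this
    · have hP : Tendsto (fun N : ℕ => (N : ℝ)⁻¹ • scoreVar N (fun i => y N i ω) (fun i => x i ω)) l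
          (𝓝 V) := ?_
      · exact tendsto_matrix_inv hP hVpos.det_pos.ne'
      refine tendsto_pi_nhds.2 fun k => tendsto_pi_nhds.2 fun j => ?_
      have := h.tendsto_scoreVar (β := β) hl hAlt hReg.posDef hc he k j
      simp only [one_pow, one_mul] at this
      refine this.congr fun N => ?_
      rw [Matrix.smul_apply, smul_eq_mul, inv_mul_eq_div]
  let g : (Fin K → ℝ) × ((Fin K → ℝ) × (Fin K → Fin K → ℝ)) → ℝ := fun p =>
    ∑ k, (p.1 k + p.2.1 k) * ∑ j, p.2.2 k j * (p.1 j + p.2.1 j)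
  have hg : Continuous g := by fun_prop
  have hlim := TendstoInDistribution.continuous_comp_prodMk_of_tendstoInMeasure_const hg hZ hY
    fun N => (hYm N).aemeasurable
  have hLM : ∀ N ω, g (Z N ω, Y N ω) = panelLM x ε β lam G γ N ω := fun N ω => by
    have h1 : g (Z N ω, Y N ω) =
        ((quartRoot N ^ 2)⁻¹ • score N (fun i => y N i ω) (fun i => x i ω)) ⬝ᵥ
        (((N : ℝ)⁻¹ • scoreVar N (fun i => y N i ω) (fun i => x i ω))⁻¹ *ᵥ
        ((quartRoot N ^ 2)⁻¹ • score N (fun i => y N i ω) (fun i => x i ω))) := by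
      simp only [g, Y, dotProduct, mulVec, add_sub_cancel, Pi.smul_apply, smul_eq_mul,
        div_eq_inv_mul]
    rw [h1, show panelLM x ε β lam G γ N ω = lmStat N (fun i => y N i ω) (fun i => x i ω) from rfl,
      lmStat]
    -- The scaling is invertible only for `N > 0`; for `N = 0` the score is an empty sum and both
    -- sides are zero.
    rcases N.eq_zero_or_pos with rfl | hN
    · have h0 : score 0 (fun i => y 0 i ω) (fun i => x i ω) = 0 := by
        funext k
        simp [score]
      simp [h0]
    · have hN' : (N : ℝ) ≠ 0 := by positivity
      have hq := (quartRoot_pos hN).ne'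
      rw [inv_smul_of_ne_zero _ (inv_ne_zero hN'), inv_inv, ← quartRoot_pow_four]
      simp only [smul_mulVec, mulVec_smul, smul_dotProduct, dotProduct_smul, smul_eq_mul]
      field_simp
  have hgz : ∀ z : Fin K → ℝ, g (A *ᵥ z, (δ, W)) =
      ∑ k : Fin K, (z k + if (k : ℕ) = 0 then √(δ ⬝ᵥ (V⁻¹ *ᵥ δ)) else 0) ^ 2 := fun z => by
    rw [← hAz]
    rfl
  refine ⟨fun N => (measurable_lmStat (hy N) hx.measurable N).aemeasurable, aemeasurable_id, ?_⟩
  have ht := hlim.tendsto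
  simp only [hLM, hgz] at ht
  convert ht using 3
  exact congrArg 𝓝 (Subtype.ext Measure.map_id)

/-- Consistency of the test when the detection rate diverges. -/
theorem tendsto_measure_lt_panelLM (hε : Errors μ x ε σ2) (hReg : Regressors μ x G S SG)
    (hAlt : LocalAlternative G γ lam m₀)
    (hU : ∀ k, PLim μ (fun N ω => groupAvg (range N) fun i => unitU (x i ω) k) (U k))
    (hUG : ∀ k, PLim μ (fun N ω => groupAvg (G N) fun i => unitU (x i ω) k) (UG k))
    (hV : PLim μ (fun N ω => groupAvg (range N) fun i => σ2 i ^ 2 • unitV (x i ω)) V)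
    (hVpos : V.PosDef) (hd : drift m₀ lam S SG U UG ≠ 0)
    (hrate : Tendsto (detectionRate G γ) atTop atTop) (B : ℝ) :
    Tendsto (fun N => μ {ω | B < panelLM x ε β lam G γ N ω}) atTop (𝓝 1) := by
  obtain ⟨q, D, hx⟩ := hReg.momentBound
  have hq := hx.pos
  have hSG : SG.IsSymm := by simpa using! hReg.posDef_group.isHermitian.eq
  have hτ : Tendsto (fun N => ((γ N)⁻¹ + (quartRoot N)⁻¹) ^ q) atTop (𝓝 0) := by
    have h1 := ((tendsto_inv_atTop_zero.comp hAlt.scale).add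
      (tendsto_inv_atTop_zero.comp tendsto_quartRoot)).rpow_const (p := q) (Or.inr hq.le)
    simpa [Real.zero_rpow hq.ne'] using h1
  -- The score of the errors is of order `√N`, so after the factor `rate⁻²` it no longer competes
  -- with the drift.
  have hκ : Tendsto (fun N => (detectionRate G γ N)⁻¹ ^ 2) atTop (𝓝 0) := by
    simpa using (tendsto_inv_atTop_zero.comp hrate).pow 2
  have hpath := ((asAlong_pathLimits hx hε hReg hAlt hU hUG hV).and
    (ASAlong.of_tendstoInMeasure (tendsto_sum_rpow_mul_pow hx hε hτ))).and
    (ASAlong.forall fun k => ASAlong.of_tendstoInMeasure (tendsto_mul_sum_unitScore hx hε hκ k))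
  exact tendsto_measure_lt_of_asAlong (fun N => measurable_lmStat
    (measurable_altData hx.measurable hε.measurable N) hx.measurable N)
    (hpath.mono fun l ω _ hl ⟨⟨h, hmom⟩, hscore⟩ => h.tendsto_lmStat_atTop hl hAlt hReg.posDef hSG
      hVpos hq hx.le_one hmom (hrate.mono_left hl) hscore hd) B

end Regimes

/-! ### The central chi-squared law and undetectable groups -/

section Undetectable

lemma noncentralChiSq_zero (K : ℕ) : noncentralChiSq K 0 = chiSq K := by
  simp [noncentralChiSq, chiSq]

/-- Given all other coordinates, the first one is confined to at most two points, which a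
nondegenerate Gaussian law does not charge. Every `q` is thus admissible in the portmanteau theorem.
-/
lemma chiSq_singleton {K : ℕ} (hK : 0 < K) (q : ℝ) : chiSq K {q} = 0 := by
  obtain ⟨n, rfl⟩ := Nat.exists_eq_succ_of_ne_zero hK.ne'
  have hm : Measurable fun z : Fin (n + 1) → ℝ => ∑ k, z k ^ 2 := by fun_prop
  rw [chiSq, Measure.map_apply hm (measurableSet_singleton q)]
  have hmp := (measurePreserving_piFinSuccAbove (fun _ : Fin (n + 1) => gaussianReal 0 1) 0).symm
  have hs := hm (measurableSet_singleton q)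
  rw [← hmp.measure_preimage hs.nullMeasurableSet, Measure.prod_apply_symm (hmp.measurable hs)]
  have := nullSingletonClass_gaussianReal (μ := 0) (v := 1) one_ne_zero
  refine (lintegral_congr fun y => ?_).trans lintegral_zero
  refine Set.Finite.measure_zero (Set.Finite.subset
    (s := {√(q - ∑ k, y k ^ 2), -√(q - ∑ k, y k ^ 2)}) (by simp) fun a ha => ?_) _
  have h1 : a ^ 2 + ∑ k, y k ^ 2 = q := by
    simpa [Fin.sum_univ_succ, MeasurableEquiv.piFinSuccAbove] using ha
  have h2 : q - ∑ k, y k ^ 2 = a ^ 2 := by linarith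
  rw [h2, Real.sqrt_sq_eq_abs]
  rcases abs_choice a with h | h
  · left
    exact h.symm
  · right
    rw [h, neg_neg]
    rfl

variable {Ω : Type*} [MeasurableSpace Ω] {μ : Measure Ω} [IsProbabilityMeasure μ]

lemma tendstoInDistribution_id_congr {X : ℕ → Ω → ℝ} {ν ν' : Measure ℝ} [IsProbabilityMeasure ν]
    [IsProbabilityMeasure ν'] (h : ν = ν')
    (hX : TendstoInDistribution X atTop id (fun _ => μ) ν) :
    TendstoInDistribution X atTop id (fun _ => μ) ν' := by
  subst h
  exact hX

lemma tendsto_measure_of_tendstoInDistribution {X : ℕ → Ω → ℝ} {ν : Measure ℝ}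
    [IsProbabilityMeasure ν] (hX : TendstoInDistribution X atTop id (fun _ => μ) ν) {q : ℝ}
    (hq : ν {q} = 0) : Tendsto (fun N => μ {ω | q < X N ω}) atTop (𝓝 (ν (Set.Ioi q))) := by
  have h := ProbabilityMeasure.tendsto_measure_of_null_frontier_of_tendsto' hX.tendsto
    (E := Set.Ioi q) (by simpa [frontier_Ioi] using hq)
  simp only [ProbabilityMeasure.coe_mk, Measure.map_id] at h
  refine h.congr fun N => ?_
  rw [Measure.map_apply_of_aemeasurable (hX.forall_aemeasurable N) measurableSet_Ioi]
  rfl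

variable {T K : ℕ} {x : ℕ → Ω → Fin T → Fin K → ℝ} {ε : ℕ → Ω → Fin T → ℝ} {σ2 : ℕ → ℝ}
  {β lam : Fin K → ℝ} {G : ℕ → Finset ℕ} {γ : ℕ → ℝ} {m₀ : ℝ} {S SG V : Matrix (Fin K) (Fin K) ℝ}
  {U UG : Fin K → Matrix (Fin K) (Fin K) ℝ}

/-- Convergence of the statistic to the central chi-squared law. -/
theorem tendstoInDistribution_panelLM_zero (hε : Errors μ x ε σ2) (hReg : Regressors μ x G S SG)
    (hAlt : LocalAlternative G γ lam m₀)
    (hU : ∀ k, PLim μ (fun N ω => groupAvg (range N) fun i => unitU (x i ω) k) (U k))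
    (hUG : ∀ k, PLim μ (fun N ω => groupAvg (G N) fun i => unitU (x i ω) k) (UG k))
    (hV : PLim μ (fun N ω => groupAvg (range N) fun i => σ2 i ^ 2 • unitV (x i ω)) V)
    (hVpos : V.PosDef) (hrate : Tendsto (detectionRate G γ) atTop (𝓝 0)) :
    TendstoInDistribution (panelLM x ε β lam G γ) atTop id (fun _ => μ) (chiSq K) := by
  refine tendstoInDistribution_id_congr ?_ (tendstoInDistribution_panelLM hε hReg hAlt hU hUG hV
    hVpos rfl hrate)
  simp [noncentralChiSq_zero]

/-- The square of the rate is `(M / √N) γ⁻²`, a product of two null sequences. -/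
lemma tendsto_detectionRate_of_isLittleO (hγ : Tendsto γ atTop atTop)
    (h : (fun N => (#(G N) : ℝ)) =o[atTop] (fun N : ℕ => √(N : ℝ))) :
    Tendsto (detectionRate G γ) atTop (𝓝 0) := by
  have h1 := h.tendsto_div_nhds_zero.mul ((tendsto_inv_atTop_zero.comp hγ).pow 2)
  rw [zero_mul] at h1
  refine tendsto_zero_of_sq_le h1 fun N => le_of_eq ?_
  rw [detectionRate, div_pow, mul_pow, Real.sq_sqrt (Nat.cast_nonneg _), ← quartRoot_sq N,
    Function.comp_apply]
  simp only [quartRoot, div_eq_mul_inv, mul_inv, inv_pow]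
  ring

/-- For a subsequence `φ`, the map that sends `N` to the largest member of `φ` below `N`. -/
lemma exists_tendsto_retraction {φ : ℕ → ℕ} (hφ : StrictMono φ) :
    ∃ j : ℕ → ℕ, Tendsto j atTop atTop ∧ (∀ n, j (φ n) = n) ∧ ∀ᶠ N in atTop, φ (j N) ≤ N := by
  have hle : ∀ N, φ 0 ≤ N → φ (Nat.findGreatest (fun n => φ n ≤ N) N) ≤ N := fun N hN =>
    Nat.findGreatest_spec (P := fun n => φ n ≤ N) (Nat.zero_le N) hN
  have hge : ∀ n N, φ n ≤ N → n ≤ Nat.findGreatest (fun n => φ n ≤ N) N := fun n N h =>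
    Nat.le_findGreatest ((hφ.id_le n).trans h) h
  refine ⟨fun N => Nat.findGreatest (fun n => φ n ≤ N) N, ?_, fun n => ?_, ?_⟩
  · exact tendsto_atTop.2 fun n => (eventually_ge_atTop (φ n)).mono fun N h => hge n N h
  · refine le_antisymm ?_ (hge n _ le_rfl)
    exact hφ.le_iff_le.1 (hle (φ n) (hφ.monotone (Nat.zero_le n)))
  · exact (eventually_ge_atTop (φ 0)).mono hle

/-- Groups can only be detected if their size is at least of the order `√N`. -/
theorem isBigO_card_of_detects (hε : Errors μ x ε σ2) (hReg : Regressors μ x G S SG)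
    (hAlt : LocalAlternative G γ lam m₀)
    (hU : ∀ k, PLim μ (fun N ω => groupAvg (range N) fun i => unitU (x i ω) k) (U k))
    (hUG : ∀ k, PLim μ (fun N ω => groupAvg (G N) fun i => unitU (x i ω) k) (UG k))
    (hV : PLim μ (fun N ω => groupAvg (range N) fun i => σ2 i ^ 2 • unitV (x i ω)) V)
    (hVpos : V.PosDef) (hdet : Detects μ K (panelLM x ε β lam G γ)) :
    (fun N : ℕ => √(N : ℝ)) =O[atTop] (fun N => (#(G N) : ℝ)) := by
  by_contra hO
  obtain ⟨q, hq⟩ := hdet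
  have hK : 0 < K := by
    obtain ⟨k, -⟩ := Function.ne_iff.1 hAlt.ne_zero
    exact k.pos
  -- The failure of every constant `n` in the bound lets `φ` be chosen with `n · M < √N` at its
  -- `n`-th member.
  have hfreq : ∀ n : ℕ, ∃ᶠ N in atTop, (n : ℝ) * #(G N) < √(N : ℝ) := fun n hn => hO <| by
    refine Asymptotics.IsBigO.of_bound n (hn.mono fun N hN => ?_)
    rw [Real.norm_of_nonneg (Real.sqrt_nonneg _), Real.norm_of_nonneg (Nat.cast_nonneg _)]
    exact not_lt.1 hN
  obtain ⟨φ, hφ, hφG⟩ := extraction_forall_of_frequently hfreq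
  obtain ⟨j, hj, hjφ, hjle⟩ := exists_tendsto_retraction hφ
  -- The value `0` before the subsequence starts ensures `ψ N ≤ N` for every `N`, so that the groups
  -- chosen below lie among the first `N` units.
  let ψ : ℕ → ℕ := fun N => if φ (j N) ≤ N then φ (j N) else 0
  have hψeq : ψ =ᶠ[atTop] φ ∘ j := hjle.mono fun N hN => if_pos hN
  have hψ : Tendsto ψ atTop atTop := (hφ.tendsto_atTop.comp hj).congr' hψeq.symm
  have hψle : ∀ N, ψ N ≤ N := fun N => by
    simp only [ψ]
    split_ifs with h
    · exact h
    · exact Nat.zero_le N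
  -- The limit theorem is about full sequences, so the gaps are filled: between two members of `φ`
  -- the group of the earlier one is kept. `G'` agrees with `G` along `φ`, and the size bound at an
  -- earlier index is stronger than at `N`.
  let G' : ℕ → Finset ℕ := fun N => G (ψ N)
  have hG'φ : ∀ n, G' (φ n) = G (φ n) := fun n => by simp [G', ψ, hjφ]
  have hlittle : (fun N => (#(G' N) : ℝ)) =o[atTop] (fun N : ℕ => √(N : ℝ)) := by
    refine Asymptotics.isLittleO_iff.2 fun c hc => ?_
    filter_upwards [hjle, (tendsto_natCast_atTop_atTop.comp hj).eventually_ge_atTop c⁻¹] with N h1 h2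
    have h3 : G' N = G (φ (j N)) := by simp [G', ψ, h1]
    rw [Real.norm_of_nonneg (Nat.cast_nonneg _), Real.norm_of_nonneg (Real.sqrt_nonneg _), h3]
    have h4 := (hφG (j N)).le.trans (Real.sqrt_le_sqrt (Nat.cast_le.2 h1))
    have h5 := (mul_le_mul_of_nonneg_right h2 (Nat.cast_nonneg #(G (φ (j N))))).trans h4
    rwa [inv_mul_le_iff₀ hc] at h5
  have hAlt' : LocalAlternative G' γ lam 0 := by
    refine ⟨fun N => (hAlt.subset _).trans (range_subset_range.2 (hψle N)), hAlt.size.comp hψ, ?_,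
      le_rfl, one_pos, hAlt.ne_zero, hAlt.scale⟩
    refine squeeze_zero' (.of_forall fun N => by positivity) ?_ hlittle.tendsto_div_nhds_zero
    filter_upwards [eventually_ge_atTop 1] with N hN
    have hN1 : (1 : ℝ) ≤ N := Nat.one_le_cast.2 hN
    exact div_le_div_of_nonneg_left (Nat.cast_nonneg _) (Real.sqrt_pos.2 (by linarith))
      (Real.sqrt_le_iff.2 ⟨by linarith, by nlinarith⟩)
  -- Averages over `G'` are those over `G` at the index `ψ N`, so they inherit their limits because
  -- `ψ` diverges.
  have hReg' : Regressors μ x G' S SG := ⟨hReg.measurable, hReg.moments, hReg.plim, hReg.posDef,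
    fun k l => (hReg.plim_group k l).comp hψ, hReg.posDef_group⟩
  have hlim := tendsto_measure_of_tendstoInDistribution (tendstoInDistribution_panelLM_zero (β := β)
    hε hReg' hAlt' hU (fun k i l => (hUG k i l).comp hψ) hV hVpos
    (tendsto_detectionRate_of_isLittleO hAlt.scale hlittle)) (chiSq_singleton hK q)
  have hsub := hlim.comp hφ.tendsto_atTop
  have heq : ∀ n, {ω | q < panelLM x ε β lam G' γ (φ n) ω} =
      {ω | q < panelLM x ε β lam G γ (φ n) ω} := fun n => by
    simp only [panelLM, slope, hG'φ]
  -- A lower limit cannot exceed the one along `φ`. There the two panels coincide, and the rejection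
  -- probability tends to the chi-squared tail.
  have hle : liminf (fun N => μ {ω | q < panelLM x ε β lam G γ N ω}) atTop ≤
      liminf (fun N => μ {ω | q < panelLM x ε β lam G γ N ω}) (map φ atTop) :=
    liminf_le_liminf_of_le hφ.tendsto_atTop
  have hval : liminf (fun N => μ {ω | q < panelLM x ε β lam G γ N ω}) (map φ atTop) =
      chiSq K (Set.Ioi q) := by
    refine Tendsto.liminf_eq (tendsto_map'_iff.2 (hsub.congr fun n => ?_))
    exact congrArg μ (heq n)
  exact absurd hq (not_lt.2 (hle.trans hval.le))

end Undetectable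

end PanelLM

end

theorem corollary2 {Ω : Type*} [MeasurableSpace Ω] (μ : Measure Ω) [IsProbabilityMeasure μ]
    {T K : ℕ} (x : ℕ → Ω → Fin T → Fin K → ℝ) (ε : ℕ → Ω → Fin T → ℝ) (σ2 : ℕ → ℝ)
    (β lam : Fin K → ℝ) (G : ℕ → Finset ℕ) (γ : ℕ → ℝ) (m₀ : ℝ)
    (S SG V : Matrix (Fin K) (Fin K) ℝ) (U UG : Fin K → Matrix (Fin K) (Fin K) ℝ)
    (hErr : PanelLM.Errors μ x ε σ2)
    (hReg : PanelLM.Regressors μ x G S SG)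
    (hAlt : PanelLM.LocalAlternative G γ lam m₀)
    (hU : ∀ k, PanelLM.PLim μ
      (fun N ω => PanelLM.groupAvg (range N) fun i => PanelLM.unitU (x i ω) k) (U k))
    (hUG : ∀ k, PanelLM.PLim μ
      (fun N ω => PanelLM.groupAvg (G N) fun i => PanelLM.unitU (x i ω) k) (UG k))
    (hV : PanelLM.PLim μ
      (fun N ω => PanelLM.groupAvg (range N) fun i => σ2 i ^ 2 • PanelLM.unitV (x i ω)) V)
    (hVpos : V.PosDef) :
    let LM : ℕ → Ω → ℝ := PanelLM.panelLM x ε β lam G γ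
    let rate : ℕ → ℝ := fun N => √(#(G N) : ℝ) / (γ N * (N : ℝ) ^ (1 / 4 : ℝ))
    let d : Fin K → ℝ := PanelLM.drift m₀ lam S SG U UG
    -- the three regimes
    (Tendsto rate atTop (𝓝 0) →
      TendstoInDistribution LM atTop id (fun _ => μ) (PanelLM.chiSq K)) ∧
    (∀ c : ℝ, 0 < c → Tendsto rate atTop (𝓝 c) →
      let δ : Fin K → ℝ := c ^ 2 • d
      TendstoInDistribution LM atTop id (fun _ => μ)
        (PanelLM.noncentralChiSq K (δ ⬝ᵥ (V⁻¹ *ᵥ δ)))) ∧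
    (d ≠ 0 → Tendsto rate atTop atTop →
      ∀ B : ℝ, Tendsto (fun N => μ {ω | B < LM N ω}) atTop (𝓝 1)) ∧
    -- below the order `√N` the group is undetectable, and detection needs at least this order
    ((fun N => (#(G N) : ℝ)) =o[atTop] (fun N : ℕ => √(N : ℝ)) →
      TendstoInDistribution LM atTop id (fun _ => μ) (PanelLM.chiSq K)) ∧
    (PanelLM.Detects μ K LM →
      (fun N : ℕ => √(N : ℝ)) =O[atTop] (fun N => (#(G N) : ℝ))) := by
  refine ⟨fun h => ?_, fun c _ h => ?_, fun hd h B => ?_, fun h => ?_, fun h => ?_⟩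
  · exact PanelLM.tendstoInDistribution_panelLM_zero hErr hReg hAlt hU hUG hV hVpos h
  · exact PanelLM.tendstoInDistribution_panelLM hErr hReg hAlt hU hUG hV hVpos rfl h
  · exact PanelLM.tendsto_measure_lt_panelLM hErr hReg hAlt hU hUG hV hVpos hd h B
  · exact PanelLM.tendstoInDistribution_panelLM_zero hErr hReg hAlt hU hUG hV hVpos
      (PanelLM.tendsto_detectionRate_of_isLittleO hAlt.scale h)
  · exact PanelLM.isBigO_card_of_detects hErr hReg hAlt hU hUG hV hVpos h
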